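/- For an integer $n$, let $c_5(n)$ be the number of partitions of $n$ that are $5$-cores (partitions none of whose hook numbers is divisible by $5$). With $$\varphi(-q)=\sum_{n=-\infty}^{\infty}(-1)^nq^{n^2},\qquad \psi(-q)=\sum_{n=0}^{\infty}(-q)^{n(n+1)/2},$$ define $\overline{a}_5(n)$ and $\overline{b}_5(n)$ by $$\sum_{n=0}^{\infty}\overline{a}_5(n)q^n=\frac{\varphi^5(-q^5)}{\varphi(-q)},\qquad \sum_{n=0}^{\infty}\overline{b}_5(n)q^n=\frac{\psi^5(-q^5)}{\psi(-q)},$$ and put $c_5(n)=\overline{a}_5(n)=\overline{b}_5(n)=0$ for $n<0$. Then for every integer $n\ge 0$, \begin{align*} \overline{b}_5(4n+1) &= c_5(n)-2\overline{b}_5(2n-1),\\ \overline{b}_5(10n) &= \tfrac12 c_5(10n+2),\\ \overline{b}_5(10n+1) &= c_5(5n+1),\\ \overline{b}_5(10n+2) &= \tfrac14\overline{a}_5(2n+1)+\tfrac12 c_5(2n),\\ \overline{b}_5(10n+3) &= c_5(5n+2),\\ \overline{b}_5(10n+4) &= \tfrac12 c_5(10n+6),\\ \overline{b}_5(10n+6)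 &= 0,\\ \overline{b}_5(10n+8) &= 0,\\ \overline{b}_5(20n+5) &= -c_5(5n+1),\\ \overline{b}_5(20n+7) &= \tfrac12\overline{a}_5(2n+1)+c_5(2n),\\ \overline{b}_5(20n+9) &= -c_5(5n+2),\\ \overline{b}_5(20n+15) &= 0,\\ \overline{b}_5(20n+19) &= 0. \end{align*} -/

import Mathlib

open scoped PowerSeries PowerSeries.WithPiTopology

/-! ### `t`-cores -/

/-- The hook number of the node `(i, j)` of a Young diagram (rows and columns numbered from `0`):
the number of nodes to its right in row `i`, plus the number of nodes below it in column `j`,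
plus one for the node itself. -/
def hookNumber (μ : YoungDiagram) (i j : ℕ) : ℕ :=
  (μ.rowLen i - (j + 1)) + (μ.colLen j - (i + 1)) + 1

/-- A partition is a `t`-core if none of its hook numbers is divisible by `t`. -/
def IsTCore (t : ℕ) (μ : YoungDiagram) : Prop :=
  ∀ i j : ℕ, (i, j) ∈ μ → ¬ t ∣ hookNumber μ i j

/-- The partitions of `n` that are `t`-cores (there are none for `n < 0`). -/
def tCores (t : ℕ) (n : ℤ) : Set YoungDiagram :=
  {μ | (μ.card : ℤ) = n ∧ IsTCore t μ}

theorem tCores_finite (t : ℕ) (n : ℤ) : (tCores t n).Finite := by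
  have hfin : (Set.range fun s : (Finset.range n.toNat ×ˢ Finset.range n.toNat).powerset =>
      (s : Finset (ℕ × ℕ))).Finite := Set.finite_range _
  refine Set.Finite.of_finite_image (f := YoungDiagram.cells) (hfin.subset ?_)
    (fun a _ b _ h => YoungDiagram.ext h)
  rintro _ ⟨μ, ⟨hc, -⟩, rfl⟩
  refine ⟨⟨μ.cells, Finset.mem_powerset.2 ?_⟩, rfl⟩
  rintro ⟨i, j⟩ hij
  have hij' : (i, j) ∈ μ := hij
  have h1 : j < μ.rowLen i := YoungDiagram.mem_iff_lt_rowLen.1 hij'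
  have h2 : i < μ.colLen j := YoungDiagram.mem_iff_lt_colLen.1 hij'
  have h3 : μ.rowLen i ≤ μ.card := by
    rw [YoungDiagram.rowLen_eq_card]; exact Finset.card_le_card (Finset.filter_subset _ _)
  have h4 : μ.colLen j ≤ μ.card := by
    rw [YoungDiagram.colLen_eq_card]; exact Finset.card_le_card (Finset.filter_subset _ _)
  simp only [Finset.mem_product, Finset.mem_range]
  omega

/-- `c₅(n)`, the number of `5`-cores of `n`. -/
noncomputable def c5 (n : ℤ) : ℤ := ((tCores 5 n).ncard : ℤ)

/-! ### Theta functions, as formal power series in `q = X` -/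

/-- Ramanujan's general theta function `f(a, b) = ∑_{n ∈ ℤ} a ^ (n(n+1)/2) * b ^ (n(n-1)/2)`,
for power series `a`, `b` without constant term (both exponents are nonnegative integers). -/
noncomputable def ramanujanTheta (a b : ℤ⟦X⟧) : ℤ⟦X⟧ :=
  ∑' n : ℤ, a ^ (n * (n + 1) / 2).toNat * b ^ (n * (n - 1) / 2).toNat

/-- `φ(-q^k) = f(-q^k, -q^k)`. -/
noncomputable def phiNeg (k : ℕ) : ℤ⟦X⟧ :=
  ramanujanTheta (-PowerSeries.X ^ k) (-PowerSeries.X ^ k)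

/-- `ψ(-q^k) = f(-q^k, -q^{3k})`. -/
noncomputable def psiNeg (k : ℕ) : ℤ⟦X⟧ :=
  ramanujanTheta (-PowerSeries.X ^ k) (-PowerSeries.X ^ (3 * k))

theorem exists_exponents (n : ℤ) :
    (n * (n + 1) / 2).toNat + (n * (n - 1) / 2).toNat = n.natAbs ^ 2 := by
  obtain ⟨u, hu⟩ := Int.even_mul_succ_self n
  have h1 : n * (n + 1) / 2 = u := by omega
  have h2 : n * (n - 1) / 2 = u - n := by
    have : n * (n - 1) = 2 * (u - n) := by linear_combination hu
    omega
  have h3 : 0 ≤ u := by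
    rcases le_or_gt 0 n with h | h
    · nlinarith
    · nlinarith
  have h4 : 0 ≤ u - n := by
    rcases le_or_gt n 0 with h | h
    · omega
    · nlinarith
  zify
  rw [h1, h2, Int.toNat_of_nonneg h3, Int.toNat_of_nonneg h4, sq_abs]
  linear_combination -hu

theorem coeff_thetaTerm {a b : ℤ⟦X⟧} (ha : PowerSeries.constantCoeff a = 0)
    (hb : PowerSeries.constantCoeff b = 0) (n : ℤ) (m : ℕ) (h : m < n.natAbs ^ 2) :
    PowerSeries.coeff m
      (a ^ (n * (n + 1) / 2).toNat * b ^ (n * (n - 1) / 2).toNat) = 0 := by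
  have hdvd : (PowerSeries.X : ℤ⟦X⟧) ^ (n.natAbs ^ 2) ∣
      a ^ (n * (n + 1) / 2).toNat * b ^ (n * (n - 1) / 2).toNat := by
    rw [← exists_exponents n, pow_add]
    exact mul_dvd_mul (pow_dvd_pow_of_dvd (PowerSeries.X_dvd_iff.2 ha) _)
      (pow_dvd_pow_of_dvd (PowerSeries.X_dvd_iff.2 hb) _)
  exact PowerSeries.X_pow_dvd_iff.1 hdvd m h

/-- The series defining `f(a, b)` converges coefficientwise. -/
theorem summable_ramanujanTheta {a b : ℤ⟦X⟧} (ha : PowerSeries.constantCoeff a = 0)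
    (hb : PowerSeries.constantCoeff b = 0) :
    Summable fun n : ℤ => a ^ (n * (n + 1) / 2).toNat * b ^ (n * (n - 1) / 2).toNat := by
  rw [PowerSeries.WithPiTopology.summable_iff_summable_coeff]
  intro m
  refine summable_of_ne_finset_zero (s := Finset.Icc (-(m : ℤ)) m) fun n hn =>
    coeff_thetaTerm ha hb n m ?_
  have : m < n.natAbs := by
    rw [Finset.mem_Icc] at hn
    omega
  nlinarith

theorem constantCoeff_ramanujanTheta {a b : ℤ⟦X⟧} (ha : PowerSeries.constantCoeff a = 0)
    (hb : PowerSeries.constantCoeff b = 0) :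
    PowerSeries.constantCoeff (ramanujanTheta a b) = 1 := by
  have h := (PowerSeries.WithPiTopology.hasSum_iff_hasSum_coeff ℤ).1
    (summable_ramanujanTheta ha hb).hasSum 0
  have h' := hasSum_single (f := fun n : ℤ => PowerSeries.coeff 0
      (a ^ (n * (n + 1) / 2).toNat * b ^ (n * (n - 1) / 2).toNat)) 0 (fun n hn =>
    coeff_thetaTerm ha hb n 0 (by positivity))
  have h2 := h.unique h'
  simpa [ramanujanTheta] using h2

/-! ### The sequences `ā₅` and `b̄₅` -/

/-- `φ(-q^5)^5 / φ(-q)`. -/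
noncomputable def a5Series : ℤ⟦X⟧ := phiNeg 5 ^ 5 * PowerSeries.invOfUnit (phiNeg 1) 1

/-- `ψ(-q^5)^5 / ψ(-q)`. -/
noncomputable def b5Series : ℤ⟦X⟧ := psiNeg 5 ^ 5 * PowerSeries.invOfUnit (psiNeg 1) 1

theorem a5Series_mul : a5Series * phiNeg 1 = phiNeg 5 ^ 5 := by
  have h : PowerSeries.constantCoeff (phiNeg 1) = ((1 : ℤˣ) : ℤ) := by
    rw [phiNeg, constantCoeff_ramanujanTheta] <;> simp
  rw [a5Series, mul_assoc, mul_comm (PowerSeries.invOfUnit _ _),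
    PowerSeries.mul_invOfUnit _ _ h, mul_one]

theorem b5Series_mul : b5Series * psiNeg 1 = psiNeg 5 ^ 5 := by
  have h : PowerSeries.constantCoeff (psiNeg 1) = ((1 : ℤˣ) : ℤ) := by
    rw [psiNeg, constantCoeff_ramanujanTheta] <;> simp
  rw [b5Series, mul_assoc, mul_comm (PowerSeries.invOfUnit _ _),
    PowerSeries.mul_invOfUnit _ _ h, mul_one]

/-- `ā₅(n)`, the coefficient of `q^n` in `φ(-q^5)^5 / φ(-q)`, and `0` for `n < 0`. -/
noncomputable def a5 (n : ℤ) : ℤ := if 0 ≤ n then PowerSeries.coeff n.toNat a5Series else 0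

/-- `b̄₅(n)`, the coefficient of `q^n` in `ψ(-q^5)^5 / ψ(-q)`, and `0` for `n < 0`. -/
noncomputable def b5 (n : ℤ) : ℤ := if 0 ≤ n then PowerSeries.coeff n.toNat b5Series else 0

/-! ### Infinite products of formal power series -/

section FormalProducts

open PowerSeries Finset

variable {R S : Type*} [CommRing R] [CommRing S]

/-! Write f_k = ∏ (1 - q^(km)), χ for the quadratic character mod 5, σ_A(n) = ∑_{d∣n} d χ(n/d) and
σ_B(n) = ∑_{d∣n} d χ(d). Every sequence in the theorem is expressed through these two divisor sums;
what remains is arithmetic mod 2 and mod 5.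

Replacing q by -q turns the series of b̄₅ into ψ(q⁵)⁵/ψ(q). Both q³ψ(q⁵)⁵/ψ(q) and φ(-q⁵)⁵/φ(-q) are
linear combinations of the Eisenstein series A = ∑ σ_A(n) qⁿ and B = 1 - 5 ∑ σ_B(n) qⁿ and of their
images under q ↦ q² (`eisenstein_expansions`). This needs no modular forms: by Ramanujan, A = q
f₅⁵/f₁ and B = f₁⁵/f₅, and after division by A all the series become rational functions of t = q
f₁f₁₀⁵/(f₂f₅⁵), because 1 + t and 1 - 4t are eta quotients as well (`level_ten_relations`).

The formulas for 1 + t and 1 - 4t amount to product formulas for ψ(q)² - qψ(q⁵)² and φ(-q)² -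
φ(-q⁵)². They come from the Gaussian integers: multiplication by 1 + 2i scales norms by 5, and the
quarter turn permutes the four nonzero classes mod 5 of its image, so each class carries a quarter
of the sum (`four_mul_theta2_class`). Ramanujan's two identities come from the same lattice with
weight χ₄(x)χ₄(y)(x² - y²). Its theta series is a Wronskian of two one-variable theta functions and
evaluates to a sixth power of an Euler product; by the Jacobi triple product the Wronskian is also a
product times a difference of logarithmic derivatives, that is, a Lambert series. The
Rogers–Ramanujan theta functions give B, and theta functions at fifth roots of unity give A.

On a five-runner abacus the 5-cores become integer vectors (v₀, …, v₄) of sum 0. Their generating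
function is the constant term of a product of five theta functions, equal to f₅⁵/f₁ = A/q; hence
c₅(n) = σ_A(n+1) (`c5_natCast`).

With D = σ_A - σ_B one gets 4 b̄₅(2k) = D(2k+3) and 2 b̄₅(2k+1) = D(k+2) - D((k+2)/2), the last term
being absent for odd k. Away from multiples of 5, σ_B = χσ_A, so D vanishes at n ≡ ±1 and equals
2σ_A at n ≡ ±2 (mod 5), while D(5n) = 5σ_A(n) - σ_B(n). The first identity is the Hecke relation at
2; each of the others is a choice of residue class. -/

theorem PowerSeries.eq_of_forall_X_pow_dvd_sub {f g : R⟦X⟧}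
    (h : ∀ N, (X : R⟦X⟧) ^ N ∣ f - g) : f = g := by
  ext n
  have := X_pow_dvd_iff.1 (h (n + 1)) n (by omega)
  rw [map_sub] at this
  exact sub_eq_zero.1 this

theorem PowerSeries.coeff_eq_of_X_pow_dvd_sub {f g : R⟦X⟧} {N n : ℕ}
    (h : (X : R⟦X⟧) ^ N ∣ f - g) (hn : n < N) : coeff n f = coeff n g := by
  have := X_pow_dvd_iff.1 h n hn
  rw [map_sub] at this
  exact sub_eq_zero.1 this

theorem PowerSeries.X_pow_dvd_sub_of_coeff_eq {f g : R⟦X⟧} {N : ℕ}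
    (h : ∀ n < N, coeff n f = coeff n g) : (X : R⟦X⟧) ^ N ∣ f - g :=
  X_pow_dvd_iff.2 fun n hn => by rw [map_sub, h n hn, sub_self]

theorem dvd_mul_sub_mul_of_dvd {A : Type*} [CommRing A] {d a b c e : A} (h₁ : d ∣ a - b)
    (h₂ : d ∣ c - e) : d ∣ a * c - b * e := by
  have : a * c - b * e = (a - b) * c + b * (c - e) := by ring
  rw [this]
  exact dvd_add (h₁.mul_right _) (h₂.mul_left _)

/-- The families of power series whose infinite product converges because the `m`-th factor is
`1` modulo `X ^ m`. -/
def Admissible (f : ℕ → R⟦X⟧) : Prop := ∀ m, (X : R⟦X⟧) ^ m ∣ f m - 1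

/-- The formal infinite product `∏ m, f m` of an admissible family. -/
noncomputable def prodX (f : ℕ → R⟦X⟧) : R⟦X⟧ :=
  PowerSeries.mk fun n => coeff n (∏ m ∈ range (n + 1), f m)

theorem Admissible.mul {f g : ℕ → R⟦X⟧} (hf : Admissible f) (hg : Admissible g) :
    Admissible fun m => f m * g m := fun m => by
  simpa using dvd_mul_sub_mul_of_dvd (hf m) (hg m)

theorem admissible_one_add {u : ℕ → R⟦X⟧} {e : ℕ → ℕ} (he : ∀ m, m ≤ e m) :
    Admissible fun m => 1 + u m * X ^ e m := fun m => by
  rw [add_sub_cancel_left]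
  exact (pow_dvd_pow _ (he m)).mul_left _

theorem admissible_one_sub {e : ℕ → ℕ} (he : ∀ m, m ≤ e m) :
    Admissible fun m => (1 : R⟦X⟧) - X ^ e m := fun m => by
  rw [sub_sub_cancel_left]
  exact (dvd_neg.2 (pow_dvd_pow _ (he m)))

theorem Admissible.prod {ι : Type*} {s : Finset ι} {f : ι → ℕ → R⟦X⟧}
    (hf : ∀ i ∈ s, Admissible (f i)) : Admissible fun m => ∏ i ∈ s, f i m := by
  classical
  induction s using Finset.induction_on with
  | empty => intro m; simp
  | insert i s hi ih =>
    simp only [prod_insert hi]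
    exact (hf i (by simp)).mul (ih fun j hj => hf j (by simp [hj]))

/-- Factors with index at least N are 1 modulo X ^ N, so partial products stabilise; this justifies
the truncation at n + 1 in `prodX`. The factor of index 0 is unconstrained and may have any constant
term. -/
theorem Admissible.dvd_prod_range_sub {f : ℕ → R⟦X⟧} (hf : Admissible f) {N M : ℕ} (h : N ≤ M) :
    (X : R⟦X⟧) ^ N ∣ ∏ m ∈ range M, f m - ∏ m ∈ range N, f m := by
  induction M, h using Nat.le_induction with
  | base => simp
  | succ M hM ih =>
    rw [prod_range_succ]
    simpa using dvd_mul_sub_mul_of_dvd ih ((pow_dvd_pow _ hM).trans (hf M))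

theorem Admissible.coeff_prodX {f : ℕ → R⟦X⟧} (hf : Admissible f) {n M : ℕ} (h : n < M) :
    coeff n (prodX f) = coeff n (∏ m ∈ range M, f m) := by
  rw [prodX, coeff_mk]
  exact (coeff_eq_of_X_pow_dvd_sub (hf.dvd_prod_range_sub h) (by omega)).symm

theorem Admissible.dvd_prodX_sub {f : ℕ → R⟦X⟧} (hf : Admissible f) {N M : ℕ} (h : N ≤ M) :
    (X : R⟦X⟧) ^ N ∣ prodX f - ∏ m ∈ range M, f m :=
  X_pow_dvd_sub_of_coeff_eq fun _ hn => hf.coeff_prodX (by omega)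

theorem Admissible.prodX_eq {f : ℕ → R⟦X⟧} (hf : Admissible f) {g : R⟦X⟧}
    (h : ∀ N, ∃ M, N ≤ M ∧ (X : R⟦X⟧) ^ N ∣ g - ∏ m ∈ range M, f m) : prodX f = g := by
  refine eq_of_forall_X_pow_dvd_sub fun N => ?_
  obtain ⟨M, hM, h⟩ := h N
  have := dvd_sub (hf.dvd_prodX_sub hM) h
  rwa [sub_sub_sub_cancel_right] at this

theorem prodX_mul {f g : ℕ → R⟦X⟧} (hf : Admissible f) (hg : Admissible g) :
    prodX (fun m => f m * g m) = prodX f * prodX g :=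
  (hf.mul hg).prodX_eq fun N => ⟨N, le_rfl, by
    rw [prod_mul_distrib]
    exact dvd_mul_sub_mul_of_dvd (hf.dvd_prodX_sub le_rfl) (hg.dvd_prodX_sub le_rfl)⟩

theorem prodX_one : prodX (fun _ => (1 : R⟦X⟧)) = 1 :=
  Admissible.prodX_eq (fun m => by simp) fun N => ⟨N, le_rfl, by simp⟩

theorem prodX_prod {ι : Type*} {s : Finset ι} {f : ι → ℕ → R⟦X⟧}
    (hf : ∀ i ∈ s, Admissible (f i)) :
    prodX (fun m => ∏ i ∈ s, f i m) = ∏ i ∈ s, prodX (f i) := by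
  classical
  induction s using Finset.induction_on with
  | empty => simpa using prodX_one
  | insert i s hi ih =>
    simp only [prod_insert hi]
    rw [prodX_mul (hf i (by simp)) (Admissible.prod fun j hj => hf j (by simp [hj])),
      ih fun j hj => hf j (by simp [hj])]

/-- The factors of an infinite product may be grouped into blocks of length `s`. -/
theorem prodX_block {f : ℕ → R⟦X⟧} (hf : Admissible f) {s : ℕ} (hs : 0 < s) :
    prodX (fun m => ∏ r ∈ range s, f (s * m + r)) = prodX f := by
  have hadm : Admissible fun m => ∏ r ∈ range s, f (s * m + r) :=
    Admissible.prod fun r _ m => (pow_dvd_pow _ (by nlinarith)).trans (hf _)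
  refine hadm.prodX_eq fun N => ⟨N, le_rfl, ?_⟩
  have : ∏ m ∈ range N, ∏ r ∈ range s, f (s * m + r) = ∏ m ∈ range (s * N), f m := by
    induction N with
    | zero => simp
    | succ N ih => rw [prod_range_succ, ih, Nat.mul_succ, prod_range_add]
  rw [this]
  exact hf.dvd_prodX_sub (by nlinarith)

theorem prodX_succ {f : ℕ → R⟦X⟧} (hf : Admissible f) :
    prodX f = f 0 * prodX fun m => f (m + 1) := by
  have hadm : Admissible fun m => f (m + 1) := fun m => (pow_dvd_pow _ (by omega)).trans (hf _)
  refine hf.prodX_eq fun N => ⟨N + 1, by omega, ?_⟩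
  rw [prod_range_succ', mul_comm _ (f 0), ← mul_sub]
  exact (hadm.dvd_prodX_sub le_rfl).mul_left _

theorem map_prodX (φ : R →+* S) (f : ℕ → R⟦X⟧) :
    PowerSeries.map φ (prodX f) = prodX fun m => PowerSeries.map φ (f m) := by
  ext n
  rw [coeff_map, prodX, prodX, coeff_mk, coeff_mk, ← map_prod, coeff_map]

theorem Admissible.expand {f : ℕ → R⟦X⟧} (hf : Admissible f) {k : ℕ} (hk : k ≠ 0) :
    Admissible fun m => PowerSeries.expand k hk (f m) := fun m => by
  have := _root_.map_dvd (PowerSeries.expand (R := R) k hk) (hf m)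
  rw [map_sub, map_pow, expand_X, map_one, ← pow_mul] at this
  exact (pow_dvd_pow _ (Nat.le_mul_of_pos_left m (Nat.pos_of_ne_zero hk))).trans this

theorem expand_prodX {f : ℕ → R⟦X⟧} (hf : Admissible f) {k : ℕ} (hk : k ≠ 0) :
    PowerSeries.expand k hk (prodX f) = prodX fun m => PowerSeries.expand k hk (f m) := by
  symm
  refine (hf.expand hk).prodX_eq fun N => ⟨N, le_rfl, ?_⟩
  rw [← map_prod, ← map_sub]
  have := _root_.map_dvd (PowerSeries.expand (R := R) k hk) (hf.dvd_prodX_sub (le_refl N))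
  rw [map_pow, expand_X, ← pow_mul] at this
  exact (pow_dvd_pow _ (Nat.le_mul_of_pos_left N (Nat.pos_of_ne_zero hk))).trans this

theorem Admissible.constantCoeff_prodX {f : ℕ → R⟦X⟧} :
    constantCoeff (prodX f) = constantCoeff (f 0) := by
  rw [← coeff_zero_eq_constantCoeff_apply, prodX, coeff_mk]
  simp

/-- Euler's product `∏ (1 - q ^ (k m))`, `m ≥ 1`. -/
noncomputable def eulerProd (R : Type*) [CommRing R] (k : ℕ) : R⟦X⟧ :=
  prodX fun m => 1 - X ^ (k * (m + 1))

theorem admissible_eulerProd {k : ℕ} (hk : 0 < k) :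
    Admissible fun m => (1 : R⟦X⟧) - X ^ (k * (m + 1)) :=
  admissible_one_sub fun m => by nlinarith

theorem map_eulerProd (φ : R →+* S) (k : ℕ) :
    PowerSeries.map φ (eulerProd R k) = eulerProd S k := by
  rw [eulerProd, map_prodX, eulerProd]
  simp

theorem expand_eulerProd {k l : ℕ} (hk : 0 < k) (hl : l ≠ 0) :
    PowerSeries.expand l hl (eulerProd R k) = eulerProd R (l * k) := by
  rw [eulerProd, expand_prodX (admissible_eulerProd hk), eulerProd]
  congr 1
  ext1 m
  rw [map_sub, map_one, map_pow, expand_X, ← pow_mul, mul_assoc]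

theorem constantCoeff_eulerProd {k : ℕ} (hk : 0 < k) : constantCoeff (eulerProd R k) = 1 := by
  rw [eulerProd, Admissible.constantCoeff_prodX]
  simp [hk.ne']

theorem eulerProd_ne_zero [Nontrivial R] {k : ℕ} (hk : 0 < k) : eulerProd R k ≠ 0 := by
  intro h
  have := constantCoeff_eulerProd (R := R) hk
  simp [h] at this

end FormalProducts

/-! ### Sums of monomials over arbitrary index sets -/

section LatticeSums

open PowerSeries Finset

variable {R S : Type*} [CommRing R] [CommRing S] {ι κ : Type*}

/-- The formal sum `∑ i, c i * X ^ e i`, for exponents `e` with finite fibres. -/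
noncomputable def latSum (c : ι → R) (e : ι → ℕ) : R⟦X⟧ :=
  PowerSeries.mk fun N => ∑ᶠ i, if e i = N then c i else 0

/-- Only finitely many terms of each given degree. -/
def FiniteFibers (e : ι → ℕ) : Prop := ∀ N, {i | e i < N}.Finite

theorem coeff_latSum (c : ι → R) (e : ι → ℕ) (N : ℕ) :
    coeff N (latSum c e) = ∑ᶠ i, if e i = N then c i else 0 := by
  rw [latSum, coeff_mk]

theorem coeff_latSum_eq_sum (c : ι → R) {e : ι → ℕ} {N : ℕ} {s : Finset ι}
    (hs : ∀ i, e i = N → i ∈ s) :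
    coeff N (latSum c e) = ∑ i ∈ s, if e i = N then c i else 0 := by
  rw [coeff_latSum]
  refine finsum_eq_sum_of_support_subset _ fun i hi => hs i ?_
  by_contra h
  simp [h] at hi

theorem X_pow_dvd_latSum_sub (c : ι → R) {e : ι → ℕ} {N : ℕ} {s : Finset ι}
    (hs : ∀ i, e i < N → i ∈ s) :
    (X : R⟦X⟧) ^ N ∣ latSum c e - ∑ i ∈ s, C (c i) * X ^ e i := by
  refine X_pow_dvd_sub_of_coeff_eq fun n hn => ?_
  rw [coeff_latSum_eq_sum c (s := s) fun i hi => hs i (by omega), map_sum]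
  refine sum_congr rfl fun i _ => ?_
  rw [coeff_C_mul, coeff_X_pow]
  by_cases h : e i = n
  · simp [h]
  · simp [h, Ne.symm h]

/-- The working criterion for formal sums: compare with a finite partial sum modulo X ^ N. The
finite set may be larger than necessary, which lets one set serve several series. -/
theorem latSum_eq {c : ι → R} {e : ι → ℕ} {g : R⟦X⟧}
    (h : ∀ N, ∃ s : Finset ι, (∀ i, e i < N → i ∈ s) ∧
      (X : R⟦X⟧) ^ N ∣ g - ∑ i ∈ s, C (c i) * X ^ e i) : latSum c e = g := by
  refine eq_of_forall_X_pow_dvd_sub fun N => ?_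
  obtain ⟨s, hs, h⟩ := h N
  have := dvd_sub (X_pow_dvd_latSum_sub c hs) h
  rwa [sub_sub_sub_cancel_right] at this

theorem FiniteFibers.exists_finset {e : ι → ℕ} (he : FiniteFibers e) (N : ℕ) :
    ∃ s : Finset ι, ∀ i, e i < N → i ∈ s :=
  ⟨(he N).toFinset, fun i hi => by simpa using hi⟩

theorem FiniteFibers.add {e : ι → ℕ} {e' : κ → ℕ} (he : FiniteFibers e) (he' : FiniteFibers e') :
    FiniteFibers fun p : ι × κ => e p.1 + e' p.2 := fun N =>
  ((he N).prod (he' N)).subset fun p hp => by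
    simp only [Set.mem_ofPred_eq, Set.mem_prod] at hp ⊢
    omega

theorem FiniteFibers.mono {e e' : ι → ℕ} (he : FiniteFibers e) (h : ∀ i, e i ≤ e' i) :
    FiniteFibers e' := fun N => (he N).subset fun i hi => (h i).trans_lt hi

theorem latSum_mul_latSum (c : ι → R) {e : ι → ℕ} (he : FiniteFibers e) (c' : κ → R)
    {e' : κ → ℕ} (he' : FiniteFibers e') :
    latSum c e * latSum c' e' =
      latSum (fun p : ι × κ => c p.1 * c' p.2) fun p => e p.1 + e' p.2 := by
  symm
  refine latSum_eq fun N => ?_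
  obtain ⟨s, hs⟩ := he.exists_finset N
  obtain ⟨t, ht⟩ := he'.exists_finset N
  refine ⟨s ×ˢ t, fun p hp => ?_, ?_⟩
  · rw [mem_product]
    exact ⟨hs _ (by omega), ht _ (by omega)⟩
  · have : ∑ p ∈ s ×ˢ t, C (c p.1 * c' p.2) * (X : R⟦X⟧) ^ (e p.1 + e' p.2) =
        (∑ i ∈ s, C (c i) * X ^ e i) * ∑ i ∈ t, C (c' i) * X ^ e' i := by
      rw [sum_mul_sum, sum_product]
      refine sum_congr rfl fun i _ => sum_congr rfl fun j _ => ?_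
      rw [map_mul, pow_add]
      ring
    rw [this]
    exact dvd_mul_sub_mul_of_dvd (X_pow_dvd_latSum_sub c hs) (X_pow_dvd_latSum_sub c' ht)

theorem latSum_add (c c' : ι → R) {e : ι → ℕ} (he : FiniteFibers e) :
    latSum (fun i => c i + c' i) e = latSum c e + latSum c' e := by
  refine latSum_eq fun N => ?_
  obtain ⟨s, hs⟩ := he.exists_finset N
  refine ⟨s, hs, ?_⟩
  simp only [map_add, add_mul, sum_add_distrib]
  rw [add_sub_add_comm]
  exact dvd_add (X_pow_dvd_latSum_sub c hs) (X_pow_dvd_latSum_sub c' hs)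

theorem latSum_const_mul (a : R) (c : ι → R) {e : ι → ℕ} (he : FiniteFibers e) :
    latSum (fun i => a * c i) e = C a * latSum c e := by
  refine latSum_eq fun N => ?_
  obtain ⟨s, hs⟩ := he.exists_finset N
  refine ⟨s, hs, ?_⟩
  simp only [map_mul, mul_assoc, ← mul_sum]
  rw [← mul_sub]
  exact (X_pow_dvd_latSum_sub c hs).mul_left _

theorem latSum_neg (c : ι → R) {e : ι → ℕ} (he : FiniteFibers e) :
    latSum (fun i => - c i) e = - latSum c e := by
  simpa using latSum_const_mul (-1) c he

theorem latSum_sub (c c' : ι → R) {e : ι → ℕ} (he : FiniteFibers e) :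
    latSum (fun i => c i - c' i) e = latSum c e - latSum c' e := by
  simp only [sub_eq_add_neg]
  rw [latSum_add c (fun i => - c' i) he, latSum_neg c' he]

theorem latSum_sum {α : Type*} (s : Finset α) (c : α → ι → R) {e : ι → ℕ} (he : FiniteFibers e) :
    latSum (fun i => ∑ a ∈ s, c a i) e = ∑ a ∈ s, latSum (c a) e := by
  classical
  induction s using Finset.induction_on with
  | empty =>
    ext N
    simp [coeff_latSum]
  | insert a s ha ih =>
    simp only [sum_insert ha]
    rw [latSum_add (c a) (fun i => ∑ b ∈ s, c b i) he, ih]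

/-- Reindexing along an injection whose image contains the support. This is how a sum restricted by
congruences becomes a sum over all integers. -/
theorem latSum_comp (c : ι → R) (e : ι → ℕ) {σ : κ → ι} (hσ : Function.Injective σ)
    (hc : ∀ i, i ∉ Set.range σ → c i = 0) :
    latSum (fun k => c (σ k)) (fun k => e (σ k)) = latSum c e := by
  ext N
  rw [coeff_latSum, coeff_latSum,
    ← finsum_mem_range (f := fun i => if e i = N then c i else 0) hσ]
  refine finsum_congr fun i => ?_
  by_cases hi : i ∈ Set.range σ
  · simp [hi]
  · simp [hi, hc i hi]

theorem latSum_comp_equiv (c : ι → R) (e : ι → ℕ) (σ : κ ≃ ι) :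
    latSum (fun k => c (σ k)) (fun k => e (σ k)) = latSum c e :=
  latSum_comp c e σ.injective fun i hi => absurd (σ.surjective i) hi

theorem X_pow_mul_latSum (c : ι → R) {e : ι → ℕ} (he : FiniteFibers e) (j : ℕ) :
    X ^ j * latSum c e = latSum c fun i => e i + j := by
  symm
  refine latSum_eq fun N => ?_
  obtain ⟨s, hs⟩ := he.exists_finset N
  refine ⟨s, fun i hi => hs i (by omega), ?_⟩
  have : ∑ i ∈ s, C (c i) * (X : R⟦X⟧) ^ (e i + j) = X ^ j * ∑ i ∈ s, C (c i) * X ^ e i := by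
    rw [mul_sum]
    refine sum_congr rfl fun i _ => ?_
    ring
  rw [this, ← mul_sub]
  exact (X_pow_dvd_latSum_sub c hs).mul_left _

theorem expand_latSum (c : ι → R) {e : ι → ℕ} (he : FiniteFibers e) {k : ℕ} (hk : k ≠ 0) :
    PowerSeries.expand k hk (latSum c e) = latSum c fun i => k * e i := by
  symm
  refine latSum_eq fun N => ?_
  obtain ⟨s, hs⟩ := he.exists_finset N
  have hk1 := Nat.pos_of_ne_zero hk
  refine ⟨s, fun i hi => hs i (by nlinarith), ?_⟩
  have : ∑ i ∈ s, C (c i) * (X : R⟦X⟧) ^ (k * e i) =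
      PowerSeries.expand k hk (∑ i ∈ s, C (c i) * X ^ e i) := by
    rw [map_sum]
    refine sum_congr rfl fun i _ => ?_
    rw [map_mul, map_pow, expand_C, expand_X, pow_mul]
  rw [this, ← map_sub]
  have := _root_.map_dvd (PowerSeries.expand (R := R) k hk) (X_pow_dvd_latSum_sub c hs)
  rw [map_pow, expand_X, ← pow_mul] at this
  exact (pow_dvd_pow _ (Nat.le_mul_of_pos_left N hk1)).trans this

theorem map_latSum (φ : R →+* S) (c : ι → R) {e : ι → ℕ} (he : FiniteFibers e) :
    PowerSeries.map φ (latSum c e) = latSum (fun i => φ (c i)) e := by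
  symm
  refine latSum_eq fun N => ?_
  obtain ⟨s, hs⟩ := he.exists_finset N
  refine ⟨s, hs, ?_⟩
  have : ∑ i ∈ s, C (φ (c i)) * (X : S⟦X⟧) ^ e i =
      PowerSeries.map φ (∑ i ∈ s, C (c i) * X ^ e i) := by
    simp [map_sum]
  rw [this, ← map_sub]
  simpa using _root_.map_dvd (PowerSeries.map φ) (X_pow_dvd_latSum_sub c hs)

/-- The operator `X * d/dX`. -/
noncomputable def eulerDeriv (f : R⟦X⟧) : R⟦X⟧ := PowerSeries.mk fun n => n * coeff n f

theorem eulerDeriv_eq (f : R⟦X⟧) : eulerDeriv f = X * derivative R f := by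
  ext n
  cases n with
  | zero => simp [eulerDeriv]
  | succ n => simp [eulerDeriv, coeff_succ_X_mul, coeff_derivative, mul_comm]

theorem eulerDeriv_mul (f g : R⟦X⟧) :
    eulerDeriv (f * g) = eulerDeriv f * g + f * eulerDeriv g := by
  simp only [eulerDeriv_eq, Derivation.leibniz, smul_eq_mul]
  ring

theorem eulerDeriv_X_pow (k : ℕ) : eulerDeriv (X ^ k : R⟦X⟧) = (k : R⟦X⟧) * X ^ k := by
  ext n
  rw [eulerDeriv, coeff_mk, ← map_natCast (C : R →+* R⟦X⟧) k, coeff_C_mul, coeff_X_pow]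
  split_ifs with h <;> simp [h]

theorem eulerDeriv_expand (f : R⟦X⟧) {k : ℕ} (hk : k ≠ 0) :
    eulerDeriv (PowerSeries.expand k hk f) = k * PowerSeries.expand k hk (eulerDeriv f) := by
  ext n
  rw [eulerDeriv, coeff_mk, ← map_natCast (C : R →+* R⟦X⟧) k, coeff_C_mul, coeff_expand, coeff_expand]
  split_ifs with h
  · obtain ⟨m, rfl⟩ := h
    rw [Nat.mul_div_cancel_left m (Nat.pos_of_ne_zero hk)]
    simp [eulerDeriv, mul_assoc]
  · simp

theorem eulerDeriv_latSum (c : ι → R) {e : ι → ℕ} (he : FiniteFibers e) :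
    eulerDeriv (latSum c e) = latSum (fun i => e i * c i) e := by
  ext n
  obtain ⟨s, hs⟩ := he.exists_finset (n + 1)
  rw [eulerDeriv, coeff_mk, coeff_latSum_eq_sum c fun i hi => hs i (by omega),
    coeff_latSum_eq_sum _ fun i hi => hs i (by omega), mul_sum]
  refine sum_congr rfl fun i _ => ?_
  split_ifs with h <;> simp [h]

end LatticeSums

/-! ### The Jacobi triple product -/

section TripleProduct

open PowerSeries Finset

variable {R : Type*} [CommRing R]

/-- The finite product `(q ^ s; q ^ s)_n`. -/
noncomputable def qPoch (R : Type*) [CommRing R] (s n : ℕ) : R⟦X⟧ :=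
  ∏ m ∈ range n, (1 - X ^ (s * (m + 1)))

/-- The inverse of `(q ^ s; q ^ s)_n`. -/
noncomputable def qPochInv (R : Type*) [CommRing R] (s n : ℕ) : R⟦X⟧ :=
  invOfUnit (qPoch R s n) 1

theorem qPoch_mul_qPochInv {s : ℕ} (hs : 0 < s) (n : ℕ) :
    qPoch R s n * qPochInv R s n = 1 := by
  refine mul_invOfUnit _ _ ?_
  rw [qPoch, map_prod]
  simp [hs.ne']

theorem qPoch_succ (s n : ℕ) : qPoch R s (n + 1) = qPoch R s n * (1 - X ^ (s * (n + 1))) :=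
  prod_range_succ _ _

theorem qPochInv_eq {s : ℕ} (hs : 0 < s) (n : ℕ) :
    qPochInv R s n = (1 - X ^ (s * (n + 1))) * qPochInv R s (n + 1) := by
  have h1 := qPoch_mul_qPochInv (R := R) hs n
  have h2 := qPoch_mul_qPochInv (R := R) hs (n + 1)
  rw [qPoch_succ] at h2
  linear_combination (1 - X ^ (s * (n + 1))) * qPochInv R s (n + 1) * h1 - qPochInv R s n * h2

theorem qPochInv_zero {s : ℕ} (hs : 0 < s) : qPochInv R s 0 = 1 := by
  have h1 := qPoch_mul_qPochInv (R := R) hs 0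
  simpa [qPoch] using h1

/-- The Gaussian binomial coefficient with parameter `q ^ s`. -/
noncomputable def gaussBinom (R : Type*) [CommRing R] (s n k : ℕ) : R⟦X⟧ :=
  if k ≤ n then qPoch R s n * qPochInv R s k * qPochInv R s (n - k) else 0

theorem gaussBinom_zero_right {s : ℕ} (hs : 0 < s) (n : ℕ) : gaussBinom R s n 0 = 1 := by
  have := qPoch_mul_qPochInv (R := R) hs n
  simp [gaussBinom, qPochInv_zero hs, this]

theorem gaussBinom_self {s : ℕ} (hs : 0 < s) (n : ℕ) : gaussBinom R s n n = 1 := by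
  have := qPoch_mul_qPochInv (R := R) hs n
  simp [gaussBinom, qPochInv_zero hs, this]

theorem gaussBinom_of_lt {s n k : ℕ} (h : n < k) : gaussBinom R s n k = 0 := by
  rw [gaussBinom, if_neg (by omega)]

/-- With x = q^(s(k+1)) and y = q^(s(n-k)), this rule is the splitting 1 - xy = (1 - x) + x(1 - y),
and the next one is 1 - xy = (1 - y) + y(1 - x). -/
theorem gaussBinom_succ_succ {s : ℕ} (hs : 0 < s) {n k : ℕ} (h : k ≤ n) :
    gaussBinom R s (n + 1) (k + 1) =
      gaussBinom R s n k + X ^ (s * (k + 1)) * gaussBinom R s n (k + 1) := by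
  rcases h.eq_or_lt with rfl | h
  · rw [gaussBinom_self hs, gaussBinom_self hs, gaussBinom_of_lt (by omega)]
    ring
  · obtain ⟨d, rfl⟩ := Nat.exists_eq_add_of_lt h
    rw [gaussBinom, gaussBinom, gaussBinom, if_pos (by omega), if_pos (by omega),
      if_pos (by omega), show k + d + 1 + 1 - (k + 1) = d + 1 by omega,
      show k + d + 1 - k = d + 1 by omega, show k + d + 1 - (k + 1) = d by omega,
      qPochInv_eq hs k, qPochInv_eq hs d, qPoch_succ,
      show s * (k + d + 1 + 1) = s * (k + 1) + s * (d + 1) by ring, pow_add]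
    ring

theorem gaussBinom_succ_succ' {s : ℕ} (hs : 0 < s) {n k : ℕ} (h : k ≤ n) :
    gaussBinom R s (n + 1) (k + 1) =
      gaussBinom R s n (k + 1) + X ^ (s * (n - k)) * gaussBinom R s n k := by
  rcases h.eq_or_lt with rfl | h
  · rw [gaussBinom_self hs, gaussBinom_self hs, gaussBinom_of_lt (by omega)]
    simp
  · obtain ⟨d, rfl⟩ := Nat.exists_eq_add_of_lt h
    rw [gaussBinom, gaussBinom, gaussBinom, if_pos (by omega), if_pos (by omega),
      if_pos (by omega), show k + d + 1 + 1 - (k + 1) = d + 1 by omega,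
      show k + d + 1 - k = d + 1 by omega, show k + d + 1 - (k + 1) = d by omega,
      qPochInv_eq hs k, qPochInv_eq hs d, qPoch_succ,
      show s * (k + d + 1 + 1) = s * (k + 1) + s * (d + 1) by ring, pow_add]
    ring

/-- Cauchy's finite form of the triple product. -/
theorem finite_triple_product (z : Rˣ) {s r : ℕ} (hs : 0 < s) (hr : r ≤ s) {e : ℤ → ℕ}
    (he : ∀ n : ℤ, 2 * (e n : ℤ) = s * (n * (n - 1)) + 2 * r * n) (a b : ℕ) :
    (∏ m ∈ range a, (1 + C (z : R) * X ^ (s * m + r))) *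
        ∏ m ∈ range b, (1 + C ((z⁻¹ : Rˣ) : R) * X ^ (s * m + (s - r))) =
      ∑ k ∈ range (a + b + 1), gaussBinom R s (a + b) k *
        (C ((z ^ ((k : ℤ) - b) : Rˣ) : R) * X ^ e (k - b)) := by
  have he0 : e 0 = 0 := by have := he 0; simpa using this
  -- Induction on the number of factors in z, with an inner induction on the factors in z⁻¹ at a =
  -- 0. A new factor in z⁻¹ is absorbed by the first q-Pascal rule, a new factor in z by the second.
  induction a with
  | zero =>
    induction b with
    | zero => simp [he0, gaussBinom_zero_right hs]
    | succ b ih =>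
      rw [prod_range_succ, ← mul_assoc, ih, sum_range_succ' _ (0 + (b + 1))]
      simp only [Nat.zero_add]
      have key : ∀ k : ℕ, C ((z ^ ((k : ℤ) - b) : Rˣ) : R) * X ^ e (k - b) *
          (C ((z⁻¹ : Rˣ) : R) * X ^ (s * b + (s - r))) =
          C ((z ^ ((k : ℤ) - b - 1) : Rˣ) : R) * X ^ (e (k - b - 1) + s * k) := by
        intro k
        have h1 : e (k - b) + (s * b + (s - r)) = e (k - b - 1) + s * k := by
          have h1 := he (k - b)
          have h2 := he (k - b - 1)
          zify [hr]
          linarith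
        rw [← h1, pow_add, zpow_sub_one, Units.val_mul, map_mul]
        ring
      have h2 : ∀ k ∈ range (b + 1), gaussBinom R s (b + 1) (k + 1) *
          (C ((z ^ (((k + 1 : ℕ) : ℤ) - (b + 1 : ℕ)) : Rˣ) : R) *
            X ^ e ((k + 1 : ℕ) - (b + 1 : ℕ))) =
          gaussBinom R s b k * (C ((z ^ ((k : ℤ) - b) : Rˣ) : R) * X ^ e (k - b)) +
          gaussBinom R s b (k + 1) * ((C ((z ^ (((k + 1 : ℕ) : ℤ) - b) : Rˣ) : R) *
            X ^ e ((k + 1 : ℕ) - b)) * (C ((z⁻¹ : Rˣ) : R) * X ^ (s * b + (s - r)))) := by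
        intro k hk
        rw [key, gaussBinom_succ_succ hs (by simpa [Nat.lt_succ_iff] using hk)]
        have h3 : ((k + 1 : ℕ) : ℤ) - (b + 1 : ℕ) = k - b := by push_cast; ring
        have h4 : ((k + 1 : ℕ) : ℤ) - b - 1 = k - b := by push_cast; ring
        rw [h3, h4, pow_add]
        ring
      rw [sum_congr rfl h2, sum_add_distrib, mul_add, mul_one, add_assoc]
      congr 1
      have h5 := sum_range_succ' (fun k => gaussBinom R s b k *
        ((C ((z ^ ((k : ℤ) - b) : Rˣ) : R) *
            X ^ e (k - b)) * (C ((z⁻¹ : Rˣ) : R) * X ^ (s * b + (s - r))))) (b + 1)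
      rw [sum_range_succ, gaussBinom_of_lt (by omega), zero_mul, add_zero] at h5
      rw [sum_mul]
      simp only [mul_assoc] at h5 ⊢
      rw [h5]
      congr 1
      have h6 := key 0
      simp only [mul_assoc] at h6
      rw [gaussBinom_zero_right hs, gaussBinom_zero_right hs, h6]
      have h7 : ((0 : ℕ) : ℤ) - b - 1 = (0 : ℕ) - (b + 1 : ℕ) := by push_cast; ring
      rw [h7, mul_zero, add_zero]
  | succ a ih =>
    rw [prod_range_succ, mul_right_comm, ih, show a + 1 + b = a + b + 1 by ring,
      sum_range_succ' _ (a + b + 1)]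
    have h2 : ∀ k ∈ range (a + b + 1), gaussBinom R s (a + b + 1) (k + 1) *
        (C ((z ^ (((k + 1 : ℕ) : ℤ) - b) : Rˣ) : R) * X ^ e ((k + 1 : ℕ) - b)) =
        gaussBinom R s (a + b) (k + 1) *
          (C ((z ^ (((k + 1 : ℕ) : ℤ) - b) : Rˣ) : R) * X ^ e ((k + 1 : ℕ) - b)) +
        gaussBinom R s (a + b) k * (C ((z ^ ((k : ℤ) - b) : Rˣ) : R) * X ^ e (k - b)) *
          (C (z : R) * X ^ (s * a + r)) := by
      intro k hk
      have hk : k ≤ a + b := by simpa [Nat.lt_succ_iff] using hk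
      rw [gaussBinom_succ_succ' hs hk]
      have h1 : e (k - b) + (s * a + r) = e ((k + 1 : ℕ) - b) + s * (a + b - k) := by
        have h1 := he (k - b)
        have h2 := he ((k + 1 : ℕ) - b)
        zify [hk]
        push_cast at h2
        linarith
      have h3 : ((k + 1 : ℕ) : ℤ) - b = k - b + 1 := by push_cast; ring
      have h4 : (X : R⟦X⟧) ^ e (k - b) * X ^ (s * a + r) =
          X ^ e ((k + 1 : ℕ) - b) * X ^ (s * (a + b - k)) := by rw [← pow_add, h1, pow_add]
      have h5 : C ((z ^ (((k + 1 : ℕ) : ℤ) - b) : Rˣ) : R) =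
          C ((z ^ ((k : ℤ) - b) : Rˣ) : R) * C (z : R) := by
        rw [h3, zpow_add_one, Units.val_mul, map_mul]
      rw [h5]
      linear_combination (- gaussBinom R s (a + b) k * C ((z ^ ((k : ℤ) - b) : Rˣ) : R) *
        C (z : R)) * h4
    have h5 := sum_range_succ' (fun k => gaussBinom R s (a + b) k *
        (C ((z ^ ((k : ℤ) - b) : Rˣ) : R) * X ^ e (k - b))) (a + b + 1)
    rw [sum_range_succ, gaussBinom_of_lt (by omega : a + b < a + b + 1), zero_mul, add_zero] at h5
    rw [sum_congr rfl h2, sum_add_distrib, mul_add, mul_one, gaussBinom_zero_right hs, ← sum_mul]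
    rw [gaussBinom_zero_right hs] at h5
    nth_rewrite 1 [h5]
    ring

theorem qPoch_dvd_sub {s : ℕ} (hs : 0 < s) {n L : ℕ} (h : L ≤ n) :
    (X : R⟦X⟧) ^ (L + 1) ∣ qPoch R s n - qPoch R s L := by
  induction n, h using Nat.le_induction with
  | base => simp
  | succ n hn ih =>
    rw [qPoch_succ, mul_sub, mul_one, sub_right_comm]
    exact dvd_sub ih ((pow_dvd_pow _ (by nlinarith)).mul_left _)

theorem qPochInv_dvd_sub {s : ℕ} (hs : 0 < s) {n L : ℕ} (h : L ≤ n) :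
    (X : R⟦X⟧) ^ (L + 1) ∣ qPochInv R s n - qPochInv R s L := by
  have h1 := qPoch_mul_qPochInv (R := R) hs n
  have h2 := qPoch_mul_qPochInv (R := R) hs L
  have : qPochInv R s n - qPochInv R s L =
      - (qPochInv R s n * qPochInv R s L) * (qPoch R s n - qPoch R s L) := by
    linear_combination (qPochInv R s L) * h1 - (qPochInv R s n) * h2
  rw [this]
  exact (qPoch_dvd_sub hs h).mul_left _

/-- Modulo q^(L+1) each of the four q-factorials involved may be replaced by the one of index L, and
then they cancel. -/
theorem qPoch_mul_gaussBinom_dvd {s : ℕ} (hs : 0 < s) {M k L : ℕ} (hL : L ≤ k)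
    (hk : k + L ≤ 2 * M) (hM : L ≤ M) :
    (X : R⟦X⟧) ^ (L + 1) ∣ qPoch R s M * gaussBinom R s (M + M) k - 1 := by
  rw [gaussBinom, if_pos (by omega)]
  have h := dvd_mul_sub_mul_of_dvd (qPoch_dvd_sub (R := R) hs hM) (dvd_mul_sub_mul_of_dvd
    (dvd_mul_sub_mul_of_dvd (qPoch_dvd_sub (R := R) hs (by omega : L ≤ M + M))
    (qPochInv_dvd_sub hs hL)) (qPochInv_dvd_sub hs (by omega : L ≤ M + M - k)))
  rwa [qPoch_mul_qPochInv hs, one_mul, qPoch_mul_qPochInv hs] at h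

/-- A crude linear bound that suffices for the finiteness of fibres, for the error term of the
triple product and for the number of beads on the abacus. The + 1 is needed: for s = 1, r = 0, n = 1
the exponent is 0. -/
theorem natAbs_le_of_exponent {s r : ℕ} (hs : 0 < s) (hr : r ≤ s) {n : ℤ} {e : ℕ}
    (he : 2 * (e : ℤ) = s * (n * (n - 1)) + 2 * r * n) : n.natAbs ≤ e + 1 := by
  have h1 : (1 : ℤ) ≤ s := by exact_mod_cast hs
  have h2 : (r : ℤ) ≤ s := by exact_mod_cast hr
  have h3 : (0 : ℤ) ≤ r := by positivity
  rcases le_or_gt 0 n with h | h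
  · rcases le_or_gt n 0 with h' | h'
    · omega
    · have : n * (n - 1) ≥ 2 * (n - 1) := by
        rcases eq_or_lt_of_le (by omega : 1 ≤ n) with h6 | h6
        · rw [← h6]; norm_num
        · nlinarith
      have h4 : (s : ℤ) * (n * (n - 1)) ≥ n * (n - 1) := by nlinarith
      have h5 : (r : ℤ) * n ≥ 0 := by positivity
      zify
      rw [abs_of_nonneg h]
      nlinarith
  · obtain ⟨i, rfl⟩ : ∃ i, n = - i := ⟨-n, by ring⟩
    have hi : 0 < i := by omega
    have h4 : (s : ℤ) * (i * (i - 1)) ≥ i * (i - 1) := by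
      have : 0 ≤ i * (i - 1) := mul_nonneg (by omega) (by omega)
      nlinarith
    have : i * (i - 1) ≥ 2 * (i - 1) := by
      rcases eq_or_lt_of_le (by omega : 1 ≤ i) with h6 | h6
      · rw [← h6]; norm_num
      · nlinarith
    have h5 : (r : ℤ) * i ≤ s * i := by nlinarith
    zify
    rw [abs_neg, abs_of_pos hi]
    nlinarith

theorem finiteFibers_exponent {s r : ℕ} (hs : 0 < s) (hr : r ≤ s) {e : ℤ → ℕ}
    (he : ∀ n : ℤ, 2 * (e n : ℤ) = s * (n * (n - 1)) + 2 * r * n) : FiniteFibers e := fun N =>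
  (Set.finite_Icc (-(N : ℤ)) N).subset fun n hn => by
    have := natAbs_le_of_exponent hs hr (he n)
    have hn : e n < N := hn
    rw [Set.mem_Icc]
    omega

/-- The Jacobi triple product identity
`∑ z ^ n q ^ (s n (n - 1) / 2 + r n) =
  ∏ (1 - q ^ (s (m + 1))) (1 + z q ^ (s m + r)) (1 + z⁻¹ q ^ (s m + s - r))`. -/
theorem jacobi_triple_product (z : Rˣ) {s r : ℕ} (hs : 0 < s) (hr : r ≤ s) {e : ℤ → ℕ}
    (he : ∀ n : ℤ, 2 * (e n : ℤ) = s * (n * (n - 1)) + 2 * r * n) :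
    latSum (fun n : ℤ => ((z ^ n : Rˣ) : R)) e =
      eulerProd R s * (prodX (fun m => 1 + C (z : R) * X ^ (s * m + r)) *
        prodX fun m => 1 + C ((z⁻¹ : Rˣ) : R) * X ^ (s * m + (s - r))) := by
  refine latSum_eq fun N => ?_
  have hfin : Set.InjOn (fun k : ℕ => (k : ℤ) - N) (range (N + N + 1)) :=
    fun a _ b _ h => by simpa using h
  refine ⟨(range (N + N + 1)).image fun k : ℕ => (k : ℤ) - N, fun n hn => ?_, ?_⟩
  · have := natAbs_le_of_exponent hs hr (he n)
    rw [mem_image]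
    exact ⟨(n + N).toNat, by rw [mem_range]; omega, by omega⟩
  rw [sum_image hfin]
  have h1 := dvd_mul_sub_mul_of_dvd ((admissible_eulerProd (R := R) hs).dvd_prodX_sub (le_refl N))
    (dvd_mul_sub_mul_of_dvd ((admissible_one_add (u := fun _ => C (z : R))
      (e := fun m => s * m + r) fun m => by nlinarith).dvd_prodX_sub (le_refl N))
      ((admissible_one_add (u := fun _ => C ((z⁻¹ : Rˣ) : R))
      (e := fun m => s * m + (s - r)) fun m => by nlinarith).dvd_prodX_sub (le_refl N)))
  rw [finite_triple_product z hs hr he] at h1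
  have h2 : (X : R⟦X⟧) ^ N ∣ qPoch R s N * (∑ k ∈ range (N + N + 1), gaussBinom R s (N + N) k *
      (C ((z ^ ((k : ℤ) - N) : Rˣ) : R) * X ^ e (k - N))) -
      ∑ k ∈ range (N + N + 1), C ((z ^ ((k : ℤ) - N) : Rˣ) : R) * X ^ e (k - N) := by
    rw [mul_sum, ← sum_sub_distrib]
    refine dvd_sum fun k hk => ?_
    rw [mem_range] at hk
    have h3 := natAbs_le_of_exponent hs hr (he (k - N))
    -- The Gaussian binomial is accurate only to order N - |k - N| + 1, but its monomial has
    -- exponent at least |k - N| - 1; the two orders add up to at least N.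
    have h4 := mul_dvd_mul (qPoch_mul_gaussBinom_dvd (R := R) (M := N) (k := k)
      (L := N - ((k : ℤ) - N).natAbs) hs (by omega) (by omega) (by omega))
      (dvd_refl ((X : R⟦X⟧) ^ e (k - N)))
    rw [← pow_add] at h4
    refine ((pow_dvd_pow _ (by omega)).trans h4).trans ⟨C ((z ^ ((k : ℤ) - N) : Rˣ) : R), ?_⟩
    ring
  have h3 := dvd_add h1 h2
  rwa [qPoch, sub_add_sub_cancel] at h3

end TripleProduct

/-! ### Theta series on the lattices `ℤ` and `ℤ × ℤ` -/

section LatticeTheta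

open PowerSeries Finset

variable {R S : Type*} [CommRing R] [CommRing S]

/-- `∑ c x * q ^ (x ^ 2)` over the integers `x`. -/
noncomputable def theta1 (c : ℤ → R) : R⟦X⟧ := latSum c fun x => x.natAbs ^ 2

/-- `∑ c (x, y) * q ^ (x ^ 2 + y ^ 2)` over the pairs of integers. -/
noncomputable def theta2 (c : ℤ × ℤ → R) : R⟦X⟧ :=
  latSum c fun p => p.1.natAbs ^ 2 + p.2.natAbs ^ 2

theorem finiteFibers_sq : FiniteFibers fun x : ℤ => x.natAbs ^ 2 := fun N =>
  (Set.finite_Icc (-(N : ℤ)) N).subset fun n hn => by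
    have hn : n.natAbs ^ 2 < N := hn
    have : n.natAbs ≤ n.natAbs ^ 2 := Nat.le_self_pow (by norm_num) _
    rw [Set.mem_Icc]
    omega

theorem finiteFibers_sq_add_sq :
    FiniteFibers fun p : ℤ × ℤ => p.1.natAbs ^ 2 + p.2.natAbs ^ 2 :=
  finiteFibers_sq.add finiteFibers_sq

theorem theta1_mul_theta1 (c c' : ℤ → R) :
    theta1 c * theta1 c' = theta2 fun p => c p.1 * c' p.2 :=
  latSum_mul_latSum c finiteFibers_sq c' finiteFibers_sq

theorem theta2_sub (c c' : ℤ × ℤ → R) :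
    theta2 (fun p => c p - c' p) = theta2 c - theta2 c' :=
  latSum_sub c c' finiteFibers_sq_add_sq

theorem theta2_const_mul (a : R) (c : ℤ × ℤ → R) :
    theta2 (fun p => a * c p) = C a * theta2 c :=
  latSum_const_mul a c finiteFibers_sq_add_sq

theorem theta2_sum {α : Type*} (s : Finset α) (c : α → ℤ × ℤ → R) :
    theta2 (fun p => ∑ a ∈ s, c a p) = ∑ a ∈ s, theta2 (c a) :=
  latSum_sum s c finiteFibers_sq_add_sq

theorem eulerDeriv_theta1 (c : ℤ → R) :
    eulerDeriv (theta1 c) = theta1 fun x => (x : R) ^ 2 * c x := by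
  rw [theta1, eulerDeriv_latSum c finiteFibers_sq, theta1]
  congr 1
  ext1 x
  have : ((x.natAbs ^ 2 : ℕ) : R) = (x : R) ^ 2 := by
    have h : ((x.natAbs ^ 2 : ℕ) : ℤ) = x ^ 2 := by push_cast; exact sq_abs x
    exact_mod_cast congrArg (Int.cast (R := R)) h
  rw [this]

/-- Quarter turn of the lattice. -/
def quarterTurn : ℤ × ℤ ≃ ℤ × ℤ where
  toFun p := (-p.2, p.1)
  invFun p := (p.2, -p.1)
  left_inv p := by simp
  right_inv p := by simp

theorem theta2_quarterTurn (c : ℤ × ℤ → R) :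
    theta2 (fun p => c (-p.2, p.1)) = theta2 c := by
  rw [theta2, theta2, ← latSum_comp_equiv c _ quarterTurn]
  simp only [quarterTurn, Equiv.coe_fn_mk, Int.natAbs_neg]
  congr 1
  ext1 p
  ring

theorem theta2_swap (c : ℤ × ℤ → R) : theta2 (fun p => c (p.2, p.1)) = theta2 c := by
  rw [theta2, theta2, ← latSum_comp_equiv c _ (Equiv.prodComm ℤ ℤ)]
  simp only [Equiv.prodComm_apply, Prod.swap]
  congr 1
  ext1 p
  ring

/-- Exchanging the coordinates preserves x² + y², so the series equals its own negative. -/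
theorem theta2_eq_zero_of_antisymm [NoZeroDivisors R] [CharZero R] {c : ℤ × ℤ → R}
    (hc : ∀ x y, c (y, x) = - c (x, y)) : theta2 c = 0 := by
  have h : theta2 (fun p => c (p.2, p.1)) = - theta2 c := by
    rw [theta2, theta2, ← latSum_neg c finiteFibers_sq_add_sq]
    congr 1
    ext1 p
    exact hc p.1 p.2
  rw [theta2_swap] at h
  ext n
  have := congrArg (coeff n) h
  rw [map_neg] at this
  simpa using self_eq_neg.1 this

/-- The points of the sublattice `y ≡ 2 x (mod 5)` are the multiples of `1 + 2 i`. -/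
theorem theta2_sublattice (c : ℤ × ℤ → R) :
    theta2 (fun p => if 5 ∣ p.2 - 2 * p.1 then c p else 0) =
      expand 5 (by norm_num) (theta2 fun p => c (p.1 - 2 * p.2, 2 * p.1 + p.2)) := by
  rw [theta2, theta2, expand_latSum _ finiteFibers_sq_add_sq]
  let σ : ℤ × ℤ → ℤ × ℤ := fun p => (p.1 - 2 * p.2, 2 * p.1 + p.2)
  have hσ : Function.Injective σ := fun p q h => by
    simp only [σ, Prod.mk.injEq] at h
    ext <;> omega
  rw [← latSum_comp (σ := σ) _ _ hσ]
  · congr 1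
    · ext1 p
      exact if_pos ⟨p.2, by ring⟩
    · ext1 p
      zify
      simp only [sq_abs, σ]
      ring
  · intro p hp
    refine if_neg fun ⟨k, hk⟩ => hp ⟨(p.1 + 2 * k, k), ?_⟩
    ext
    · simp only [σ]; omega
    · simp only [σ]; omega

theorem theta2_five (c : ℤ × ℤ → R) :
    theta2 (fun p => if 5 ∣ p.1 ∧ 5 ∣ p.2 then c p else 0) =
      expand 25 (by norm_num) (theta2 fun p => c (5 * p.1, 5 * p.2)) := by
  rw [theta2, theta2, expand_latSum _ finiteFibers_sq_add_sq]
  let σ : ℤ × ℤ → ℤ × ℤ := fun p => (5 * p.1, 5 * p.2)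
  have hσ : Function.Injective σ := fun p q h => by
    simp only [σ, Prod.mk.injEq] at h
    ext <;> omega
  rw [← latSum_comp (σ := σ) _ _ hσ]
  · congr 1
    · ext1 p
      exact if_pos ⟨⟨p.1, rfl⟩, ⟨p.2, rfl⟩⟩
    · ext1 p
      zify
      simp only [sq_abs, σ]
      ring
  · intro p hp
    refine if_neg fun ⟨⟨k, hk⟩, ⟨l, hl⟩⟩ => hp ⟨(k, l), ?_⟩
    ext
    · simp only [σ]; omega
    · simp only [σ]; omega

/-- The part of a rotation invariant theta series in a single residue class modulo `5` on the
sublattice of multiples of `1 + 2 i`. -/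
theorem four_mul_theta2_class {c : ℤ × ℤ → R} (hc : ∀ x y, c (-y, x) = c (x, y)) :
    4 * theta2 (fun p => if 5 ∣ p.1 - 2 ∧ 5 ∣ p.2 - 4 then c p else 0) =
      expand 5 (by norm_num) (theta2 fun p => c (p.1 - 2 * p.2, 2 * p.1 + p.2)) -
        expand 25 (by norm_num) (theta2 fun p => c (5 * p.1, 5 * p.2)) := by
  rw [← theta2_sublattice, ← theta2_five]
  -- `T r` is the part of `c` on the class (r, 2r) mod 5. These five classes make up the sublattice;
  -- the quarter turn permutes the classes r = 1, 2, 3, 4 in a single cycle, and r = 0 is the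
  -- lattice 5ℤ².
  let T : ℤ → ℤ × ℤ → R := fun r p => if 5 ∣ p.1 - r ∧ 5 ∣ p.2 - 2 * r then c p else 0
  have hT : ∀ r r', 5 ∣ r' - 2 * r → theta2 (T r) = theta2 (T r') := by
    intro r r' hr
    rw [← theta2_quarterTurn (T r)]
    congr 1
    ext1 p
    simp only [T, hc]
    have : (5 ∣ -p.2 - r ∧ 5 ∣ p.1 - 2 * r) ↔ (5 ∣ p.1 - r' ∧ 5 ∣ p.2 - 2 * r') := by omega
    simp only [this]
  have h24 := hT 2 4 (by norm_num)
  have h43 := hT 4 3 (by norm_num)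
  have h31 := hT 3 1 (by norm_num)
  have h := theta2_sum (range 5) fun i : ℕ => T i
  have h2 : (fun p => ∑ i ∈ range 5, T i p) = fun p => if 5 ∣ p.2 - 2 * p.1 then c p else 0 := by
    ext1 p
    simp only [sum_range_succ, range_zero, sum_empty, T]
    push_cast
    have : p.1 % 5 = 0 ∨ p.1 % 5 = 1 ∨ p.1 % 5 = 2 ∨ p.1 % 5 = 3 ∨ p.1 % 5 = 4 := by omega
    by_cases h5 : 5 ∣ p.2 - 2 * p.1
    · rw [if_pos h5]
      rcases this with h | h | h | h | h
      · rw [if_pos (by omega), if_neg (by omega), if_neg (by omega), if_neg (by omega),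
          if_neg (by omega)]
        ring
      · rw [if_neg (by omega), if_pos (by omega), if_neg (by omega), if_neg (by omega),
          if_neg (by omega)]
        ring
      · rw [if_neg (by omega), if_neg (by omega), if_pos (by omega), if_neg (by omega),
          if_neg (by omega)]
        ring
      · rw [if_neg (by omega), if_neg (by omega), if_neg (by omega), if_pos (by omega),
          if_neg (by omega)]
        ring
      · rw [if_neg (by omega), if_neg (by omega), if_neg (by omega), if_neg (by omega),
          if_pos (by omega)]
        ring
    · rw [if_neg h5, if_neg (by omega), if_neg (by omega), if_neg (by omega), if_neg (by omega),
          if_neg (by omega)]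
      ring
  rw [h2] at h
  simp only [sum_range_succ, range_zero, sum_empty] at h
  have h0 : theta2 (fun p => if 5 ∣ p.1 ∧ 5 ∣ p.2 then c p else 0) = theta2 (T 0) := by
    simp [T]
  have h1 : theta2 (fun p => if 5 ∣ p.1 - 2 ∧ 5 ∣ p.2 - 4 then c p else 0) = theta2 (T 2) := by
    simp [T]
  rw [h0, h1, h]
  push_cast
  rw [← h31, ← h43, ← h24]
  ring

/-- Twisting a rotation invariant theta series with vanishing sum by a function of
`x + 2 y (mod 5)`. -/
theorem four_mul_theta2_twist {c : ℤ × ℤ → R} (hc : ∀ x y, c (-y, x) = c (x, y))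
    (hc0 : theta2 c = 0) {g : ℤ → R} (hg : ∀ s, g (s % 5) = g s) :
    4 * theta2 (fun p => g (p.1 + 2 * p.2) * c p) =
      C (4 * g 0 - g 1 - g 2 - g 3 - g 4) *
        expand 5 (by norm_num) (theta2 fun p => c (p.1 - 2 * p.2, 2 * p.1 + p.2)) := by
  rw [← theta2_sublattice]
  -- `T r` is the part with x + 2y ≡ r. The quarter turn doubles x + 2y mod 5, so the four nonzero
  -- parts have the same series, and the vanishing of the total makes each of them -1/4 of the part
  -- r = 0, which lives on the sublattice.
  let T : ℤ → ℤ × ℤ → R := fun r p => if (p.1 + 2 * p.2) % 5 = r then c p else 0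
  have hT : ∀ r r', 0 ≤ r → r < 5 → (r' - 3 * r) % 5 = 0 → 0 ≤ r' → r' < 5 →
      theta2 (T r) = theta2 (T r') := by
    intro r r' _ _ hr _ _
    rw [← theta2_quarterTurn (T r)]
    congr 1
    ext1 p
    simp only [T, hc]
    have : (-p.2 + 2 * p.1) % 5 = r ↔ (p.1 + 2 * p.2) % 5 = r' := by omega
    simp only [this]
  have h13 := hT 1 3 (by norm_num) (by norm_num) (by norm_num) (by norm_num) (by norm_num)
  have h34 := hT 3 4 (by norm_num) (by norm_num) (by norm_num) (by norm_num) (by norm_num)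
  have h42 := hT 4 2 (by norm_num) (by norm_num) (by norm_num) (by norm_num) (by norm_num)
  have h := fun g : ℤ → R => theta2_sum (range 5) fun (i : ℕ) p => g i * T i p
  have h2 : ∀ g : ℤ → R, (∀ s, g (s % 5) = g s) →
      (fun p => ∑ i ∈ range 5, g (i : ℕ) * T i p) = fun p => g (p.1 + 2 * p.2) * c p := by
    intro g hg
    ext1 p
    simp only [sum_range_succ, range_zero, sum_empty, T]
    rw [← hg (p.1 + 2 * p.2)]
    have : (p.1 + 2 * p.2) % 5 = 0 ∨ (p.1 + 2 * p.2) % 5 = 1 ∨ (p.1 + 2 * p.2) % 5 = 2 ∨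
      (p.1 + 2 * p.2) % 5 = 3 ∨ (p.1 + 2 * p.2) % 5 = 4 := by omega
    rcases this with h | h | h | h | h <;> rw [h] <;> norm_num
  have hlin : ∀ g : ℤ → R, (∀ s, g (s % 5) = g s) →
      theta2 (fun p => g (p.1 + 2 * p.2) * c p) = C (g 0) * theta2 (T 0) +
        C (g 1 + g 2 + g 3 + g 4) * theta2 (T 1) := by
    intro g hg
    have h3 := h g
    rw [h2 g hg] at h3
    rw [h3]
    simp only [sum_range_succ, range_zero, sum_empty, theta2_const_mul]
    push_cast
    rw [← h42, ← h34, ← h13]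
    simp only [map_add]
    ring
  have h4 := hlin (fun _ => 1) (fun _ => rfl)
  simp only [one_mul, hc0, map_one, map_add] at h4
  rw [hlin g hg]
  have h5 : theta2 (fun p => if 5 ∣ p.2 - 2 * p.1 then c p else 0) = theta2 (T 0) := by
    congr 1
    ext1 p
    have : 5 ∣ p.2 - 2 * p.1 ↔ (p.1 + 2 * p.2) % 5 = 0 := by omega
    simp only [T, this]
  rw [h5]
  simp only [map_add, map_sub, map_mul, map_ofNat]
  linear_combination (-(C (g 1) + C (g 2) + C (g 3) + C (g 4))) * h4

/-- Completing the square: the substitution x = σ n removes the linear term of the exponent, and the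
resulting congruence condition on x is absorbed into the coefficient c'. -/
theorem X_pow_mul_expand_latSum {c : ℤ → R} {e : ℤ → ℕ} (he : FiniteFibers e) {c' : ℤ → R}
    {k : ℕ} (hk : k ≠ 0) {j : ℕ} {σ : ℤ → ℤ} (hσ : Function.Injective σ)
    (h1 : ∀ n, c n = c' (σ n)) (h0 : ∀ x, x ∉ Set.range σ → c' x = 0)
    (h2 : ∀ n, (k * e n + j : ℤ) = σ n ^ 2) :
    X ^ j * expand k hk (latSum c e) = theta1 c' := by
  rw [expand_latSum c he, X_pow_mul_latSum, theta1, ← latSum_comp (σ := σ) _ _ hσ h0]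
  · congr 1
    · ext1 n
      exact h1 n
    · ext1 n
      have := h2 n
      zify
      rw [this, sq_abs]
  · exact he.mono fun n => by nlinarith [Nat.pos_of_ne_zero hk]

theorem expand_injective {k : ℕ} (hk : k ≠ 0) {f g : R⟦X⟧}
    (h : expand k hk f = expand k hk g) : f = g := by
  ext n
  rw [← coeff_expand_mul k hk, h, coeff_expand_mul]

theorem X_pow_mul_left_cancel {k : ℕ} {f g : R⟦X⟧} (h : X ^ k * f = X ^ k * g) : f = g := by
  ext n
  rw [← coeff_X_pow_mul f k n, h, coeff_X_pow_mul]

end LatticeTheta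

/-! ### Product formulas and quadratic identities for theta series -/

section ThetaProducts

open PowerSeries Finset

variable {R S : Type*} [CommRing R] [CommRing S]

/-- `∏ (1 + u q ^ (s m + r))`. -/
noncomputable def resProd (u : R) (s r : ℕ) : R⟦X⟧ := prodX fun m => 1 + C u * X ^ (s * m + r)

theorem admissible_resProd (u : R) {s : ℕ} (hs : 0 < s) (r : ℕ) :
    Admissible fun m => 1 + C u * X ^ (s * m + r) :=
  admissible_one_add fun m => by nlinarith

theorem resProd_block (u : R) {s : ℕ} (hs : 0 < s) (r : ℕ) {l : ℕ} (hl : 0 < l) :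
    resProd u s r = ∏ i ∈ range l, resProd u (s * l) (s * i + r) := by
  simp only [resProd]
  rw [← prodX_prod fun i _ => admissible_resProd u (by positivity) _,
    ← prodX_block (admissible_resProd u hs r) hl]
  congr 1
  ext1 m
  refine prod_congr rfl fun i _ => ?_
  congr 3
  ring

theorem resProd_mul_resProd_neg (u : R) {s : ℕ} (hs : 0 < s) (r : ℕ) :
    resProd u s r * resProd (-u) s r = resProd (-u ^ 2) (2 * s) (2 * r) := by
  simp only [resProd]
  rw [← prodX_mul (admissible_resProd u hs r) (admissible_resProd _ hs r)]
  congr 1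
  ext1 m
  rw [show 2 * s * m + 2 * r = (s * m + r) * 2 by ring, pow_mul]
  simp only [map_neg, map_pow]
  ring

theorem eulerProd_eq_resProd (k : ℕ) : eulerProd R k = resProd (-1) k k := by
  rw [eulerProd, resProd]
  congr 1
  ext1 m
  rw [map_neg, map_one, mul_add_one]
  ring

theorem map_resProd (φ : R →+* S) (u : R) (s r : ℕ) :
    PowerSeries.map φ (resProd u s r) = resProd (φ u) s r := by
  rw [resProd, map_prodX, resProd]
  simp

theorem resProd_zero (u : R) {s : ℕ} (hs : 0 < s) :
    resProd u s 0 = C (1 + u) * resProd u s s := by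
  rw [resProd, prodX_succ (admissible_resProd u hs 0), resProd]
  simp [mul_add_one]

/-- The exponent `s n (n - 1) / 2 + r n`. -/
def thetaExp (s r : ℕ) (n : ℤ) : ℕ := ((s * (n * (n - 1)) + 2 * r * n) / 2).toNat

theorem two_mul_thetaExp {s r : ℕ} (hr : r ≤ s) (n : ℤ) :
    2 * (thetaExp s r n : ℤ) = s * (n * (n - 1)) + 2 * r * n := by
  have h1 : (2 : ℤ) ∣ s * (n * (n - 1)) + 2 * r * n := by
    refine dvd_add (Dvd.dvd.mul_left ?_ _) ⟨r * n, by ring⟩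
    have := (Int.even_mul_pred_self n).two_dvd
    exact this
  have h2 : (r : ℤ) ≤ s := by exact_mod_cast hr
  have h0 : (0 : ℤ) ≤ r := by positivity
  have h3 : 0 ≤ s * (n * (n - 1)) + 2 * r * n := by
    rcases le_or_gt 1 n with h | h
    · have : 0 ≤ n * (n - 1) := mul_nonneg (by omega) (by omega)
      have : (0 : ℤ) ≤ r * n := by positivity
      have : 0 ≤ s * (n * (n - 1)) := by positivity
      linarith
    · obtain ⟨i, rfl⟩ : ∃ i, n = - i := ⟨-n, by ring⟩
      have hi : 0 ≤ i := by omega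
      have h5 : (r : ℤ) * i ≤ s * i := by nlinarith
      have : 0 ≤ i * (i - 1) := by
        rcases hi.eq_or_lt with h | h
        · rw [← h]; simp
        · exact mul_nonneg hi (by omega)
      have : 0 ≤ s * (i * (i - 1)) := by positivity
      nlinarith
  rw [thetaExp, Int.toNat_of_nonneg (Int.ediv_nonneg h3 (by norm_num)),
    Int.mul_ediv_cancel' h1]

/-- `∑ z ^ n q ^ (s n (n - 1) / 2 + r n)`. -/
noncomputable def thetaSum (z : Rˣ) (s r : ℕ) : R⟦X⟧ :=
  latSum (fun n : ℤ => ((z ^ n : Rˣ) : R)) (thetaExp s r)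

theorem finiteFibers_thetaExp {s r : ℕ} (hs : 0 < s) (hr : r ≤ s) :
    FiniteFibers (thetaExp s r) :=
  finiteFibers_exponent hs hr (two_mul_thetaExp hr)

theorem thetaSum_eq (z : Rˣ) {s r : ℕ} (hs : 0 < s) (hr : r ≤ s) :
    thetaSum z s r =
      eulerProd R s * (resProd (z : R) s r * resProd ((z⁻¹ : Rˣ) : R) s (s - r)) :=
  jacobi_triple_product z hs hr (two_mul_thetaExp hr)

theorem X_pow_mul_expand_thetaSum (z : Rˣ) {s r : ℕ} (hs : 0 < s) (hr : r ≤ s) {c : ℤ → R} {k : ℕ}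
    (hk : k ≠ 0) {j : ℕ} {σ : ℤ → ℤ} (hσ : Function.Injective σ)
    (h1 : ∀ n, ((z ^ n : Rˣ) : R) = c (σ n)) (h0 : ∀ x, x ∉ Set.range σ → c x = 0)
    (h2 : ∀ n, k * (s * (n * (n - 1)) + 2 * r * n) + 2 * j = 2 * σ n ^ 2) :
    X ^ j * expand k hk (thetaSum z s r) = theta1 c := by
  refine X_pow_mul_expand_latSum (finiteFibers_thetaExp hs hr) hk hσ h1 h0 fun n => ?_
  have h3 := two_mul_thetaExp hr n
  have h4 := h2 n
  rw [← h3] at h4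
  linarith

/-- `ψ(q) = f(q, q ^ 3)`. -/
noncomputable def psiPos : ℤ⟦X⟧ := thetaSum 1 4 1

/-- The triple product gives ψ(q) = (-q; q²)(q⁴; q⁴), and (q; q²)(-q; q²) = (q²; q⁴) turns this into
f₂²/f₁. -/
theorem psiPos_mul : psiPos * eulerProd ℤ 1 = eulerProd ℤ 2 ^ 2 := by
  have h1 := resProd_block (1 : ℤ) (s := 2) (by norm_num) 1 (l := 2) (by norm_num)
  have h2 := resProd_block (-1 : ℤ) (s := 1) (by norm_num) 1 (l := 2) (by norm_num)
  have h3 := resProd_block (-1 : ℤ) (s := 2) (by norm_num) 2 (l := 2) (by norm_num)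
  have h4 := resProd_mul_resProd_neg (1 : ℤ) (s := 2) (by norm_num) 1
  simp only [prod_range_succ, range_zero, prod_empty] at h1 h2 h3
  norm_num at h1 h2 h3 h4
  rw [psiPos, thetaSum_eq 1 (by norm_num) (by norm_num)]
  simp only [inv_one, Units.val_one, eulerProd_eq_resProd]
  norm_num
  rw [← h1, h2]
  linear_combination (resProd (-1) 4 4 * resProd (-1) 2 2) * h4 - resProd (-1) 2 2 * h3

/-- `φ(-q) = f(-q, -q)`. -/
noncomputable def phiMinus : ℤ⟦X⟧ := thetaSum (-1) 2 1

theorem phiMinus_mul : phiMinus * eulerProd ℤ 2 = eulerProd ℤ 1 ^ 2 := by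
  have h2 := resProd_block (-1 : ℤ) (s := 1) (by norm_num) 1 (l := 2) (by norm_num)
  simp only [prod_range_succ, range_zero, prod_empty] at h2
  norm_num at h2
  rw [phiMinus, thetaSum_eq (-1) (by norm_num) (by norm_num)]
  simp only [inv_neg, inv_one, Units.val_one, Units.val_neg, eulerProd_eq_resProd]
  norm_num
  rw [h2]
  ring

/-- The two triple products contain the four nonzero classes mod 5 of (-q; q) = f₂/f₁; the missing
class is (-q⁵; q⁵) = f₁₀/f₅. -/
theorem thetaSum_one_five_mul :
    thetaSum (1 : ℤˣ) 5 1 * thetaSum (1 : ℤˣ) 5 2 * (eulerProd ℤ 1 * eulerProd ℤ 10) =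
      eulerProd ℤ 2 * eulerProd ℤ 5 ^ 3 := by
  have h1 := resProd_block (1 : ℤ) (s := 1) (by norm_num) 1 (l := 5) (by norm_num)
  have h4 := resProd_mul_resProd_neg (1 : ℤ) (s := 1) (by norm_num) 1
  have h5 := resProd_mul_resProd_neg (1 : ℤ) (s := 5) (by norm_num) 5
  simp only [prod_range_succ, range_zero, prod_empty] at h1
  norm_num at h1 h4 h5
  rw [thetaSum_eq 1 (by norm_num) (by norm_num), thetaSum_eq 1 (by norm_num) (by norm_num)]
  simp only [inv_one, Units.val_one, eulerProd_eq_resProd]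
  norm_num
  rw [← h4, ← h5, h1]
  ring

theorem thetaSum_neg_one_five_mul :
    thetaSum (-1 : ℤˣ) 5 1 * thetaSum (-1 : ℤˣ) 5 2 = eulerProd ℤ 1 * eulerProd ℤ 5 := by
  have h1 := resProd_block (-1 : ℤ) (s := 1) (by norm_num) 1 (l := 5) (by norm_num)
  simp only [prod_range_succ, range_zero, prod_empty] at h1
  norm_num at h1
  rw [thetaSum_eq _ (by norm_num) (by norm_num), thetaSum_eq _ (by norm_num) (by norm_num)]
  simp only [inv_neg, inv_one, Units.val_one, Units.val_neg, eulerProd_eq_resProd]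
  norm_num
  rw [h1]
  ring

/-- The odd classes mod 10 other than 5: (q; q²) = f₁/f₂ with (q⁵; q¹⁰) = f₅/f₁₀ removed. -/
theorem thetaSum_neg_one_ten_mul :
    thetaSum (-1 : ℤˣ) 10 1 * thetaSum (-1 : ℤˣ) 10 3 * (eulerProd ℤ 2 * eulerProd ℤ 5) =
      eulerProd ℤ 1 * eulerProd ℤ 10 ^ 3 := by
  have h1 := resProd_block (-1 : ℤ) (s := 2) (by norm_num) 1 (l := 5) (by norm_num)
  have h2 := resProd_block (-1 : ℤ) (s := 1) (by norm_num) 1 (l := 2) (by norm_num)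
  have h3 := resProd_block (-1 : ℤ) (s := 5) (by norm_num) 5 (l := 2) (by norm_num)
  simp only [prod_range_succ, range_zero, prod_empty] at h1 h2 h3
  norm_num at h1 h2 h3
  rw [thetaSum_eq _ (by norm_num) (by norm_num), thetaSum_eq _ (by norm_num) (by norm_num)]
  simp only [inv_neg, inv_one, Units.val_one, Units.val_neg, eulerProd_eq_resProd]
  norm_num
  rw [h2, h3, h1]
  ring

/-- The primitive character modulo `4`. -/
def chi4 (x : ℤ) : ℤ := if x % 4 = 1 then 1 else if x % 4 = 3 then -1 else 0

theorem neg_one_zpow_val (n : ℤ) : (((-1 : ℤˣ) ^ n : ℤˣ) : ℤ) = if n % 2 = 0 then 1 else -1 := by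
  split_ifs with h
  · rw [(Int.even_iff.2 h).neg_one_zpow, Units.val_one]
  · rw [(Int.odd_iff.2 (by omega)).neg_one_zpow, Units.val_neg, Units.val_one]

/-- The odd integers are the classes ±1 mod 4, exchanged by negation; the class x = 4n - 1 gives
qψ(q⁸). -/
theorem theta1_odd :
    theta1 (fun x => if x % 2 = 1 then (1 : ℤ) else 0) = 2 * (X * expand 8 (by norm_num) psiPos) := by
  have h := X_pow_mul_expand_thetaSum (1 : ℤˣ) (s := 4) (r := 1) (by norm_num) (by norm_num)
    (c := fun x => if x % 4 = 3 then (1 : ℤ) else 0) (k := 8) (by norm_num) (j := 1)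
    (σ := fun n => 4 * n - 1) (fun a b h => by simpa using h)
    (fun n => by simp only [one_zpow, Units.val_one]; rw [if_pos (by omega)])
    (fun x hx => if_neg fun h => hx ⟨(x + 1) / 4, by simp only; omega⟩)
    (fun n => by push_cast; ring)
  have h' : theta1 (fun x => if x % 4 = 1 then (1 : ℤ) else 0) =
      theta1 (fun x => if x % 4 = 3 then (1 : ℤ) else 0) := by
    rw [theta1, theta1, ← latSum_comp_equiv (fun x => if x % 4 = 3 then (1 : ℤ) else 0) _
      (Equiv.neg ℤ)]
    simp only [Equiv.neg_apply, Int.natAbs_neg]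
    congr 1
    ext1 x
    have : -x % 4 = 3 ↔ x % 4 = 1 := by omega
    simp only [this]
  have h2 : (fun x : ℤ => if x % 2 = 1 then (1 : ℤ) else 0) = fun x =>
      (if x % 4 = 1 then (1 : ℤ) else 0) + if x % 4 = 3 then (1 : ℤ) else 0 := by
    ext1 x
    split_ifs <;> omega
  rw [psiPos, ← pow_one (X : ℤ⟦X⟧), h, h2, theta1, latSum_add _ _ finiteFibers_sq]
  change theta1 _ + theta1 _ = _
  rw [h', two_mul]

/-- `four_mul_theta2_class` for the indicator of pairs of odd integers, which is unchanged under
multiplication by 1 + 2i and by 5. On the class (2, 4) mod 5 it separates into x ≡ 7 and y ≡ 9 mod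
10, whence the two theta functions on the right. -/
theorem psiPos_sq_sub :
    psiPos ^ 2 - X * expand 5 (by norm_num) psiPos ^ 2 =
      thetaSum (1 : ℤˣ) 5 1 * thetaSum (1 : ℤˣ) 5 2 := by
  have hG := X_pow_mul_expand_thetaSum (1 : ℤˣ) (s := 5) (r := 1) (by norm_num) (by norm_num)
    (c := fun x => if x % 10 = 7 then (1 : ℤ) else 0) (k := 40) (by norm_num) (j := 9)
    (σ := fun n => 10 * n - 3) (fun a b h => by simpa using h)
    (fun n => by simp only [one_zpow, Units.val_one]; rw [if_pos (by omega)])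
    (fun x hx => if_neg fun h => hx ⟨(x + 3) / 10, by simp only; omega⟩)
    (fun n => by push_cast; ring)
  have hH := X_pow_mul_expand_thetaSum (1 : ℤˣ) (s := 5) (r := 2) (by norm_num) (by norm_num)
    (c := fun x => if x % 10 = 9 then (1 : ℤ) else 0) (k := 40) (by norm_num) (j := 1)
    (σ := fun n => 10 * n - 1) (fun a b h => by simpa using h)
    (fun n => by simp only [one_zpow, Units.val_one]; rw [if_pos (by omega)])
    (fun x hx => if_neg fun h => hx ⟨(x + 1) / 10, by simp only; omega⟩)
    (fun n => by push_cast; ring)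
  let c : ℤ × ℤ → ℤ := fun p => (if p.1 % 2 = 1 then 1 else 0) * if p.2 % 2 = 1 then 1 else 0
  have h := four_mul_theta2_class (c := c) fun x y => by
    have : -y % 2 = 1 ↔ y % 2 = 1 := by omega
    simp only [c, this]
    ring
  have h1 : (fun p : ℤ × ℤ => c (p.1 - 2 * p.2, 2 * p.1 + p.2)) = c := by
    ext1 p
    have h3 : (p.1 - 2 * p.2) % 2 = 1 ↔ p.1 % 2 = 1 := by omega
    have h4 : (2 * p.1 + p.2) % 2 = 1 ↔ p.2 % 2 = 1 := by omega
    simp only [c, h3, h4]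
  have h2 : (fun p : ℤ × ℤ => c (5 * p.1, 5 * p.2)) = c := by
    ext1 p
    have h3 : (5 * p.1) % 2 = 1 ↔ p.1 % 2 = 1 := by omega
    have h4 : (5 * p.2) % 2 = 1 ↔ p.2 % 2 = 1 := by omega
    simp only [c, h3, h4]
  have h3 : theta2 c = (2 * (X * expand 8 (by norm_num) psiPos)) ^ 2 := by
    rw [← theta1_odd, sq, theta1_mul_theta1]
  have h4 : (fun p : ℤ × ℤ => if 5 ∣ p.1 - 2 ∧ 5 ∣ p.2 - 4 then c p else 0) = fun p =>
      (if p.1 % 10 = 7 then (1 : ℤ) else 0) * if p.2 % 10 = 9 then (1 : ℤ) else 0 := by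
    ext1 p
    by_cases h5 : p.1 % 10 = 7 ∧ p.2 % 10 = 9
    · rw [if_pos (by omega), if_pos h5.1, if_pos h5.2]
      simp only [c]
      rw [if_pos (by omega), if_pos (by omega)]
    · have h6 : (if p.1 % 10 = 7 then (1 : ℤ) else 0) * (if p.2 % 10 = 9 then (1 : ℤ) else 0) = 0 := by
        split_ifs <;> simp_all
      rw [h6]
      split_ifs with h7
      · simp only [c]
        split_ifs <;> omega
      · rfl
  rw [h4, ← theta1_mul_theta1 (fun x => if x % 10 = 7 then (1 : ℤ) else 0)
    (fun x => if x % 10 = 9 then (1 : ℤ) else 0), ← hG, ← hH, h1, h2, h3] at h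
  simp only [map_mul, map_pow, map_ofNat, expand_X, ← expand_mul] at h
  refine (expand_injective (by norm_num : (40 : ℕ) ≠ 0) ?_).symm
  refine X_pow_mul_left_cancel (k := 10) ?_
  have h8 : (4 : ℤ⟦X⟧) ≠ 0 := by
    rw [← map_ofNat (C : ℤ →+* ℤ⟦X⟧), Ne, map_eq_zero_iff _ PowerSeries.C_injective]
    norm_num
  refine mul_left_cancel₀ h8 ?_
  simp only [map_mul, map_pow, map_sub, expand_X, ← expand_mul]
  simp only [Nat.reduceMul] at h ⊢
  linear_combination h

end ThetaProducts

/-! ### Quadratic identity for φ, Jacobi's identity for f₁³, and the first Wronskian -/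

section ThetaIdentities

open PowerSeries Finset

variable {R S : Type*} [CommRing R] [CommRing S]

/-- The sign `(-1) ^ x`. -/
def signPow (x : ℤ) : ℤ := if x % 2 = 0 then 1 else -1

/-- The argument for ψ, with coefficients (-1)^(x+y). The minus sign on the right arises because y =
5n - 1 has the sign -(-1)ⁿ. -/
theorem phiMinus_sq_sub :
    phiMinus ^ 2 - expand 5 (by norm_num) phiMinus ^ 2 =
      -4 * X * (thetaSum (-1 : ℤˣ) 10 1 * thetaSum (-1 : ℤˣ) 10 3) := by
  have hP := X_pow_mul_expand_thetaSum (-1 : ℤˣ) (s := 2) (r := 1) (by norm_num) (by norm_num)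
    (c := signPow) (k := 1) (by norm_num) (j := 0)
    (σ := fun n => n) (fun a b h => h)
    (fun n => by rw [neg_one_zpow_val, signPow])
    (fun x hx => absurd ⟨x, rfl⟩ hx)
    (fun n => by push_cast; ring)
  rw [pow_zero, one_mul, expand_one_apply] at hP
  have hG := X_pow_mul_expand_thetaSum (-1 : ℤˣ) (s := 10) (r := 1) (by norm_num) (by norm_num)
    (c := fun x => if x % 5 = 2 then signPow x else 0) (k := 5) (by norm_num) (j := 4)
    (σ := fun n => 2 - 5 * n) (fun a b h => by simpa using h)
    (fun n => by
      simp only [signPow]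
      rw [neg_one_zpow_val]
      split_ifs <;> omega)
    (fun x hx => if_neg fun h => hx ⟨(2 - x) / 5, by simp only; omega⟩)
    (fun n => by push_cast; ring)
  have hH := X_pow_mul_expand_thetaSum (-1 : ℤˣ) (s := 10) (r := 3) (by norm_num) (by norm_num)
    (c := fun x => if x % 5 = 4 then - signPow x else 0) (k := 5) (by norm_num) (j := 1)
    (σ := fun n => 5 * n - 1) (fun a b h => by simpa using h)
    (fun n => by
      simp only [signPow]
      rw [neg_one_zpow_val]
      split_ifs <;> omega)
    (fun x hx => if_neg fun h => hx ⟨(x + 1) / 5, by simp only; omega⟩)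
    (fun n => by push_cast; ring)
  let c : ℤ × ℤ → ℤ := fun p => signPow p.1 * signPow p.2
  have h := four_mul_theta2_class (c := c) fun x y => by
    have : -y % 2 = 0 ↔ y % 2 = 0 := by omega
    simp only [c, signPow, this]
    ring
  have h1 : (fun p : ℤ × ℤ => c (p.1 - 2 * p.2, 2 * p.1 + p.2)) = c := by
    ext1 p
    have h3 : (p.1 - 2 * p.2) % 2 = 0 ↔ p.1 % 2 = 0 := by omega
    have h4 : (2 * p.1 + p.2) % 2 = 0 ↔ p.2 % 2 = 0 := by omega
    simp only [c, signPow, h3, h4]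
  have h2 : (fun p : ℤ × ℤ => c (5 * p.1, 5 * p.2)) = c := by
    ext1 p
    have h3 : (5 * p.1) % 2 = 0 ↔ p.1 % 2 = 0 := by omega
    have h4 : (5 * p.2) % 2 = 0 ↔ p.2 % 2 = 0 := by omega
    simp only [c, signPow, h3, h4]
  have h3 : theta2 c = phiMinus ^ 2 := by
    rw [phiMinus, hP, sq, theta1_mul_theta1]
  have h4 : (fun p : ℤ × ℤ => if 5 ∣ p.1 - 2 ∧ 5 ∣ p.2 - 4 then c p else 0) = fun p =>
      -((if p.1 % 5 = 2 then signPow p.1 else 0) * if p.2 % 5 = 4 then - signPow p.2 else 0) := by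
    ext1 p
    have h5 : 5 ∣ p.1 - 2 ↔ p.1 % 5 = 2 := by omega
    have h6 : 5 ∣ p.2 - 4 ↔ p.2 % 5 = 4 := by omega
    simp only [h5, h6, c, ite_and]
    split_ifs <;> simp
  have h5 := latSum_neg (fun p : ℤ × ℤ => (if p.1 % 5 = 2 then signPow p.1 else 0) *
    if p.2 % 5 = 4 then - signPow p.2 else 0) finiteFibers_sq_add_sq
  change theta2 _ = - theta2 _ at h5
  rw [h4, h5, ← theta1_mul_theta1 (fun x => if x % 5 = 2 then signPow x else 0)
    (fun x => if x % 5 = 4 then - signPow x else 0), ← hG, ← hH, h1, h2, h3] at h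
  refine expand_injective (by norm_num : (5 : ℕ) ≠ 0) ?_
  simp only [map_mul, map_pow, map_sub, map_neg, map_ofNat, expand_X, ← expand_mul] at h ⊢
  simp only [Nat.reduceMul] at h ⊢
  linear_combination -h

theorem chi4_neg (x : ℤ) : chi4 (-x) = - chi4 x := by
  simp only [chi4]
  split_ifs <;> omega

/-- For odd x and y both arguments shift by 2 mod 4, so the two sign changes cancel; otherwise both
sides vanish. -/
theorem chi4_mul_chi4_sublattice (x y : ℤ) :
    chi4 (x - 2 * y) * chi4 (2 * x + y) = chi4 x * chi4 y := by
  have hx : x % 4 = 0 ∨ x % 4 = 1 ∨ x % 4 = 2 ∨ x % 4 = 3 := by omega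
  have hy : y % 4 = 0 ∨ y % 4 = 1 ∨ y % 4 = 2 ∨ y % 4 = 3 := by omega
  have h1 : (x - 2 * y) % 4 = (x % 4 - 2 * (y % 4)) % 4 := by omega
  have h2 : (2 * x + y) % 4 = (2 * (x % 4) + y % 4) % 4 := by omega
  simp only [chi4, h1, h2]
  rcases hx with hx | hx | hx | hx <;> rcases hy with hy | hy | hy | hy <;>
    · rw [hx, hy]; norm_num

/-- Jacobi's identity `∑ (2 n - 1) (-1) ^ n q ^ (n (n - 1) / 2) = -2 ∏ (1 - q ^ m) ^ 3`. -/
theorem theta1_mul_chi4 :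
    theta1 (fun x => x * chi4 x) = 2 * (X * expand 8 (by norm_num) (eulerProd ℤ 1 ^ 3)) := by
  -- Dual numbers differentiate the triple product at z = -1: for z = -(1 + ε) one has zⁿ = (-1)ⁿ(1
  -- + nε), and the constant factor 1 + z = -ε leaves of the remaining factors only their value at ε
  -- = 0.
  let ε : DualNumber ℤ := DualNumber.eps
  have hε : ε * ε = 0 := DualNumber.eps_mul_eps
  let z : (DualNumber ℤ)ˣ := ⟨-(1 + ε), -(1 - ε), by linear_combination -hε,
    by linear_combination -hε⟩
  have hz : ∀ n : ℤ, ((z ^ n : (DualNumber ℤ)ˣ) : DualNumber ℤ) =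
      (signPow n : DualNumber ℤ) * (1 + (n : DualNumber ℤ) * ε) := by
    intro n
    induction n using Int.induction_on with
    | zero => simp [signPow]
    | succ n ih =>
      rw [zpow_add_one, Units.val_mul, ih]
      have : signPow ((n : ℤ) + 1) = - signPow n := by
        simp only [signPow]; split_ifs <;> omega
      rw [this]
      have : (z : DualNumber ℤ) = -(1 + ε) := rfl
      rw [this]
      push_cast
      linear_combination (-(signPow (n : ℤ) : DualNumber ℤ) * n) * hε
    | pred n ih =>
      rw [zpow_sub_one, Units.val_mul, ih]
      have : signPow (-(n : ℤ) - 1) = - signPow (-n) := by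
        simp only [signPow]; split_ifs <;> omega
      rw [this]
      have : ((z⁻¹ : (DualNumber ℤ)ˣ) : DualNumber ℤ) = -(1 - ε) := rfl
      rw [this]
      push_cast
      linear_combination (-(signPow (-n : ℤ) : DualNumber ℤ) * n) * hε
  have h := thetaSum_eq z (s := 1) (r := 0) (by norm_num) (by norm_num)
  rw [resProd_zero _ (by norm_num)] at h
  have hz1 : 1 + (z : DualNumber ℤ) = -ε := by
    have : (z : DualNumber ℤ) = -(1 + ε) := rfl
    rw [this]; ring
  have hzi : ((z⁻¹ : (DualNumber ℤ)ˣ) : DualNumber ℤ) = -(1 - ε) := rfl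
  rw [hz1] at h
  set Y : (DualNumber ℤ)⟦X⟧ := eulerProd _ 1 * resProd (z : DualNumber ℤ) 1 1 *
    resProd ((z⁻¹ : (DualNumber ℤ)ˣ) : DualNumber ℤ) 1 1 with hY
  have hY1 : PowerSeries.map (TrivSqZeroExt.fstHom ℤ ℤ ℤ).toRingHom Y = eulerProd ℤ 1 ^ 3 := by
    rw [hY, map_mul, map_mul, map_eulerProd, map_resProd, map_resProd, hzi]
    have h2 : (z : DualNumber ℤ) = -(1 + ε) := rfl
    rw [h2]
    simp [ε, eulerProd_eq_resProd]
    ring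
  have h3 : thetaSum z 1 0 = C (-ε) * Y := by
    rw [h, hY]; ring
  have hfib := finiteFibers_thetaExp (s := 1) (r := 0) (by norm_num) (by norm_num)
  have hA : ∀ N, coeff N (latSum signPow (thetaExp 1 0)) = 0 := by
    intro N
    have h4 := congrArg (fun f => TrivSqZeroExt.fst (coeff N f)) h3
    obtain ⟨t, ht⟩ := hfib.exists_finset (N + 1)
    simp only [thetaSum, coeff_C_mul] at h4
    rw [coeff_latSum_eq_sum _ fun i hi => ht i (by omega), TrivSqZeroExt.fst_sum] at h4
    rw [coeff_latSum_eq_sum _ fun i hi => ht i (by omega)]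
    simp only [hz] at h4
    simpa [ε, apply_ite] using h4
  have hB : ∀ N, coeff N (latSum (fun n => n * signPow n) (thetaExp 1 0)) =
      - coeff N (eulerProd ℤ 1 ^ 3) := by
    intro N
    have h4 := congrArg (fun f => TrivSqZeroExt.snd (coeff N f)) h3
    obtain ⟨t, ht⟩ := hfib.exists_finset (N + 1)
    simp only [thetaSum, coeff_C_mul] at h4
    rw [coeff_latSum_eq_sum _ fun i hi => ht i (by omega), TrivSqZeroExt.snd_sum] at h4
    rw [coeff_latSum_eq_sum _ fun i hi => ht i (by omega), ← hY1, coeff_map]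
    simp only [hz] at h4
    simpa [ε, apply_ite, mul_comm] using h4
  have h5 : latSum (fun n => -((2 * n - 1) * signPow n)) (thetaExp 1 0) =
      2 * eulerProd ℤ 1 ^ 3 := by
    have h6 : (fun n : ℤ => -((2 * n - 1) * signPow n)) = fun n =>
        signPow n - 2 * (n * signPow n) := by
      ext1 n; ring
    rw [h6, latSum_sub _ _ hfib, latSum_const_mul _ _ hfib]
    ext N
    rw [map_sub, coeff_C_mul, hA, hB, ← map_ofNat (C : ℤ →+* ℤ⟦X⟧), coeff_C_mul]
    ring
  rw [← X_pow_mul_expand_latSum hfib (c := fun n => -((2 * n - 1) * signPow n))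
    (k := 8) (by norm_num) (j := 1) (σ := fun n => 2 * n - 1) (fun a b h => by simpa using h),
    h5, map_mul, map_ofNat]
  · ring
  · intro n
    have : chi4 (2 * n - 1) = - signPow n := by
      simp only [chi4, signPow]
      split_ifs <;> omega
    rw [this]
    ring
  · intro x hx
    have : chi4 x = 0 := by
      have : x % 2 = 0 := by
        by_contra h
        exact hx ⟨(x + 1) / 2, by simp only; omega⟩
      simp only [chi4]
      split_ifs <;> omega
    rw [this, mul_zero]
  · intro n
    have := two_mul_thetaExp (s := 1) (r := 0) (by norm_num) n
    push_cast at this ⊢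
    linear_combination 4 * this

/-- The weight whose theta series is the Wronskian of two theta series of weight `1 / 2`. -/
def wronskWeight (p : ℤ × ℤ) : ℤ := chi4 p.1 * chi4 p.2 * (p.1 ^ 2 - p.2 ^ 2)

theorem wronskWeight_quarterTurn (x y : ℤ) : wronskWeight (-y, x) = wronskWeight (x, y) := by
  simp only [wronskWeight, chi4_neg]
  ring

theorem theta2_wronskWeight : theta2 wronskWeight = 0 :=
  theta2_eq_zero_of_antisymm fun x y => by
    simp only [wronskWeight]
    ring

/-- (x - 2y)² - (2x + y)² = -3(x² - y²) - 8xy. The first part contributes nothing by antisymmetry,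
and the second separates into the square of Jacobi's series for f₁³. -/
theorem theta2_wronskWeight_sublattice :
    theta2 (fun p => wronskWeight (p.1 - 2 * p.2, 2 * p.1 + p.2)) =
      -32 * X ^ 2 * expand 8 (by norm_num) (eulerProd ℤ 1 ^ 6) := by
  have h : (fun p : ℤ × ℤ => wronskWeight (p.1 - 2 * p.2, 2 * p.1 + p.2)) = fun p =>
      -3 * wronskWeight p - 8 * ((p.1 * chi4 p.1) * (p.2 * chi4 p.2)) := by
    ext1 p
    simp only [wronskWeight]
    rw [chi4_mul_chi4_sublattice]
    ring
  rw [h, theta2_sub, theta2_const_mul, theta2_const_mul, theta2_wronskWeight,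
    ← theta1_mul_theta1 (fun x => x * chi4 x) (fun x => x * chi4 x), theta1_mul_chi4]
  simp only [map_pow, map_ofNat]
  ring

/-- The Wronskian of the Rogers–Ramanujan theta functions. -/
theorem wronskian_thetaSum_five :
    thetaSum (-1 : ℤˣ) 5 1 * thetaSum (-1 : ℤˣ) 5 2 +
      5 * (eulerDeriv (thetaSum (-1 : ℤˣ) 5 1) * thetaSum (-1 : ℤˣ) 5 2 -
        thetaSum (-1 : ℤˣ) 5 1 * eulerDeriv (thetaSum (-1 : ℤˣ) 5 2)) = eulerProd ℤ 1 ^ 6 := by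
  have hG := X_pow_mul_expand_thetaSum (-1 : ℤˣ) (s := 5) (r := 1) (by norm_num) (by norm_num)
    (c := fun x => if x % 5 = 2 then chi4 x else 0) (k := 40) (by norm_num) (j := 9)
    (σ := fun n => 10 * n - 3) (fun a b h => by simpa using h)
    (fun n => by
      simp only [chi4]
      rw [neg_one_zpow_val]
      split_ifs <;> omega)
    (fun x hx => by
      simp only [chi4]
      have : ¬ x % 10 = 7 := fun h => hx ⟨(x + 3) / 10, by simp only; omega⟩
      split_ifs <;> omega)
    (fun n => by push_cast; ring)
  have hH := X_pow_mul_expand_thetaSum (-1 : ℤˣ) (s := 5) (r := 2) (by norm_num) (by norm_num)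
    (c := fun x => if x % 5 = 4 then - chi4 x else 0) (k := 40) (by norm_num) (j := 1)
    (σ := fun n => 10 * n - 1) (fun a b h => by simpa using h)
    (fun n => by
      simp only [chi4]
      rw [neg_one_zpow_val]
      split_ifs <;> omega)
    (fun x hx => by
      simp only [chi4]
      have : ¬ x % 10 = 9 := fun h => hx ⟨(x + 1) / 10, by simp only; omega⟩
      split_ifs <;> omega)
    (fun n => by push_cast; ring)
  set G := thetaSum (-1 : ℤˣ) 5 1
  set H := thetaSum (-1 : ℤˣ) 5 2
  have h := four_mul_theta2_class wronskWeight_quarterTurn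
  have h2 : theta2 (fun p : ℤ × ℤ => wronskWeight (5 * p.1, 5 * p.2)) = 0 :=
    theta2_eq_zero_of_antisymm fun x y => by
      simp only [wronskWeight]
      ring
  rw [theta2_wronskWeight_sublattice, h2, map_zero, sub_zero] at h
  -- Multiplication of coefficients by x² is q d/dq on ∑ c(x) q^(x²), so the factor x² - y² produces
  -- a Wronskian.
  have h4 : (fun p : ℤ × ℤ => if 5 ∣ p.1 - 2 ∧ 5 ∣ p.2 - 4 then wronskWeight p else 0) = fun p =>
      (if p.1 % 5 = 2 then chi4 p.1 else 0) *
        (((p.2 : ℤ) : ℤ) ^ 2 * if p.2 % 5 = 4 then - chi4 p.2 else 0) -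
      (((p.1 : ℤ) : ℤ) ^ 2 * if p.1 % 5 = 2 then chi4 p.1 else 0) *
        (if p.2 % 5 = 4 then - chi4 p.2 else 0) := by
    ext1 p
    have h5 : 5 ∣ p.1 - 2 ↔ p.1 % 5 = 2 := by omega
    have h6 : 5 ∣ p.2 - 4 ↔ p.2 % 5 = 4 := by omega
    simp only [h5, h6, wronskWeight, ite_and]
    split_ifs <;> ring
  have h7 := eulerDeriv_theta1 (fun x => if x % 5 = 2 then chi4 x else 0)
  have h8 := eulerDeriv_theta1 (fun x => if x % 5 = 4 then - chi4 x else 0)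
  simp only [Int.cast_id] at h7 h8
  rw [h4, theta2_sub,
    ← theta1_mul_theta1 (fun x => if x % 5 = 2 then chi4 x else 0)
      (fun x => x ^ 2 * if x % 5 = 4 then - chi4 x else 0),
    ← theta1_mul_theta1 (fun x => x ^ 2 * if x % 5 = 2 then chi4 x else 0)
      (fun x => if x % 5 = 4 then - chi4 x else 0), ← h7, ← h8, ← hG, ← hH] at h
  -- Differentiating the prefactors q⁹ and q leaves 1 - 9 = -8 times the product, while the
  -- expansion by 40 contributes a factor 40; hence the 5 in the statement.
  simp only [eulerDeriv_mul, eulerDeriv_X_pow, eulerDeriv_expand] at h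
  refine expand_injective (by norm_num : (40 : ℕ) ≠ 0) ?_
  refine X_pow_mul_left_cancel (k := 10) ?_
  have h9 : (32 : ℤ⟦X⟧) ≠ 0 := by
    rw [← map_ofNat (C : ℤ →+* ℤ⟦X⟧), Ne, map_eq_zero_iff _ PowerSeries.C_injective]
    norm_num
  refine mul_left_cancel₀ h9 ?_
  simp only [map_add, map_mul, map_pow, map_sub, map_neg, map_ofNat, expand_X, ← expand_mul] at h ⊢
  simp only [Nat.reduceMul] at h ⊢
  push_cast at h
  linear_combination -h

end ThetaIdentities

/-! ### Logarithmic derivatives and Lambert series -/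

section Lambert

open PowerSeries Finset

variable {R S : Type*} [CommRing R] [CommRing S]

theorem eulerDeriv_sub (f g : R⟦X⟧) : eulerDeriv (f - g) = eulerDeriv f - eulerDeriv g := by
  ext n
  simp [eulerDeriv, mul_sub]

theorem eulerDeriv_C (a : R) : eulerDeriv (C a) = 0 := by
  rw [eulerDeriv_eq, derivative_C, mul_zero]

theorem X_pow_dvd_eulerDeriv {f : R⟦X⟧} {N : ℕ} (h : (X : R⟦X⟧) ^ N ∣ f) :
    (X : R⟦X⟧) ^ N ∣ eulerDeriv f := by
  rw [X_pow_dvd_iff] at h ⊢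
  intro m hm
  rw [eulerDeriv, coeff_mk, h m hm, mul_zero]

/-- Additivity of logarithmic derivatives. Writing them as L with θf = fL avoids division. -/
theorem eulerDeriv_prod {ι : Type*} {s : Finset ι} {f L : ι → R⟦X⟧}
    (h : ∀ i ∈ s, eulerDeriv (f i) = f i * L i) :
    eulerDeriv (∏ i ∈ s, f i) = (∏ i ∈ s, f i) * ∑ i ∈ s, L i := by
  classical
  induction s using Finset.induction_on with
  | empty => simpa using eulerDeriv_C (1 : R)
  | insert i s hi ih =>
    rw [prod_insert hi, sum_insert hi, eulerDeriv_mul, ih fun j hj => h j (by simp [hj]),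
      h i (by simp)]
    ring

theorem eulerDeriv_prodX {f L : ℕ → R⟦X⟧} (hf : Admissible f)
    (h : ∀ m, eulerDeriv (f m) = f m * L m) (hL : ∀ m, (X : R⟦X⟧) ^ m ∣ L m) :
    eulerDeriv (prodX f) =
      prodX f * PowerSeries.mk fun N => ∑ m ∈ range (N + 1), coeff N (L m) := by
  refine eq_of_forall_X_pow_dvd_sub fun N => ?_
  have h1 := X_pow_dvd_eulerDeriv (hf.dvd_prodX_sub (le_refl N))
  rw [eulerDeriv_sub, eulerDeriv_prod fun i _ => h i] at h1
  have h2 : (X : R⟦X⟧) ^ N ∣ (∑ m ∈ range N, L m) -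
      PowerSeries.mk fun N => ∑ m ∈ range (N + 1), coeff N (L m) := by
    refine X_pow_dvd_sub_of_coeff_eq fun n hn => ?_
    rw [coeff_mk, map_sum, ← sum_subset (range_subset_range.2 (by omega : n + 1 ≤ N))]
    intro m _ hm
    rw [mem_range] at hm
    exact X_pow_dvd_iff.1 (hL m) n (by omega)
  have h3 := dvd_mul_sub_mul_of_dvd (dvd_sub_comm.1 (hf.dvd_prodX_sub (le_refl N))) h2
  have := dvd_add h1 h3
  rwa [sub_add_sub_cancel] at this

/-- The logarithmic derivative of `1 - v q ^ k`. -/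
noncomputable def lambertTerm (v : R) (k : ℕ) : R⟦X⟧ :=
  PowerSeries.mk fun N => if k ∣ N ∧ N ≠ 0 then -(k * v ^ (N / k)) else 0

theorem eulerDeriv_one_sub (v : R) {k : ℕ} (hk : 0 < k) :
    eulerDeriv (1 - C v * X ^ k) = (1 - C v * X ^ k) * lambertTerm v k := by
  have h1 : eulerDeriv (1 - C v * X ^ k) = - (C (k * v) * X ^ k : R⟦X⟧) := by
    rw [eulerDeriv_sub, eulerDeriv_mul, ← map_one (C : R →+* R⟦X⟧), eulerDeriv_C, eulerDeriv_C,
      eulerDeriv_X_pow, map_mul, map_natCast]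
    ring
  rw [h1]
  ext N
  rw [sub_mul, one_mul, mul_assoc, map_sub, map_neg, coeff_C_mul, coeff_C_mul, coeff_X_pow_mul',
    coeff_X_pow, lambertTerm, coeff_mk, coeff_mk]
  by_cases hN : k ≤ N
  · obtain ⟨M, rfl⟩ := Nat.exists_eq_add_of_le hN
    rw [if_pos hN, Nat.add_sub_cancel_left]
    by_cases hd : k ∣ M
    · obtain ⟨j, rfl⟩ := hd
      rw [show k + k * j = k * (j + 1) by ring, Nat.mul_div_cancel_left _ hk,
        Nat.mul_div_cancel_left _ hk, if_pos (⟨⟨j + 1, rfl⟩, by positivity⟩ :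
          k ∣ k * (j + 1) ∧ k * (j + 1) ≠ 0)]
      rcases j.eq_zero_or_pos with rfl | hj
      · simp
      · rw [if_neg (by nlinarith), if_pos (⟨⟨j, rfl⟩, by positivity⟩ : k ∣ k * j ∧ k * j ≠ 0),
          pow_succ]
        ring
    · have h2 : ¬ k ∣ k + M := fun h => hd ((Nat.dvd_add_right (dvd_refl k)).1 h)
      rw [if_neg fun h => h2 (by rw [h]), if_neg fun h => h2 h.1, if_neg fun h => hd h.1]
      simp
  · rw [if_neg hN, if_neg (by omega), if_neg fun h => hN (Nat.le_of_dvd (by omega) h.1)]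
    simp

/-- The logarithmic derivative of `∏ (1 - v q ^ k)` over the `k ≥ 1` congruent to `r` modulo
`s`. -/
noncomputable def lambertSeries (v : R) (s r : ℕ) : R⟦X⟧ :=
  PowerSeries.mk fun N => -∑ d ∈ N.divisors, if d % s = r % s then (d : R) * v ^ (N / d) else 0

theorem mul_sub_div_add_of_mod_eq {s r d : ℕ} (hrs : r ≤ s) (hd : 0 < d)
    (h : d % s = r % s) : s * ((d - r) / s) + r = d := by
  have hrd : r ≤ d := by
    rcases hrs.eq_or_lt with rfl | hlt
    · rw [Nat.mod_self] at h
      exact Nat.le_of_dvd hd (Nat.dvd_of_mod_eq_zero h)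
    · rw [Nat.mod_eq_of_lt hlt] at h
      exact h ▸ Nat.mod_le _ _
  rw [Nat.mul_div_cancel' (Nat.dvd_of_mod_eq_zero (Nat.sub_mod_eq_zero_of_mod_eq h))]
  omega

theorem eulerDeriv_resProd (v : R) {s r : ℕ} (hr : 0 < r) (hrs : r ≤ s) :
    eulerDeriv (resProd (-v) s r) = resProd (-v) s r * lambertSeries v s r := by
  have hs : 0 < s := hr.trans_le hrs
  have hform : ∀ m, (1 : R⟦X⟧) + C (-v) * X ^ (s * m + r) = 1 - C v * X ^ (s * m + r) := by
    intro m
    rw [map_neg]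
    ring
  rw [resProd, eulerDeriv_prodX (L := fun m => lambertTerm v (s * m + r))
    (admissible_resProd (-v) hs r)]
  · congr 1
    ext N
    rw [coeff_mk, lambertSeries, coeff_mk]
    simp only [lambertTerm, coeff_mk]
    rw [← sum_filter, ← sum_filter, ← sum_neg_distrib]
    refine sum_nbij' (fun m => s * m + r) (fun d => (d - r) / s) ?_ ?_ ?_ ?_ fun _ _ => rfl
    · intro m hm
      simp only [mem_filter, mem_range, Nat.mem_divisors] at hm ⊢
      exact ⟨hm.2, Nat.mul_add_mod s m r⟩
    · intro d hd
      simp only [mem_filter, mem_range, Nat.mem_divisors] at hd ⊢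
      rw [mul_sub_div_add_of_mod_eq hrs
        (Nat.pos_of_dvd_of_pos hd.1.1 (Nat.pos_of_ne_zero hd.1.2)) hd.2]
      refine ⟨?_, hd.1⟩
      have := Nat.le_of_dvd (Nat.pos_of_ne_zero hd.1.2) hd.1.1
      exact Nat.lt_succ_of_le ((Nat.div_le_self _ _).trans (by omega))
    · intro m _
      simp [hs]
    · intro d hd
      simp only [mem_filter, Nat.mem_divisors] at hd
      exact mul_sub_div_add_of_mod_eq hrs
        (Nat.pos_of_dvd_of_pos hd.1.1 (Nat.pos_of_ne_zero hd.1.2)) hd.2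
  · intro m
    rw [hform, eulerDeriv_one_sub v (by omega)]
  · intro m
    rw [X_pow_dvd_iff]
    intro n hn
    rw [lambertTerm, coeff_mk, if_neg]
    rintro ⟨h1, h2⟩
    have := Nat.le_of_dvd (by omega) h1
    nlinarith

theorem eulerDeriv_mul_of_eq {f g L M : R⟦X⟧} (hf : eulerDeriv f = f * L)
    (hg : eulerDeriv g = g * M) : eulerDeriv (f * g) = f * g * (L + M) := by
  rw [eulerDeriv_mul, hf, hg]
  ring

/-- The quadratic character modulo `5`. -/
def chi5 (n : ℕ) : ℤ := if n % 5 = 1 ∨ n % 5 = 4 then 1 else if n % 5 = 2 ∨ n % 5 = 3 then -1 else 0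

/-- `∑ χ(n / d) d` over the divisors `d` of `n`. -/
def sigmaA (n : ℕ) : ℤ := ∑ d ∈ n.divisors, d * chi5 (n / d)

/-- `∑ χ(d) d` over the divisors `d` of `n`. -/
def sigmaB (n : ℕ) : ℤ := ∑ d ∈ n.divisors, d * chi5 d

/-- Ramanujan's identity `∏ (1 - q ^ m) ^ 5 / (1 - q ^ (5 m)) = 1 - 5 ∑ χ(n) n q ^ n / (1 - q ^ n)`. -/
theorem eulerProd_five_mul_lambert :
    eulerProd ℤ 5 * (1 - 5 * PowerSeries.mk sigmaB) = eulerProd ℤ 1 ^ 5 := by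
  have hW := wronskian_thetaSum_five
  have hGH := thetaSum_neg_one_five_mul
  have hG := thetaSum_eq (-1 : ℤˣ) (s := 5) (r := 1) (by norm_num) (by norm_num)
  have hH := thetaSum_eq (-1 : ℤˣ) (s := 5) (r := 2) (by norm_num) (by norm_num)
  simp only [inv_neg, inv_one, Units.val_one, Units.val_neg, eulerProd_eq_resProd] at hG hH
  norm_num at hG hH
  have hr : ∀ r, 0 < r → r ≤ 5 → eulerDeriv (resProd (-1 : ℤ) 5 r) =
      resProd (-1) 5 r * lambertSeries 1 5 r := fun r h1 h2 => eulerDeriv_resProd 1 h1 h2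
  have hG' := eulerDeriv_mul_of_eq (hr 5 (by norm_num) (by norm_num))
    (eulerDeriv_mul_of_eq (hr 1 (by norm_num) (by norm_num)) (hr 4 (by norm_num) (by norm_num)))
  have hH' := eulerDeriv_mul_of_eq (hr 5 (by norm_num) (by norm_num))
    (eulerDeriv_mul_of_eq (hr 2 (by norm_num) (by norm_num)) (hr 3 (by norm_num) (by norm_num)))
  rw [← hG] at hG'
  rw [← hH] at hH'
  -- In the difference of the two logarithmic derivatives the common residue 5 drops out, and the
  -- residues 1, 4 and 2, 3 enter with opposite signs, which is χ.
  have hL : (lambertSeries 1 5 1 + lambertSeries 1 5 4 - lambertSeries 1 5 2 -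
      lambertSeries 1 5 3 : ℤ⟦X⟧) = - PowerSeries.mk sigmaB := by
    ext N
    simp only [map_add, map_sub, map_neg, lambertSeries, coeff_mk, sigmaB, ← sum_neg_distrib,
      ← sum_add_distrib, ← sum_sub_distrib]
    refine sum_congr rfl fun d _ => ?_
    have : d % 5 = 0 ∨ d % 5 = 1 ∨ d % 5 = 2 ∨ d % 5 = 3 ∨ d % 5 = 4 := by omega
    rcases this with h | h | h | h | h <;> simp [chi5, h]
  rw [hG', hH'] at hW
  refine mul_left_cancel₀ (eulerProd_ne_zero (R := ℤ) (k := 1) (by norm_num)) ?_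
  linear_combination hW - 5 * thetaSum (-1) 5 1 * thetaSum (-1) 5 2 * hL -
    (1 - 5 * PowerSeries.mk sigmaB) * hGH

end Lambert

/-! ### Theta functions at fifth roots of unity -/

section CyclotomicTheta

open PowerSeries Finset

variable {R S : Type*} [CommRing R] [CommRing S]

theorem map_theta2 (φ : R →+* S) (c : ℤ × ℤ → R) :
    PowerSeries.map φ (theta2 c) = theta2 fun p => φ (c p) :=
  map_latSum φ c finiteFibers_sq_add_sq

theorem neg_one_zpow_val' (n : ℤ) : (((-1 : Rˣ) ^ n : Rˣ) : R) = signPow n := by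
  rw [signPow]
  split_ifs with h
  · rw [(Int.even_iff.2 h).neg_one_zpow]
    simp
  · rw [(Int.odd_iff.2 (by omega)).neg_one_zpow]
    simp

theorem unit_pow_five {ζ : Rˣ} (hζ : (ζ : R) ^ 4 + ζ ^ 3 + ζ ^ 2 + ζ + 1 = 0) : ζ ^ 5 = 1 := by
  ext
  push_cast
  linear_combination ((ζ : R) - 1) * hζ

theorem zpow_eq_of_pow_five {ξ : Rˣ} (hξ : ξ ^ 5 = 1) {m n : ℤ} (h : 5 ∣ m - n) :
    ξ ^ m = ξ ^ n := by
  obtain ⟨k, hk⟩ := h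
  have : m = n + 5 * k := by omega
  rw [this, zpow_add, zpow_mul, show ξ ^ (5 : ℤ) = ξ ^ 5 from by norm_cast, hξ, one_zpow, mul_one]

/-- For x = 2n - 1 the exponent n = (x + 1)/2 is congruent to 3(x + 1) mod 5, since 3 inverts 2. -/
theorem X_mul_expand_thetaSum_of_pow_five {ξ : Rˣ} (hξ : ξ ^ 5 = 1) :
    X ^ 1 * expand 8 (by norm_num) (thetaSum (-1 * ξ) 1 0) =
      theta1 fun x => -(chi4 x : R) * ((ξ ^ (3 * (x + 1)) : Rˣ) : R) := by
  refine X_pow_mul_expand_thetaSum _ (by norm_num) (by norm_num) (by norm_num)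
    (σ := fun n => 2 * n - 1) (fun a b h => by simpa using h) (fun n => ?_) (fun x hx => ?_)
    fun n => by push_cast; ring
  · have : chi4 (2 * n - 1) = - signPow n := by
      simp only [chi4, signPow]
      split_ifs <;> omega
    rw [mul_zpow, Units.val_mul, neg_one_zpow_val', this,
      zpow_eq_of_pow_five hξ (m := 3 * (2 * n - 1 + 1)) (n := n) ⟨n, by ring⟩]
    push_cast
    ring
  · have : chi4 x = 0 := by
      have : x % 2 = 0 := by
        by_contra h
        exact hx ⟨(x + 1) / 2, by simp only; omega⟩
      simp only [chi4]
      split_ifs <;> omega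
    rw [this]
    simp

/-- The Wronskian of the two theta functions attached to the fifth roots of unity. -/
theorem wronskian_thetaSum_root [IsDomain R] [CharZero R] {ζ : Rˣ}
    (hζ : (ζ : R) ^ 4 + ζ ^ 3 + ζ ^ 2 + ζ + 1 = 0) :
    eulerDeriv (thetaSum (-1 * ζ) 1 0) * thetaSum (-1 * ζ ^ 2) 1 0 -
      thetaSum (-1 * ζ) 1 0 * eulerDeriv (thetaSum (-1 * ζ ^ 2) 1 0) =
      -5 * C (ζ : R) ^ 4 * X * eulerProd R 5 ^ 6 := by
  have h5 := unit_pow_five hζ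
  have h52 : (ζ ^ 2) ^ 5 = 1 := by rw [← pow_mul, mul_comm, pow_mul, h5, one_pow]
  have hU := X_mul_expand_thetaSum_of_pow_five h5
  have hV := X_mul_expand_thetaSum_of_pow_five h52
  set U := thetaSum (-1 * ζ) 1 0
  set V := thetaSum (-1 * ζ ^ 2) 1 0
  let c : ℤ × ℤ → R := fun p => (wronskWeight p : R)
  have hmap : ∀ w : ℤ × ℤ → ℤ, theta2 (fun p => (w p : R)) =
      PowerSeries.map (Int.castRingHom R) (theta2 w) := fun w => by
    rw [map_theta2]; rfl
  have hc0 : theta2 c = 0 := by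
    simp only [c]
    rw [hmap, theta2_wronskWeight, map_zero]
  -- The two theta functions carry ζ^(3(x+1)) and ζ^(6(y+1)); their product depends only on x + 2y.
  let g : ℤ → R := fun s => ((ζ ^ (3 * s + 9) : Rˣ) : R)
  have h := four_mul_theta2_twist (c := c) (fun x y => by
    simp only [c, wronskWeight_quarterTurn]) hc0 (g := g) fun s => by
      simp only [g]
      rw [zpow_eq_of_pow_five h5 (m := 3 * (s % 5) + 9) (n := 3 * s + 9) (by omega)]
  have hg : ∀ (s : ℤ) (k : ℕ), 5 ∣ 3 * s + 9 - k → g s = (ζ : R) ^ k := by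
    intro s k hk
    simp only [g]
    rw [zpow_eq_of_pow_five h5 hk, zpow_natCast, Units.val_pow_eq_pow_val]
  -- g 0 = ζ⁴ and the other values are the remaining four powers of ζ; the five powers add up to 0.
  have hg' : 4 * g 0 - g 1 - g 2 - g 3 - g 4 = 5 * (ζ : R) ^ 4 := by
    rw [hg 0 4 (by norm_num), hg 1 2 (by norm_num), hg 2 0 (by norm_num), hg 3 3 (by norm_num),
      hg 4 1 (by norm_num)]
    linear_combination -hζ
  simp only [c] at h
  rw [hg', hmap (fun p => wronskWeight (p.1 - 2 * p.2, 2 * p.1 + p.2)),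
    theta2_wronskWeight_sublattice] at h
  let cU : ℤ → R := fun x => -(chi4 x : R) * ((ζ ^ (3 * (x + 1)) : Rˣ) : R)
  let cV : ℤ → R := fun x => -(chi4 x : R) * (((ζ ^ 2) ^ (3 * (x + 1)) : Rˣ) : R)
  have h4 : (fun p : ℤ × ℤ => g (p.1 + 2 * p.2) * (wronskWeight p : R)) = fun p =>
      ((p.1 : R) ^ 2 * cU p.1) * cV p.2 - cU p.1 * ((p.2 : R) ^ 2 * cV p.2) := by
    ext1 p
    simp only [wronskWeight, g, cU, cV]
    have : (ζ ^ 2) ^ (3 * (p.2 + 1)) = ζ ^ (6 * (p.2 + 1)) := by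
      rw [← zpow_natCast, ← zpow_mul]
      congr 1
      push_cast
      ring
    rw [this, show 3 * (p.1 + 2 * p.2) + 9 = 3 * (p.1 + 1) + 6 * (p.2 + 1) by ring, zpow_add]
    push_cast
    ring
  rw [h4, theta2_sub, ← theta1_mul_theta1 (fun x => (x : R) ^ 2 * cU x) cV,
    ← theta1_mul_theta1 cU (fun x => (x : R) ^ 2 * cV x), ← eulerDeriv_theta1,
    ← eulerDeriv_theta1, ← hU, ← hV] at h
  simp only [eulerDeriv_mul, eulerDeriv_X_pow, eulerDeriv_expand] at h
  refine expand_injective (by norm_num : (8 : ℕ) ≠ 0) ?_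
  refine X_pow_mul_left_cancel (k := 2) ?_
  have h9 : (32 : R⟦X⟧) ≠ 0 := by
    rw [← map_ofNat (C : R →+* R⟦X⟧), Ne, map_eq_zero_iff _ PowerSeries.C_injective]
    norm_num
  refine mul_left_cancel₀ h9 ?_
  have hE : expand 5 (by norm_num) (expand 8 (by norm_num) (eulerProd R 1)) =
      expand 8 (by norm_num) (eulerProd R 5) := by
    rw [expand_eulerProd one_pos, expand_eulerProd (by norm_num), expand_eulerProd (by norm_num)]
    norm_num
  have hE' : PowerSeries.map (Int.castRingHom R) (expand 8 (by norm_num) (eulerProd ℤ 1)) =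
      expand 8 (by norm_num) (eulerProd R 1) := by
    rw [expand_eulerProd one_pos, expand_eulerProd one_pos, map_eulerProd]
  simp only [map_neg, map_mul, map_pow, map_ofNat, map_X] at h
  simp only [map_mul, map_pow, map_sub, map_neg, map_ofNat, hE', hE, expand_X,
    expand_C] at h ⊢
  push_cast at h
  linear_combination h

/-- Factor by factor this is 1 - x⁵ = ∏ (1 - ζ^j x). -/
theorem eulerProd_mul_roots {ζ : Rˣ} (hζ : (ζ : R) ^ 4 + ζ ^ 3 + ζ ^ 2 + ζ + 1 = 0) :
    eulerProd R 1 * (resProd (-(ζ : R)) 1 1 * resProd (-(ζ : R) ^ 4) 1 1 *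
    (resProd (-(ζ : R) ^ 2) 1 1 * resProd (-(ζ : R) ^ 3) 1 1)) = eulerProd R 5 := by
  rw [eulerProd_eq_resProd]
  simp only [resProd]
  have ha : ∀ u : R, Admissible fun m => 1 + C u * X ^ (1 * m + 1) :=
    fun u => admissible_resProd u one_pos 1
  rw [← prodX_mul (ha _) (ha _), ← prodX_mul (ha _) (ha _),
    ← prodX_mul ((ha _).mul (ha _)) ((ha _).mul (ha _)),
    ← prodX_mul (ha _) (((ha _).mul (ha _)).mul ((ha _).mul (ha _))), eulerProd]
  congr 1
  ext1 m
  have hC : (C (ζ : R) : R⟦X⟧) ^ 4 + C (ζ : R) ^ 3 + C (ζ : R) ^ 2 + C (ζ : R) + 1 = 0 := by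
    have := congrArg (C : R →+* R⟦X⟧) hζ
    simpa using this
  rw [show 5 * (m + 1) = (1 * m + 1) * 5 by ring, pow_mul]
  simp only [map_neg, map_pow, map_one]
  set x : R⟦X⟧ := X ^ (1 * m + 1)
  set z : R⟦X⟧ := C (ζ : R)
  linear_combination ((1 - x) * (-x + (z ^ 3 + z - 1) * x ^ 2 + -(z ^ 5 - z + 1) * x ^ 3 +
    (z ^ 5 + 1) * (z - 1) * x ^ 4)) * hC

/-- Separability of the Gauss sum: ∑ χ(j) ζ^(jk) = χ(k) ∑ χ(j) ζ^j. -/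
theorem root_sub_eq_chi5 {ζ : Rˣ} (hζ : (ζ : R) ^ 4 + ζ ^ 3 + ζ ^ 2 + ζ + 1 = 0)
    (k : ℕ) : (ζ : R) ^ k + (ζ ^ 4) ^ k - (ζ ^ 2) ^ k - (ζ ^ 3) ^ k =
    (chi5 k : R) * (ζ + ζ ^ 4 - ζ ^ 2 - ζ ^ 3) := by
  have h5 : (ζ : R) ^ 5 = 1 := by linear_combination ((ζ : R) - 1) * hζ
  have key : ∀ j, (ζ : R) ^ (k * j) = ζ ^ (k % 5 * j) := by
    intro j
    conv_lhs => rw [← Nat.div_add_mod k 5, add_mul, pow_add, mul_assoc, pow_mul, h5, one_pow, one_mul]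
  have h1 := key 1
  rw [mul_one, mul_one] at h1
  rw [← pow_mul, ← pow_mul, ← pow_mul, mul_comm 4, mul_comm 2, mul_comm 3, h1, key, key, key]
  have : k % 5 = 0 ∨ k % 5 = 1 ∨ k % 5 = 2 ∨ k % 5 = 3 ∨ k % 5 = 4 := by omega
  rcases this with h | h | h | h | h <;> simp only [chi5, h] <;> norm_num
  · linear_combination ((ζ : R) ^ 3 - ζ) * h5
  · linear_combination ((ζ : R) ^ 7 + ζ ^ 2 - ζ - ζ ^ 4) * h5
  · linear_combination ((ζ : R) ^ 11 + ζ ^ 6 + ζ - ζ ^ 3 - ζ ^ 7 - ζ ^ 2) * h5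

/-- By the triple product the two theta functions multiply to (1 - ζ)(1 - ζ²) f₁f₅, and their
logarithmic derivatives differ by -τ ∑ σ_A(n) qⁿ with τ the Gauss sum. Since τ(1 - ζ)(1 - ζ²) = 5ζ⁴,
the constants cancel against those of the Wronskian. -/
theorem eulerProd_mul_lambert_of_root [IsDomain R] [CharZero R] {ζ : Rˣ}
    (hζ : (ζ : R) ^ 4 + ζ ^ 3 + ζ ^ 2 + ζ + 1 = 0) :
    eulerProd R 1 * PowerSeries.mk (fun n => (sigmaA n : R)) = X * eulerProd R 5 ^ 5 := by
  have h5 := unit_pow_five hζ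
  have h5' : (ζ : R) ^ 5 = 1 := by linear_combination ((ζ : R) - 1) * hζ
  have hW := wronskian_thetaSum_root hζ
  have hi1 : (-1 * ζ)⁻¹ = -1 * ζ ^ 4 := by
    rw [_root_.inv_eq_iff_mul_eq_one]
    ext
    push_cast
    linear_combination h5'
  have hi2 : (-1 * ζ ^ 2)⁻¹ = -1 * ζ ^ 3 := by
    rw [_root_.inv_eq_iff_mul_eq_one]
    ext
    push_cast
    linear_combination h5'
  have hU := thetaSum_eq (-1 * ζ) (s := 1) (r := 0) (by norm_num) (by norm_num)
  have hV := thetaSum_eq (-1 * ζ ^ 2) (s := 1) (r := 0) (by norm_num) (by norm_num)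
  rw [resProd_zero _ one_pos, hi1] at hU
  rw [resProd_zero _ one_pos, hi2] at hV
  push_cast at hU hV
  simp only [neg_mul, one_mul] at hU hV
  have hr : ∀ v : R, eulerDeriv (resProd (-v) 1 1) = resProd (-v) 1 1 * lambertSeries v 1 1 :=
    fun v => eulerDeriv_resProd v one_pos le_rfl
  have hC : ∀ a : R, eulerDeriv (C a) = C a * 0 := fun a => by rw [eulerDeriv_C, mul_zero]
  have hE : eulerDeriv (eulerProd R 1) = eulerProd R 1 * lambertSeries 1 1 1 := by
    rw [eulerProd_eq_resProd]; exact hr 1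
  have hU' := eulerDeriv_mul_of_eq hE (eulerDeriv_mul_of_eq
    (eulerDeriv_mul_of_eq (hC (1 + -(ζ : R))) (hr ζ)) (hr (ζ ^ 4)))
  have hV' := eulerDeriv_mul_of_eq hE (eulerDeriv_mul_of_eq
    (eulerDeriv_mul_of_eq (hC (1 + -(ζ : R) ^ 2)) (hr (ζ ^ 2))) (hr (ζ ^ 3)))
  rw [← hU] at hU'
  rw [← hV] at hV'
  have hL : (lambertSeries (ζ : R) 1 1 + lambertSeries (ζ ^ 4 : R) 1 1 -
      lambertSeries (ζ ^ 2 : R) 1 1 - lambertSeries (ζ ^ 3 : R) 1 1 : R⟦X⟧) =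
      - (C (ζ + ζ ^ 4 - ζ ^ 2 - ζ ^ 3 : R) * PowerSeries.mk fun n => (sigmaA n : R)) := by
    ext N
    rw [map_neg, coeff_C_mul]
    simp only [map_add, map_sub, lambertSeries, coeff_mk, sigmaA,
      Nat.mod_one, if_true, Int.cast_sum, mul_sum, ← sum_neg_distrib, ← sum_add_distrib,
      ← sum_sub_distrib]
    refine sum_congr rfl fun d _ => ?_
    have := root_sub_eq_chi5 hζ (N / d)
    push_cast
    linear_combination -(d : R) * this
  simp only [neg_mul, one_mul] at hW
  rw [hU', hV'] at hW
  have hP := eulerProd_mul_roots hζ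
  have hG : (C (ζ + ζ ^ 4 - ζ ^ 2 - ζ ^ 3 : R) * C (1 + -(ζ : R)) * C (1 + -(ζ : R) ^ 2) : R⟦X⟧) =
      5 * C (ζ : R) ^ 4 := by
    have h : (ζ + ζ ^ 4 - ζ ^ 2 - ζ ^ 3 : R) * (1 + -(ζ : R)) * (1 + -(ζ : R) ^ 2) =
        5 * (ζ : R) ^ 4 := by
      linear_combination ((ζ : R) ^ 3 - 3 * ζ ^ 2 + ζ) * hζ
    rw [← map_mul, ← map_mul, h, map_mul, map_pow, map_ofNat]
  have hne : (5 * C (ζ : R) ^ 4 * eulerProd R 5 : R⟦X⟧) ≠ 0 := by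
    refine mul_ne_zero (mul_ne_zero ?_ (pow_ne_zero _ ?_)) (eulerProd_ne_zero (by norm_num))
    · rw [← map_ofNat (C : R →+* R⟦X⟧), Ne, map_eq_zero_iff _ PowerSeries.C_injective]
      norm_num
    · rw [Ne, map_eq_zero_iff _ PowerSeries.C_injective]
      exact ζ.ne_zero
  refine mul_left_cancel₀ hne ?_
  have hUV : thetaSum (-ζ) 1 0 * thetaSum (-ζ ^ 2) 1 0 =
      C (1 + -(ζ : R)) * C (1 + -(ζ : R) ^ 2) * (eulerProd R 1 * eulerProd R 5) := by
    rw [hU, hV, ← hP]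
    ring
  set A : R⟦X⟧ := PowerSeries.mk fun n => (sigmaA n : R)
  linear_combination -hW + thetaSum (-ζ) 1 0 * thetaSum (-ζ ^ 2) 1 0 * hL -
    C (ζ + ζ ^ 4 - ζ ^ 2 - ζ ^ 3 : R) * A * hUV - eulerProd R 1 * eulerProd R 5 * A * hG

end CyclotomicTheta

/-- Ramanujan's identity `q ∏ (1 - q ^ (5 m)) ^ 5 / (1 - q ^ m) = ∑ χ(n) q ^ n / (1 - q ^ n) ^ 2`. -/
theorem eulerProd_one_mul_lambert :
    eulerProd ℤ 1 * PowerSeries.mk sigmaA = PowerSeries.X * eulerProd ℤ 5 ^ 5 := by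
  have hprim := Complex.isPrimitiveRoot_exp 5 (by norm_num)
  set ξ := Complex.exp (2 * Real.pi * Complex.I / (5 : ℕ))
  have hξ : ξ ^ 4 + ξ ^ 3 + ξ ^ 2 + ξ + 1 = 0 := by
    have := hprim.geom_sum_eq_zero (by norm_num)
    simp only [Finset.sum_range_succ, Finset.range_zero, Finset.sum_empty] at this
    linear_combination this
  -- A primitive fifth root of unity in ℂ suffices: both sides have integer coefficients, and ℤ⟦X⟧
  -- embeds in ℂ⟦X⟧.
  have h := eulerProd_mul_lambert_of_root (ζ := Units.mk0 ξ (hprim.ne_zero (by norm_num))) hξ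
  refine PowerSeries.map_injective (Int.castRingHom ℂ) Int.cast_injective ?_
  rw [map_mul, map_mul, map_pow, map_eulerProd, map_eulerProd, PowerSeries.map_X, ← h]
  congr 1

/-! ### The level `10` relations -/

/-- Field algebra only: ψ₅, φ₅ stand for ψ, φ at q⁵, A₂, B₂ for A, B at q², and w, v for the theta
products of the two quadratic identities. -/
theorem level_ten_relations {K : Type*} [Field K] {q f₁ f₂ f₅ f₁₀ ψ ψ₅ w φ φ₅ v A A₂ B B₂ P F : K}
    (hq : q ≠ 0) (h₁ : f₁ ≠ 0) (h₂ : f₂ ≠ 0) (h₅ : f₅ ≠ 0) (h₁₀ : f₁₀ ≠ 0)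
    (hψ : ψ * f₁ = f₂ ^ 2) (hψ₅ : ψ₅ * f₅ = f₁₀ ^ 2) (hw : w * (f₁ * f₁₀) = f₂ * f₅ ^ 3)
    (hψw : ψ ^ 2 - q * ψ₅ ^ 2 = w) (hφ : φ * f₂ = f₁ ^ 2) (hφ₅ : φ₅ * f₁₀ = f₅ ^ 2)
    (hv : v * (f₂ * f₅) = f₁ * f₁₀ ^ 3) (hφv : φ ^ 2 - φ₅ ^ 2 = -4 * q * v)
    (hA : f₁ * A = q * f₅ ^ 5) (hA₂ : f₂ * A₂ = q ^ 2 * f₁₀ ^ 5) (hB : f₅ * B = f₁ ^ 5)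
    (hB₂ : f₁₀ * B₂ = f₂ ^ 5) (hP : P * ψ = q ^ 3 * ψ₅ ^ 5) (hF : F * φ = φ₅ ^ 5) :
    20 * P = B - B₂ + 5 * A - 15 * A₂ ∧ 5 * F = B + 4 * B₂ + 15 * A + 20 * A₂ := by
  rw [← eq_div_iff h₁] at hψ
  rw [← eq_div_iff h₅] at hψ₅
  rw [← eq_div_iff (mul_ne_zero h₁ h₁₀)] at hw
  rw [← eq_div_iff h₂] at hφ
  rw [← eq_div_iff h₁₀] at hφ₅
  rw [← eq_div_iff (mul_ne_zero h₂ h₅)] at hv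
  rw [mul_comm, ← eq_div_iff h₁] at hA
  rw [mul_comm, ← eq_div_iff h₂] at hA₂
  rw [mul_comm, ← eq_div_iff h₅] at hB
  rw [mul_comm, ← eq_div_iff h₁₀] at hB₂
  have hψ0 : ψ ≠ 0 := by rw [hψ]; positivity
  have hφ0 : φ ≠ 0 := by rw [hφ]; positivity
  rw [← eq_div_iff hψ0, hψ, hψ₅] at hP
  rw [← eq_div_iff hφ0, hφ, hφ₅] at hF
  rw [hψ, hψ₅, hw] at hψw
  rw [hφ, hφ₅, hv] at hφv
  -- The quadratic identities, divided by suitable eta quotients, evaluate 1 + t and 1 - 4t. Every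
  -- quantity is then A times a rational function of t, and both claims become polynomial identities
  -- in t.
  set t := q * f₁₀ ^ 5 * f₁ / (f₂ * f₅ ^ 5) with ht
  have ht0 : t ≠ 0 := by rw [ht]; positivity
  have e1 : 1 + t = f₂ ^ 3 * f₁₀ / (f₁ * f₅ ^ 3) := by
    rw [ht]
    field_simp at hψw ⊢
    linear_combination -hψw
  have e2 : 1 - 4 * t = f₁ ^ 4 * f₁₀ ^ 2 / (f₂ ^ 2 * f₅ ^ 4) := by
    rw [ht]
    field_simp at hφv ⊢
    linear_combination -hφv
  have hPt : P = A * t ^ 2 := by rw [hP, hA, ht]; field_simp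
  have hAt : A₂ = A * t := by rw [hA₂, hA, ht]; field_simp
  have hFt : F = A / t := by rw [hF, hA, ht]; field_simp
  have hBt : B = A * ((1 - 4 * t) ^ 2 * (1 + t) / t) := by
    rw [e1, e2, hB, hA, ht]; field_simp
  have hB₂t : B₂ = A * ((1 - 4 * t) * (1 + t) ^ 2 / t) := by
    rw [e1, e2, hB₂, hA, ht]; field_simp
  rw [hPt, hAt, hFt, hBt, hB₂t]
  constructor <;> field_simp <;> ring

section Relations

open PowerSeries

theorem expand_eulerProd_int {k l : ℕ} (hk : 0 < k) (hl : l ≠ 0) :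
    expand l hl (eulerProd ℤ k) = eulerProd ℤ (l * k) := expand_eulerProd hk hl

/-- The expansions of `q ^ 3 ψ(q ^ 5) ^ 5 / ψ(q)` and `φ(-q ^ 5) ^ 5 / φ(-q)` as combinations of
Eisenstein series. -/
theorem eisenstein_expansions {P F : ℤ⟦X⟧}
    (hP : P * psiPos = X ^ 3 * expand 5 (by norm_num) psiPos ^ 5)
    (hF : F * phiMinus = expand 5 (by norm_num) phiMinus ^ 5) :
    4 * P = PowerSeries.mk sigmaA - PowerSeries.mk sigmaB -
        3 * expand 2 (by norm_num) (PowerSeries.mk sigmaA) +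
        expand 2 (by norm_num) (PowerSeries.mk sigmaB) ∧
      F = 1 + 3 * PowerSeries.mk sigmaA - PowerSeries.mk sigmaB +
        4 * expand 2 (by norm_num) (PowerSeries.mk sigmaA) -
        4 * expand 2 (by norm_num) (PowerSeries.mk sigmaB) := by
  -- The relations divide by series such as X that are not units, so they are applied in the
  -- fraction field and pulled back.
  let K := FractionRing ℤ⟦X⟧
  let i : ℤ⟦X⟧ →+* K := algebraMap ℤ⟦X⟧ K
  have hi : Function.Injective i := IsFractionRing.injective ℤ⟦X⟧ K
  have hi0 : ∀ {f : ℤ⟦X⟧}, f ≠ 0 → i f ≠ 0 := fun h => by rwa [Ne, map_eq_zero_iff _ hi]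
  have h5ψ := congrArg (expand (R := ℤ) 5 (by norm_num)) psiPos_mul
  have h5φ := congrArg (expand (R := ℤ) 5 (by norm_num)) phiMinus_mul
  have h2A := congrArg (expand (R := ℤ) 2 (by norm_num)) eulerProd_one_mul_lambert
  have h2B := congrArg (expand (R := ℤ) 2 (by norm_num)) eulerProd_five_mul_lambert
  simp only [map_mul, map_pow, expand_X, map_sub, map_one, map_ofNat] at h5ψ h5φ h2A h2B
  rw [expand_eulerProd_int one_pos, expand_eulerProd_int two_pos] at h5ψ h5φ
  rw [expand_eulerProd_int one_pos, expand_eulerProd_int (by norm_num)] at h2A h2B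
  simp only [Nat.reduceMul] at h5ψ h5φ h2A h2B
  have map := fun {f g : ℤ⟦X⟧} (h : f = g) => congrArg i h
  have key := level_ten_relations (K := K) (q := i X) (f₁ := i (eulerProd ℤ 1))
    (f₂ := i (eulerProd ℤ 2)) (f₅ := i (eulerProd ℤ 5)) (f₁₀ := i (eulerProd ℤ 10))
    (ψ := i psiPos) (ψ₅ := i (expand 5 (by norm_num) psiPos))
    (w := i (thetaSum 1 5 1 * thetaSum 1 5 2)) (φ := i phiMinus)
    (φ₅ := i (expand 5 (by norm_num) phiMinus)) (v := i (thetaSum (-1) 10 1 * thetaSum (-1) 10 3))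
    (A := i (PowerSeries.mk sigmaA)) (A₂ := i (expand 2 (by norm_num) (PowerSeries.mk sigmaA)))
    (B := i (1 - 5 * PowerSeries.mk sigmaB))
    (B₂ := i (1 - 5 * expand 2 (by norm_num) (PowerSeries.mk sigmaB))) (P := i P) (F := i F)
    (hi0 X_ne_zero) (hi0 (eulerProd_ne_zero (by norm_num))) (hi0 (eulerProd_ne_zero (by norm_num)))
    (hi0 (eulerProd_ne_zero (by norm_num))) (hi0 (eulerProd_ne_zero (by norm_num)))
    (by simpa only [map_mul, map_pow] using map psiPos_mul)
    (by simpa only [map_mul, map_pow] using map h5ψ)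
    (by simpa only [map_mul, map_pow] using map thetaSum_one_five_mul)
    (by simpa only [map_mul, map_pow, map_sub] using map psiPos_sq_sub)
    (by simpa only [map_mul, map_pow] using map phiMinus_mul)
    (by simpa only [map_mul, map_pow] using map h5φ)
    (by simpa only [map_mul, map_pow] using map thetaSum_neg_one_ten_mul)
    (by simpa only [map_mul, map_pow, map_sub, map_neg, map_ofNat] using map phiMinus_sq_sub)
    (by simpa only [map_mul, map_pow] using map eulerProd_one_mul_lambert)
    (by simpa only [map_mul, map_pow] using map h2A)
    (by simpa only [map_mul, map_pow] using map eulerProd_five_mul_lambert)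
    (by simpa only [map_mul, map_pow] using map h2B)
    (by simpa only [map_mul, map_pow] using map hP)
    (by simpa only [map_mul, map_pow] using map hF)
  have h5 : (5 : ℤ⟦X⟧) ≠ 0 := by
    rw [← map_ofNat (C : ℤ →+* ℤ⟦X⟧), Ne, map_eq_zero_iff _ PowerSeries.C_injective]
    norm_num
  constructor
  · refine mul_left_cancel₀ h5 (hi ?_)
    have := key.1
    simp only [map_mul, map_sub, map_add, map_one, map_ofNat] at this ⊢
    linear_combination this
  · refine mul_left_cancel₀ h5 (hi ?_)
    have := key.2
    simp only [map_mul, map_sub, map_add, map_one, map_ofNat] at this ⊢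
    linear_combination this

end Relations

/-! ### The coefficients of `ā₅` and `b̄₅` -/

section Coefficients

open PowerSeries Finset

/-- The bridge from the topological sum defining theta functions to formal sums: in each degree both
are the same finite sum. -/
theorem ramanujanTheta_eq_latSum {a b : ℤ⟦X⟧} (ha : constantCoeff a = 0)
    (hb : constantCoeff b = 0) {c : ℤ → ℤ} {e : ℤ → ℕ} (he : FiniteFibers e)
    (h : ∀ n : ℤ, a ^ (n * (n + 1) / 2).toNat * b ^ (n * (n - 1) / 2).toNat = C (c n) * X ^ e n) :
    ramanujanTheta a b = latSum c e := by
  ext N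
  have h1 := (PowerSeries.WithPiTopology.hasSum_iff_hasSum_coeff ℤ).1
    (summable_ramanujanTheta ha hb).hasSum N
  obtain ⟨s, hs⟩ := he.exists_finset (N + 1)
  rw [coeff_latSum_eq_sum c fun i hi => hs i (by omega)]
  refine h1.unique ?_
  have h2 : (fun n : ℤ => coeff N (a ^ (n * (n + 1) / 2).toNat * b ^ (n * (n - 1) / 2).toNat)) =
      fun n => if e n = N then c n else 0 := by
    ext1 n
    rw [h, coeff_C_mul, coeff_X_pow]
    by_cases hn : e n = N
    · simp [hn]
    · simp [hn, Ne.symm hn]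
  rw [h2]
  exact hasSum_sum_of_ne_finset_zero fun n hn => if_neg fun hN => hn (hs n (by omega))

theorem toNat_triangular (n : ℤ) : 2 * ((n * (n + 1) / 2).toNat : ℤ) = n * (n + 1) ∧
    2 * ((n * (n - 1) / 2).toNat : ℤ) = n * (n - 1) := by
  have h1 := (Int.even_mul_succ_self n).two_dvd
  have h2 := (Int.even_mul_pred_self n).two_dvd
  have h3 : 0 ≤ n * (n + 1) := by
    rcases le_or_gt 0 n with h | h
    · positivity
    · nlinarith
  have h4 : 0 ≤ n * (n - 1) := by
    rcases le_or_gt n 0 with h | h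
    · nlinarith
    · exact mul_nonneg h.le (by omega)
  omega

theorem phiNeg_eq {k : ℕ} (hk : k ≠ 0) : phiNeg k = expand k hk phiMinus := by
  have hf := finiteFibers_thetaExp (s := 2) (r := 1) (by norm_num) (by norm_num)
  rw [phiMinus, thetaSum, expand_latSum _ hf, phiNeg]
  have h0 : constantCoeff (-X ^ k : ℤ⟦X⟧) = 0 := by simp [hk]
  refine ramanujanTheta_eq_latSum h0 h0 (hf.mono fun n => Nat.le_mul_of_pos_left _
    (Nat.pos_of_ne_zero hk)) fun n => ?_
  have he : thetaExp 2 1 n = n.natAbs ^ 2 := by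
    have := two_mul_thetaExp (s := 2) (r := 1) (by norm_num) n
    zify
    rw [sq_abs]
    push_cast at this
    linarith
  rw [← pow_add, exists_exponents, he, neg_pow, ← pow_mul, neg_one_zpow_val]
  congr 1
  rw [← map_one (C : ℤ →+* ℤ⟦X⟧), ← map_neg, ← map_pow]
  congr 1
  split_ifs with h
  · exact Even.neg_one_pow (by rw [Nat.even_pow]; exact ⟨Nat.even_iff.2 (by omega), by norm_num⟩)
  · exact Odd.neg_one_pow (Odd.pow (Nat.odd_iff.2 (by omega)))

theorem rescale_latSum (c : ℤ → ℤ) {e : ℤ → ℕ} (he : FiniteFibers e) (a : ℤ) :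
    rescale a (latSum c e) = latSum (fun n => a ^ e n * c n) e := by
  ext N
  obtain ⟨s, hs⟩ := he.exists_finset (N + 1)
  rw [coeff_rescale, coeff_latSum_eq_sum c fun i hi => hs i (by omega),
    coeff_latSum_eq_sum _ fun i hi => hs i (by omega), mul_sum]
  refine sum_congr rfl fun i _ => ?_
  split_ifs with h <;> simp [h]

/-- For odd k the sign of each term is -1 to the power of its exponent, so q ↦ -q removes all the
signs. -/
theorem rescale_psiNeg {k : ℕ} (hk : Odd k) :
    rescale (-1) (psiNeg k) = expand k hk.pos.ne' psiPos := by
  have hf := finiteFibers_thetaExp (s := 4) (r := 1) (by norm_num) (by norm_num)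
  have hf' : FiniteFibers fun n => k * thetaExp 4 1 n :=
    hf.mono fun n => Nat.le_mul_of_pos_left _ hk.pos
  have h1 : constantCoeff (-X ^ k : ℤ⟦X⟧) = 0 := by simp [hk.pos.ne']
  have h3 : constantCoeff (-X ^ (3 * k) : ℤ⟦X⟧) = 0 := by simp [hk.pos.ne']
  have he : ∀ n, thetaExp 4 1 n = (n * (n + 1) / 2).toNat + 3 * (n * (n - 1) / 2).toNat := by
    intro n
    have h4 := two_mul_thetaExp (s := 4) (r := 1) (by norm_num) n
    have h5 := toNat_triangular n
    zify
    push_cast at h4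
    linarith [h5.1, h5.2]
  rw [psiPos, thetaSum, expand_latSum _ hf, psiNeg,
    ramanujanTheta_eq_latSum h1 h3 (c := fun n => (-1) ^ (k * thetaExp 4 1 n)) hf',
    rescale_latSum _ hf']
  · congr 1
    ext1 n
    rw [← mul_pow]
    simp
  · intro n
    rw [neg_pow, neg_pow (X ^ (3 * k) : ℤ⟦X⟧), mul_mul_mul_comm, ← pow_add, ← pow_mul, ← pow_mul,
      ← pow_add]
    congr 1
    · rw [pow_mul, hk.neg_one_pow, he, map_pow, map_neg, map_one, pow_add, pow_add, pow_mul]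
      norm_num
    · rw [he]
      ring

theorem X_pow_three_mul_rescale_b5Series_mul :
    X ^ 3 * rescale (-1) b5Series * psiPos = X ^ 3 * expand 5 (by norm_num) psiPos ^ 5 := by
  have hψ := rescale_psiNeg (k := 1) (by decide)
  have hψ5 := rescale_psiNeg (k := 5) (by decide)
  rw [expand_one_apply] at hψ
  rw [← hψ5, ← hψ, mul_assoc, ← map_mul, b5Series_mul, map_pow]

theorem a5Series_mul_phiMinus : a5Series * phiMinus = expand 5 (by norm_num) phiMinus ^ 5 := by
  have h1 := phiNeg_eq one_ne_zero
  rw [expand_one_apply] at h1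
  rw [← phiNeg_eq, ← h1, a5Series_mul]

/-- The sign comes from q ↦ -q and the shift by 3 from the factor q³ that makes the series an
Eisenstein combination. -/
theorem coeff_b5Series (m : ℕ) :
    4 * ((-1) ^ m * coeff m b5Series) = sigmaA (m + 3) - sigmaB (m + 3) +
      if 2 ∣ m + 3 then -3 * sigmaA ((m + 3) / 2) + sigmaB ((m + 3) / 2) else 0 := by
  have h := congrArg (coeff (m + 3)) (eisenstein_expansions X_pow_three_mul_rescale_b5Series_mul a5Series_mul_phiMinus).1
  rw [← map_ofNat (C : ℤ →+* ℤ⟦X⟧), coeff_C_mul, map_add, map_sub, map_sub,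
    ← map_ofNat (C : ℤ →+* ℤ⟦X⟧) 3, coeff_C_mul, coeff_expand, coeff_expand, coeff_X_pow_mul,
    coeff_rescale] at h
  simp only [coeff_mk] at h
  rw [h]
  split_ifs <;> ring

theorem coeff_a5Series {m : ℕ} (hm : m ≠ 0) :
    coeff m a5Series = 3 * sigmaA m - sigmaB m +
      if 2 ∣ m then 4 * sigmaA (m / 2) - 4 * sigmaB (m / 2) else 0 := by
  have h := congrArg (coeff m) (eisenstein_expansions X_pow_three_mul_rescale_b5Series_mul a5Series_mul_phiMinus).2
  simp only [map_add, map_sub] at h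
  rw [coeff_one, if_neg hm, ← map_ofNat (C : ℤ →+* ℤ⟦X⟧), coeff_C_mul,
    ← map_ofNat (C : ℤ →+* ℤ⟦X⟧) 4, coeff_C_mul, coeff_C_mul, coeff_expand, coeff_expand] at h
  simp only [coeff_mk] at h
  rw [h]
  split_ifs <;> ring

end Coefficients

/-! ### Divisor sums twisted by the quadratic character modulo `5` -/

section DivisorSums

open Finset

theorem chi5_mul (m n : ℕ) : chi5 (m * n) = chi5 m * chi5 n := by
  have hm : m % 5 = 0 ∨ m % 5 = 1 ∨ m % 5 = 2 ∨ m % 5 = 3 ∨ m % 5 = 4 := by omega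
  have hn : n % 5 = 0 ∨ n % 5 = 1 ∨ n % 5 = 2 ∨ n % 5 = 3 ∨ n % 5 = 4 := by omega
  simp only [chi5, Nat.mul_mod m n 5]
  rcases hm with h | h | h | h | h <;> rcases hn with h' | h' | h' | h' | h' <;>
    rw [h, h'] <;> norm_num

/-- The Hecke relation for a convolution of two completely multiplicative functions. -/
theorem sum_divisors_prime_mul {g k : ℕ → ℤ} (hg : ∀ m n, g (m * n) = g m * g n)
    (hk : ∀ m n, k (m * n) = k m * k n) {p : ℕ} (hp : p.Prime) {n : ℕ} (hn : n ≠ 0) :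
    ∑ d ∈ (p * n).divisors, g d * k (p * n / d) =
      (g p + k p) * ∑ d ∈ n.divisors, g d * k (n / d) -
        g p * k p * if p ∣ n then ∑ d ∈ (n / p).divisors, g d * k (n / p / d) else 0 := by
  have hp0 := hp.pos
  let f : ℕ → ℤ := fun d => g d * k (p * n / d)
  have hinj : Set.InjOn (fun d => p * d) (n.divisors : Set ℕ) :=
    fun a _ b _ h => Nat.eq_of_mul_eq_mul_left hp0 h
  -- A divisor of pn divides n or is p times a divisor of n; both hold exactly for p times the
  -- divisors of n/p, and this overlap is the subtracted Hecke term.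
  have hunion : (p * n).divisors = n.divisors ∪ n.divisors.image fun d => p * d := by
    ext d
    simp only [mem_union, mem_image, Nat.mem_divisors]
    constructor
    · rintro ⟨hd, -⟩
      by_cases hpd : p ∣ d
      · obtain ⟨e, rfl⟩ := hpd
        exact Or.inr ⟨e, ⟨Nat.dvd_of_mul_dvd_mul_left hp0 hd, hn⟩, rfl⟩
      · exact Or.inl ⟨(((hp.coprime_iff_not_dvd).2 hpd).symm).dvd_of_dvd_mul_left hd, hn⟩
    · rintro (⟨hd, -⟩ | ⟨e, ⟨he, -⟩, rfl⟩)
      · exact ⟨hd.mul_left p, mul_ne_zero hp0.ne' hn⟩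
      · exact ⟨mul_dvd_mul_left p he, mul_ne_zero hp0.ne' hn⟩
  have h1 : ∑ d ∈ n.divisors, f d = k p * ∑ d ∈ n.divisors, g d * k (n / d) := by
    rw [mul_sum]
    refine sum_congr rfl fun d hd => ?_
    simp only [f]
    rw [Nat.mul_div_assoc _ (Nat.dvd_of_mem_divisors hd), hk]
    ring
  have h2 : ∑ d ∈ n.divisors.image (fun d => p * d), f d =
      g p * ∑ d ∈ n.divisors, g d * k (n / d) := by
    rw [sum_image hinj, mul_sum]
    refine sum_congr rfl fun d _ => ?_
    simp only [f]
    rw [Nat.mul_div_mul_left _ _ hp0, hg]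
    ring
  have h3 : ∑ d ∈ n.divisors ∩ n.divisors.image (fun d => p * d), f d =
      g p * k p * if p ∣ n then ∑ d ∈ (n / p).divisors, g d * k (n / p / d) else 0 := by
    split_ifs with hpn
    · obtain ⟨m, rfl⟩ := hpn
      rw [Nat.mul_div_cancel_left _ hp0]
      have : (p * m).divisors ∩ (p * m).divisors.image (fun d => p * d) =
          m.divisors.image fun d => p * d := by
        ext d
        simp only [mem_inter, mem_image, Nat.mem_divisors]
        constructor
        · rintro ⟨⟨h1, h0⟩, e, -, rfl⟩
          exact ⟨e, ⟨Nat.dvd_of_mul_dvd_mul_left hp0 h1, right_ne_zero_of_mul h0⟩, rfl⟩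
        · rintro ⟨e, ⟨he, h0⟩, rfl⟩
          exact ⟨⟨mul_dvd_mul_left p he, hn⟩, e, ⟨he.mul_left p, hn⟩, rfl⟩
      rw [this, sum_image fun a _ b _ h => Nat.eq_of_mul_eq_mul_left hp0 h, mul_sum]
      refine sum_congr rfl fun d hd => ?_
      simp only [f]
      rw [Nat.mul_div_mul_left _ _ hp0, hg, Nat.mul_div_assoc _ (Nat.dvd_of_mem_divisors hd), hk]
      ring
    · rw [mul_zero]
      refine sum_eq_zero fun d hd => ?_
      simp only [mem_inter, mem_image, Nat.mem_divisors] at hd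
      obtain ⟨⟨h1, -⟩, e, -, rfl⟩ := hd
      exact absurd (dvd_of_mul_right_dvd h1) hpn
  have h4 := sum_union_inter (s₁ := n.divisors) (s₂ := n.divisors.image fun d => p * d) (f := f)
  rw [← hunion, h1, h2, h3] at h4
  linear_combination h4

theorem sigmaA_two_mul {n : ℕ} (hn : n ≠ 0) :
    sigmaA (2 * n) = sigmaA n + 2 * if 2 ∣ n then sigmaA (n / 2) else 0 := by
  have h := sum_divisors_prime_mul (g := fun d => (d : ℤ)) (k := chi5) (by simp) chi5_mul
    Nat.prime_two hn
  have h2 : chi5 2 = -1 := by norm_num [chi5]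
  simp only [h2] at h
  simp only [sigmaA]
  rw [h]
  push_cast
  ring

theorem sigmaA_five_mul {n : ℕ} (hn : n ≠ 0) : sigmaA (5 * n) = 5 * sigmaA n := by
  have h := sum_divisors_prime_mul (g := fun d => (d : ℤ)) (k := chi5) (by simp) chi5_mul
    Nat.prime_five hn
  have h2 : chi5 5 = 0 := by norm_num [chi5]
  simp only [h2] at h
  simp only [sigmaA]
  rw [h]
  push_cast
  ring

theorem sigmaB_two_mul {n : ℕ} (hn : n ≠ 0) :
    sigmaB (2 * n) = - sigmaB n + 2 * if 2 ∣ n then sigmaB (n / 2) else 0 := by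
  have h := sum_divisors_prime_mul (g := fun d => (d : ℤ) * chi5 d) (k := fun _ => 1)
    (fun m n => by rw [chi5_mul]; push_cast; ring) (by simp) Nat.prime_two hn
  have h2 : chi5 2 = -1 := by norm_num [chi5]
  simp only [mul_one, h2] at h
  simp only [sigmaB]
  rw [h]
  push_cast
  ring

theorem sigmaB_five_mul {n : ℕ} (hn : n ≠ 0) : sigmaB (5 * n) = sigmaB n := by
  have h := sum_divisors_prime_mul (g := fun d => (d : ℤ) * chi5 d) (k := fun _ => 1)
    (fun m n => by rw [chi5_mul]; push_cast; ring) (by simp) Nat.prime_five hn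
  have h2 : chi5 5 = 0 := by norm_num [chi5]
  simp only [mul_one, h2] at h
  simp only [sigmaB]
  rw [h]
  push_cast
  ring

theorem chi5_sq {n : ℕ} (h : ¬ 5 ∣ n) : chi5 n * chi5 n = 1 := by
  simp only [chi5]
  split_ifs <;> omega

/-- For 5 ∤ n one has χ(d) = χ(n)χ(n/d), since χ² = 1 off multiples of 5. -/
theorem sigmaB_eq {n : ℕ} (h : ¬ 5 ∣ n) : sigmaB n = chi5 n * sigmaA n := by
  rw [sigmaB, sigmaA, mul_sum]
  refine sum_congr rfl fun d hd => ?_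
  obtain ⟨e, rfl⟩ := Nat.dvd_of_mem_divisors hd
  have hd0 : 0 < d := Nat.pos_of_mem_divisors hd
  rw [Nat.mul_div_cancel_left _ hd0, chi5_mul]
  linear_combination (-(d : ℤ) * chi5 d) * chi5_sq (n := e) fun h' => h (h'.mul_left d)

theorem sigmaB_eq_sigmaA {n : ℕ} (h : n % 5 = 1 ∨ n % 5 = 4) : sigmaB n = sigmaA n := by
  rw [sigmaB_eq (by omega), chi5, if_pos h, one_mul]

theorem sigmaB_eq_neg_sigmaA {n : ℕ} (h : n % 5 = 2 ∨ n % 5 = 3) : sigmaB n = - sigmaA n := by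
  rw [sigmaB_eq (by omega), chi5, if_neg (by omega), if_pos h, neg_one_mul]

/-- `∑ (χ(n / d) - χ(d)) d` over the divisors `d` of `n`. -/
def sigmaDiff (n : ℕ) : ℤ := sigmaA n - sigmaB n

/-- `sigmaDiff (n / 2)` for even `n`, and `0` for odd `n`. -/
def sigmaDiffHalf (n : ℕ) : ℤ := if 2 ∣ n then sigmaDiff (n / 2) else 0

theorem sigmaDiff_two_mul {n : ℕ} (hn : n ≠ 0) :
    sigmaDiff (2 * n) = 2 * sigmaA n - sigmaDiff n + 2 * sigmaDiffHalf n := by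
  simp only [sigmaDiffHalf, sigmaDiff, sigmaA_two_mul hn, sigmaB_two_mul hn]
  split_ifs <;> ring

theorem sigmaDiff_five_mul {n : ℕ} (hn : n ≠ 0) :
    sigmaDiff (5 * n) = 5 * sigmaA n - sigmaB n := by
  rw [sigmaDiff, sigmaA_five_mul hn, sigmaB_five_mul hn]

theorem sigmaDiff_eq_zero {n : ℕ} (h : n % 5 = 1 ∨ n % 5 = 4) : sigmaDiff n = 0 := by
  rw [sigmaDiff, sigmaB_eq_sigmaA h, sub_self]

theorem sigmaDiff_eq_two_mul {n : ℕ} (h : n % 5 = 2 ∨ n % 5 = 3) :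
    sigmaDiff n = 2 * sigmaA n := by
  rw [sigmaDiff, sigmaB_eq_neg_sigmaA h]
  ring

/-- If n is even and n ≡ ±2 mod 5, then n/2 ≡ ±1 mod 5, where `sigmaDiff` vanishes. -/
theorem sigmaDiffHalf_eq_zero {n : ℕ} (h : n % 2 = 1 ∨ n % 5 = 2 ∨ n % 5 = 3) :
    sigmaDiffHalf n = 0 := by
  rw [sigmaDiffHalf]
  split_ifs with h2
  · exact sigmaDiff_eq_zero (by omega)
  · rfl

theorem b5_natCast (m : ℕ) : b5 m = PowerSeries.coeff m b5Series := by
  rw [b5, if_pos (Int.natCast_nonneg m), Int.toNat_natCast]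

theorem four_mul_b5_even (k : ℕ) : 4 * b5 ((2 * k : ℕ) : ℤ) = sigmaDiff (2 * k + 3) := by
  have h := coeff_b5Series (2 * k)
  rw [← b5_natCast, if_neg (by omega), pow_mul, neg_one_sq, one_pow] at h
  rw [sigmaDiff]
  linarith

/-- Here m + 3 = 2(k + 2) is even, and the Hecke relation at 2 combines with the terms at (m + 3)/2
into -2 times the right side; the sign is (-1)^m. -/
theorem two_mul_b5_odd (k : ℕ) :
    2 * b5 ((2 * k + 1 : ℕ) : ℤ) = sigmaDiff (k + 2) - sigmaDiffHalf (k + 2) := by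
  have h := coeff_b5Series (2 * k + 1)
  have h2 : 2 * k + 1 + 3 = 2 * (k + 2) := by ring
  have h3 := sigmaDiff_two_mul (n := k + 2) (by omega)
  rw [← b5_natCast, h2, if_pos (Dvd.intro _ rfl), Nat.mul_div_cancel_left _ two_pos, pow_succ,
    pow_mul] at h
  simp only [sigmaDiff] at h3 ⊢
  rw [neg_one_sq, one_pow] at h
  linarith

theorem a5_odd (k : ℕ) :
    a5 ((2 * k + 1 : ℕ) : ℤ) = 3 * sigmaA (2 * k + 1) - sigmaB (2 * k + 1) := by
  rw [a5, if_pos (Int.natCast_nonneg _), Int.toNat_natCast, coeff_a5Series (by omega),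
    if_neg (by omega), add_zero]

end DivisorSums

/-! ### The lattice sum of the `5`-cores -/

section CoreLattice

open PowerSeries Finset

variable {R : Type*} [CommRing R]

theorem dvd_prod_sub_prod {ι : Type*} {A : Type*} [CommRing A] {d : A} {s : Finset ι} {f g : ι → A}
    (h : ∀ i ∈ s, d ∣ f i - g i) : d ∣ ∏ i ∈ s, f i - ∏ i ∈ s, g i := by
  classical
  induction s using Finset.induction_on with
  | empty => simp
  | insert i s hi ih =>
    rw [prod_insert hi, prod_insert hi]
    exact dvd_mul_sub_mul_of_dvd (h i (by simp)) (ih fun j hj => h j (by simp [hj]))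

theorem FiniteFibers.sum {k : ℕ} {ι : Type*} {e : Fin k → ι → ℕ} (he : ∀ r, FiniteFibers (e r)) :
    FiniteFibers fun v : Fin k → ι => ∑ r, e r (v r) := fun N =>
  (Set.Finite.pi' fun r => he r N).subset fun v hv r =>
    (single_le_sum (f := fun r => e r (v r)) (fun _ _ => Nat.zero_le _) (mem_univ r)).trans_lt hv

theorem prod_latSum {k : ℕ} {ι : Type*} (c : Fin k → ι → R) {e : Fin k → ι → ℕ}
    (he : ∀ r, FiniteFibers (e r)) :
    ∏ r, latSum (c r) (e r) =
      latSum (fun v : Fin k → ι => ∏ r, c r (v r)) fun v => ∑ r, e r (v r) := by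
  classical
  symm
  refine latSum_eq fun N => ?_
  choose t ht using fun r => (he r).exists_finset N
  refine ⟨Fintype.piFinset t, fun v hv => Fintype.mem_piFinset.2 fun r => ht r _ ?_, ?_⟩
  · exact (single_le_sum (f := fun r => e r (v r)) (fun _ _ => Nat.zero_le _)
      (mem_univ r)).trans_lt hv
  · have : ∑ v ∈ Fintype.piFinset t, C (∏ r, c r (v r)) * (X : R⟦X⟧) ^ ∑ r, e r (v r) =
        ∏ r, ∑ i ∈ t r, C (c r i) * X ^ e r i := by
      rw [prod_univ_sum]
      refine sum_congr rfl fun v _ => ?_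
      rw [map_prod, ← prod_pow_eq_pow_sum, prod_mul_distrib]
    rw [this]
    exact dvd_prod_sub_prod fun r _ => X_pow_dvd_latSum_sub (c r) (ht r)

/-- The five theta functions run through all residues mod 5, so together they contain exactly the
z-factors of the single theta function with s = 1; only the Euler products differ. -/
theorem eulerProd_one_mul_prod_thetaSum (z : Rˣ) :
    eulerProd R 1 * ∏ r : Fin 5, thetaSum z 5 r = eulerProd R 5 ^ 5 * thetaSum z 1 0 := by
  have h1 := resProd_block (z : R) one_pos 0 (l := 5) (by norm_num)
  have h2 := resProd_block ((z⁻¹ : Rˣ) : R) one_pos 1 (l := 5) (by norm_num)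
  have h3 : ∀ r ∈ (univ : Finset (Fin 5)), thetaSum z 5 r = eulerProd R 5 *
      (resProd (z : R) 5 r * resProd ((z⁻¹ : Rˣ) : R) 5 (5 - r)) := fun r _ =>
    thetaSum_eq z (by norm_num) (by omega)
  rw [prod_congr rfl h3, thetaSum_eq z one_pos (by norm_num), Nat.sub_zero, h1, h2,
    Fin.prod_univ_eq_prod_range (fun r => eulerProd R 5 *
      (resProd (z : R) 5 r * resProd ((z⁻¹ : Rˣ) : R) 5 (5 - r))) 5]
  simp only [prod_range_succ, range_zero, prod_empty]
  norm_num
  ring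

/-- The constant term of a Laurent polynomial. -/
def constTerm : LaurentPolynomial ℤ →+ ℤ where
  toFun p := p.coeff 0
  map_zero' := rfl
  map_add' _ _ := rfl

/-- The constant term in the Laurent variable, coefficient by coefficient. -/
noncomputable def constTermSeries (f : (LaurentPolynomial ℤ)⟦X⟧) : ℤ⟦X⟧ :=
  PowerSeries.mk fun n => constTerm (coeff n f)

theorem constTermSeries_map_mul (f : ℤ⟦X⟧) (g : (LaurentPolynomial ℤ)⟦X⟧) :
    constTermSeries (PowerSeries.map (Int.castRingHom _) f * g) = f * constTermSeries g := by
  ext n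
  rw [constTermSeries, coeff_mk, coeff_mul, coeff_mul, map_sum]
  refine sum_congr rfl fun p _ => ?_
  rw [coeff_map, eq_intCast, ← zsmul_eq_mul, map_zsmul, smul_eq_mul, constTermSeries, coeff_mk]

theorem constTermSeries_latSum {ι : Type*} (c : ι → LaurentPolynomial ℤ) {e : ι → ℕ}
    (he : FiniteFibers e) : constTermSeries (latSum c e) = latSum (fun i => constTerm (c i)) e := by
  ext N
  obtain ⟨s, hs⟩ := he.exists_finset (N + 1)
  rw [constTermSeries, coeff_mk, coeff_latSum_eq_sum c fun i hi => hs i (by omega),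
    coeff_latSum_eq_sum _ fun i hi => hs i (by omega), map_sum]
  refine sum_congr rfl fun i _ => ?_
  split_ifs <;> simp

/-- The variable of the Laurent polynomial ring, as a unit. -/
noncomputable def laurentVar : (LaurentPolynomial ℤ)ˣ where
  val := LaurentPolynomial.T 1
  inv := LaurentPolynomial.T (-1)
  val_inv := by rw [← LaurentPolynomial.T_add]; simp
  inv_val := by rw [← LaurentPolynomial.T_add]; simp

theorem laurentVar_zpow (n : ℤ) :
    ((laurentVar ^ n : (LaurentPolynomial ℤ)ˣ) : LaurentPolynomial ℤ) = LaurentPolynomial.T n := by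
  induction n using Int.induction_on with
  | zero => simp
  | succ n ih =>
    rw [zpow_add_one, Units.val_mul, ih, LaurentPolynomial.T_add]
    rfl
  | pred n ih =>
    rw [zpow_sub_one, Units.val_mul, ih, sub_eq_add_neg, LaurentPolynomial.T_add]
    rfl

theorem constTerm_T (n : ℤ) : constTerm (LaurentPolynomial.T n) = if n = 0 then 1 else 0 :=
  LaurentPolynomial.T_apply 0 n

/-- The exponent attached to a lattice vector. -/
def coreExp (v : Fin 5 → ℤ) : ℕ := ∑ r : Fin 5, thetaExp 5 r (v r)

theorem finiteFibers_coreExp : FiniteFibers coreExp :=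
  FiniteFibers.sum fun r => finiteFibers_thetaExp (by norm_num) (by omega)

/-- Constant terms in a Laurent variable z: on the left the vectors of sum 0 survive, on the right
only the term n = 0, equal to 1. -/
theorem eulerProd_one_mul_latSum_core :
    eulerProd ℤ 1 * latSum (fun v : Fin 5 → ℤ => if ∑ r, v r = 0 then 1 else 0) coreExp =
      eulerProd ℤ 5 ^ 5 := by
  have h := congrArg constTermSeries (eulerProd_one_mul_prod_thetaSum laurentVar)
  rw [← map_eulerProd (Int.castRingHom (LaurentPolynomial ℤ)) 1,
    ← map_eulerProd (Int.castRingHom (LaurentPolynomial ℤ)) 5, ← map_pow,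
    constTermSeries_map_mul, constTermSeries_map_mul] at h
  simp only [thetaSum] at h
  rw [prod_latSum _ fun r => finiteFibers_thetaExp (by norm_num) (by omega)] at h
  change _ * constTermSeries (latSum _ coreExp) = _ at h
  rw [constTermSeries_latSum _ finiteFibers_coreExp,
    constTermSeries_latSum _ (finiteFibers_thetaExp (by norm_num) (by norm_num))] at h
  have h1 : (fun v : Fin 5 → ℤ => constTerm
      (∏ r, ((laurentVar ^ v r : (LaurentPolynomial ℤ)ˣ) : LaurentPolynomial ℤ))) =
      fun v => if ∑ r, v r = 0 then 1 else 0 := by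
    ext1 v
    rw [← Units.coe_prod]
    have : ∏ r, laurentVar ^ v r = laurentVar ^ ∑ r, v r := by
      simp only [Fin.prod_univ_five, Fin.sum_univ_five, zpow_add]
    rw [this, laurentVar_zpow, constTerm_T]
  have h2 : latSum (fun n : ℤ => constTerm
      ((laurentVar ^ n : (LaurentPolynomial ℤ)ˣ) : LaurentPolynomial ℤ)) (thetaExp 1 0) = 1 := by
    have hfib := finiteFibers_thetaExp (s := 1) (r := 0) (by norm_num) (by norm_num)
    ext N
    obtain ⟨s, hs⟩ := hfib.exists_finset (N + 1)
    rw [coeff_latSum_eq_sum (s := insert 0 s) _ fun i hi =>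
      mem_insert_of_mem (hs i (by omega)), sum_eq_single_of_mem 0 (mem_insert_self _ _)]
    · rw [laurentVar_zpow, constTerm_T, coeff_one]
      have : thetaExp 1 0 0 = 0 := by simp [thetaExp]
      rw [this]
      by_cases hN : N = 0
      · simp [hN]
      · simp [hN, Ne.symm hN]
    · intro n _ hn
      rw [laurentVar_zpow, constTerm_T, if_neg hn, ite_self]
  rw [h1, h2, mul_one] at h
  exact h

theorem coeff_latSum_core (N : ℕ) :
    coeff N (latSum (fun v : Fin 5 → ℤ => if ∑ r, v r = 0 then (1 : ℤ) else 0) coreExp) =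
      ({v : Fin 5 → ℤ | ∑ r, v r = 0 ∧ coreExp v = N}.ncard : ℤ) := by
  classical
  obtain ⟨s, hs⟩ := finiteFibers_coreExp.exists_finset (N + 1)
  have h : {v : Fin 5 → ℤ | ∑ r, v r = 0 ∧ coreExp v = N} =
      (s.filter fun v => ∑ r, v r = 0 ∧ coreExp v = N : Finset (Fin 5 → ℤ)) := by
    ext v
    simp only [Set.mem_ofPred_eq, coe_filter]
    exact ⟨fun h => ⟨hs v (by omega), h⟩, fun h => h.2⟩
  rw [h, Set.ncard_coe_finset, coeff_latSum_eq_sum _ fun i hi => hs i (by omega)]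
  simp only [← ite_and]
  rw [sum_boole]
  simp only [and_comm]

end CoreLattice

/-! ### Cores and beta-sets -/

section BetaSets

open Finset

/-- The `i`-th first-column hook length of `μ`, regarded as a partition into `k` parts. -/
def betaNumber (k : ℕ) (μ : YoungDiagram) (i : ℕ) : ℕ := μ.rowLen i + (k - 1 - i)

/-- The beta-set of `μ`, regarded as a partition into `k` parts. -/
def betaSet (k : ℕ) (μ : YoungDiagram) : Finset ℕ := (range k).image (betaNumber k μ)

/-- The finsets closed under subtraction of `t` (abaci with flush runners). -/
def IsFlush (t : ℕ) (s : Finset ℕ) : Prop := ∀ b, b + t ∈ s → b ∈ s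

variable {k : ℕ} {μ : YoungDiagram}

theorem mem_betaSet {b : ℕ} :
    b ∈ betaSet k μ ↔ ∃ i < k, μ.rowLen i + (k - 1 - i) = b := by
  simp [betaSet, betaNumber]

theorem betaNumber_strictAnti {i j : ℕ} (hij : i < j) (hj : j < k) :
    betaNumber k μ j < betaNumber k μ i := by
  have := μ.rowLen_anti i j hij.le
  simp only [betaNumber]
  omega

theorem betaNumber_injOn : Set.InjOn (betaNumber k μ) (range k : Set ℕ) := by
  intro i hi j hj h
  simp only [coe_range, Set.mem_Iio] at hi hj
  rcases lt_trichotomy i j with hij | hij | hij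
  · exact absurd h (betaNumber_strictAnti hij hj).ne'
  · exact hij
  · exact absurd h (betaNumber_strictAnti hij hi).ne

theorem card_betaSet : (betaSet k μ).card = k := by
  rw [betaSet, card_image_of_injOn betaNumber_injOn, card_range]

theorem rowLen_eq_zero (hμ : μ.colLen 0 ≤ k) {i : ℕ} (hi : k ≤ i) : μ.rowLen i = 0 := by
  by_contra h
  have h1 : (i, 0) ∈ μ := YoungDiagram.mem_iff_lt_rowLen.2 (by omega)
  have := YoungDiagram.mem_iff_lt_colLen.1 h1
  omega

theorem card_eq_sum_rowLen (hμ : μ.colLen 0 ≤ k) : μ.card = ∑ i ∈ range k, μ.rowLen i := by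
  have h : ∀ c ∈ μ.cells, c.1 ∈ range k := by
    intro c hc
    have h1 : (c.1, c.2) ∈ μ := hc
    have := YoungDiagram.mem_iff_lt_colLen.1 (μ.up_left_mem le_rfl (Nat.zero_le c.2) h1)
    rw [mem_range]
    omega
  rw [YoungDiagram.card, card_eq_sum_card_fiberwise h]
  refine sum_congr rfl fun i _ => ?_
  rw [YoungDiagram.rowLen_eq_card]
  rfl

theorem sum_betaSet (hμ : μ.colLen 0 ≤ k) :
    ∑ b ∈ betaSet k μ, b = μ.card + ∑ i ∈ range k, i := by
  rw [betaSet, sum_image betaNumber_injOn, card_eq_sum_rowLen hμ]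
  simp only [betaNumber]
  rw [sum_add_distrib, sum_range_reflect (fun i => i) k]

theorem youngDiagram_ext_rowLen {ν : YoungDiagram} (h : ∀ i, μ.rowLen i = ν.rowLen i) : μ = ν := by
  ext ⟨i, j⟩
  rw [YoungDiagram.mem_cells, YoungDiagram.mem_cells, YoungDiagram.mem_iff_lt_rowLen,
    YoungDiagram.mem_iff_lt_rowLen, h]

theorem betaNumber_eq_of_betaSet_eq {ν : YoungDiagram} (h : betaSet k μ = betaSet k ν) {i : ℕ}
    (hi : i < k) : betaNumber k μ i = betaNumber k ν i := by
  have key : ∀ {μ ν : YoungDiagram}, betaSet k μ = betaSet k ν → ∀ i < k,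
      (∀ j < i, betaNumber k μ j = betaNumber k ν j) → betaNumber k μ i ≤ betaNumber k ν i := by
    intro μ ν h i hi ih
    have h1 : betaNumber k μ i ∈ betaSet k ν := h ▸ mem_image_of_mem _ (mem_range.2 hi)
    obtain ⟨j, hj, h2⟩ := mem_image.1 h1
    rw [mem_range] at hj
    rcases lt_trichotomy j i with hji | rfl | hij
    · rw [← ih j hji] at h2
      exact absurd h2 (betaNumber_strictAnti hji hi).ne'
    · exact h2.ge
    · rw [← h2]
      exact (betaNumber_strictAnti hij hj).le
  induction i using Nat.strong_induction_on with
  | _ i ih =>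
    exact le_antisymm (key h i hi fun j hj => ih j hj (hj.trans hi))
      (key h.symm i hi fun j hj => (ih j hj (hj.trans hi)).symm)

theorem betaSet_injective {ν : YoungDiagram} (hμ : μ.colLen 0 ≤ k) (hν : ν.colLen 0 ≤ k)
    (h : betaSet k μ = betaSet k ν) : μ = ν := by
  refine youngDiagram_ext_rowLen fun i => ?_
  by_cases hi : i < k
  · have := betaNumber_eq_of_betaSet_eq h hi
    simpa [betaNumber] using this
  · rw [rowLen_eq_zero hμ (by omega), rowLen_eq_zero hν (by omega)]

/-- The diagram with prescribed row lengths. -/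
def diagramOfRows (f : ℕ → ℕ) (hf : Antitone f) (k : ℕ) : YoungDiagram where
  cells := (range k ×ˢ range (f 0)).filter fun p => p.2 < f p.1
  isLowerSet := by
    rintro ⟨i, j⟩ ⟨i', j'⟩ ⟨hi, hj⟩ h
    simp only [coe_filter, mem_product, mem_range, Set.mem_ofPred_eq] at h hi hj ⊢
    have := hf hi
    omega

theorem rowLen_diagramOfRows {f : ℕ → ℕ} (hf : Antitone f) (h0 : f k = 0) (i : ℕ) :
    (diagramOfRows f hf k).rowLen i = f i := by
  have h : ∀ j, (i, j) ∈ diagramOfRows f hf k ↔ j < f i := by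
    intro j
    rw [← YoungDiagram.mem_cells]
    simp only [diagramOfRows, mem_filter, mem_product, mem_range]
    refine ⟨fun h => h.2, fun h => ⟨⟨?_, h.trans_le (hf (Nat.zero_le i))⟩, h⟩⟩
    by_contra hk
    have := hf (not_lt.1 hk)
    omega
  refine le_antisymm (le_of_not_gt fun h1 => ?_) (le_of_not_gt fun h1 => ?_)
  · exact lt_irrefl _ ((h _).1 (YoungDiagram.mem_iff_lt_rowLen.2 h1))
  · exact lt_irrefl _ (YoungDiagram.mem_iff_lt_rowLen.1 ((h _).2 h1))

theorem exists_betaSet_eq {s : Finset ℕ} (hs : s.card = k) :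
    ∃ μ : YoungDiagram, μ.colLen 0 ≤ k ∧ betaSet k μ = s := by
  let e := s.orderEmbOfFin hs
  have hmono : ∀ i j : Fin k, i ≤ j → (e i : ℕ) + (j - i) ≤ e j := by
    intro i j hij
    obtain ⟨j, hj⟩ := j
    induction j with
    | zero =>
      have : i = ⟨0, hj⟩ := Fin.ext (by have := Fin.le_def.1 hij; simpa using this)
      rw [this]; simp
    | succ j ih =>
      rcases hij.eq_or_lt with h | h
      · rw [h]; simp
      · have hlt : i.val < j + 1 := h
        have h1 := ih (by omega) (Fin.le_def.2 (by simp only; omega))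
        have h2 : e ⟨j, by omega⟩ < e ⟨j + 1, hj⟩ := e.strictMono (Fin.lt_def.2 (by simp))
        simp only at h1 ⊢
        omega
  -- Row i is the element of rank k - 1 - i of s, counted from the smallest, minus that rank. By
  -- `hmono` consecutive gaps are at least 1, so the rows weakly decrease.
  let f : ℕ → ℕ := fun i => if h : i < k then e ⟨k - 1 - i, by omega⟩ - (k - 1 - i) else 0
  have hf : Antitone f := by
    refine antitone_nat_of_succ_le fun i => ?_
    simp only [f]
    split_ifs with h1 h2
    · have := hmono ⟨k - 1 - (i + 1), by omega⟩ ⟨k - 1 - i, by omega⟩ (Fin.le_def.2 (by simp only; omega))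
      simp only at this
      omega
    · omega
    · exact Nat.zero_le _
    · exact le_rfl
  have h0 : f k = 0 := dif_neg (lt_irrefl k)
  refine ⟨diagramOfRows f hf k, ?_, ?_⟩
  · by_contra h
    have h1 := YoungDiagram.mem_iff_lt_rowLen.1 (YoungDiagram.mem_iff_lt_colLen.2 (not_le.1 h))
    rw [rowLen_diagramOfRows hf h0, h0] at h1
    exact lt_irrefl _ h1
  · have hβ : ∀ i (hi : i < k), betaNumber k (diagramOfRows f hf k) i = e ⟨k - 1 - i, by omega⟩ := by
      intro i hi
      rw [betaNumber, rowLen_diagramOfRows hf h0]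
      simp only [f]
      rw [dif_pos hi]
      have := hmono ⟨0, by omega⟩ ⟨k - 1 - i, by omega⟩ (Fin.le_def.2 (by simp))
      simp only at this
      omega
    refine eq_of_subset_of_card_le (fun b hb => ?_) (by rw [hs, card_betaSet])
    obtain ⟨i, hi, rfl⟩ := mem_image.1 hb
    rw [hβ i (mem_range.1 hi)]
    exact s.orderEmbOfFin_mem hs _

/-- Each number outside the beta-set comes from a column. -/
theorem exists_colLen_of_notMem_betaSet (hμ : μ.colLen 0 ≤ k) {c : ℕ} (hc : c ∉ betaSet k μ) :
    ∃ j, c + μ.colLen j = j + k := by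
  have hex : ∃ i, k ≤ i ∨ betaNumber k μ i ≤ c := ⟨k, Or.inl le_rfl⟩
  classical
  -- i₀ counts the beta numbers exceeding c; the required column is j = c + i₀ - k, of length i₀.
  obtain ⟨i₀, h1, h2⟩ : ∃ i, (k ≤ i ∨ betaNumber k μ i ≤ c) ∧
      ∀ j < i, ¬ (k ≤ j ∨ betaNumber k μ j ≤ c) :=
    ⟨Nat.find hex, Nat.find_spec hex, fun j hj => Nat.find_min hex hj⟩
  have hi₀ : i₀ ≤ k := by
    by_contra h
    exact h2 k (by omega) (Or.inl le_rfl)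
  have h3 : k ≤ c + i₀ ∧ (∀ j, j + k = c + i₀ → μ.rowLen i₀ ≤ j) := by
    rcases hi₀.eq_or_lt with rfl | hlt
    · exact ⟨by omega, fun j _ => by rw [rowLen_eq_zero hμ le_rfl]; exact Nat.zero_le j⟩
    · have h4 : betaNumber k μ i₀ ≤ c := h1.resolve_left (by omega)
      have h5 : betaNumber k μ i₀ ≠ c := fun h =>
        hc (h ▸ mem_image_of_mem _ (mem_range.2 hlt))
      simp only [betaNumber] at h4 h5
      exact ⟨by omega, fun j _ => by omega⟩
  refine ⟨c + i₀ - k, ?_⟩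
  have h6 : μ.colLen (c + i₀ - k) ≤ i₀ := by
    by_contra h
    have := YoungDiagram.mem_iff_lt_rowLen.1 (YoungDiagram.mem_iff_lt_colLen.2 (not_le.1 h))
    have := h3.2 (c + i₀ - k) (by omega)
    omega
  have h7 : i₀ ≤ μ.colLen (c + i₀ - k) := by
    rcases i₀.eq_zero_or_pos with rfl | hpos
    · exact Nat.zero_le _
    · have h8 := h2 (i₀ - 1) (by omega)
      simp only [betaNumber, not_or, not_le] at h8
      have := YoungDiagram.mem_iff_lt_colLen.1 (YoungDiagram.mem_iff_lt_rowLen.2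
        (show c + i₀ - k < μ.rowLen (i₀ - 1) by omega))
      omega
  omega

theorem IsFlush.sub_mul_mem {t : ℕ} {s : Finset ℕ} (hs : IsFlush t s) {b m : ℕ}
    (h : b + t * m ∈ s) : b ∈ s := by
  induction m with
  | zero => simpa using h
  | succ m ih => exact ih (hs _ (by rwa [add_assoc, ← Nat.mul_succ]))

/-- A partition is a `t`-core exactly when its beta-set is flush. -/
theorem isTCore_iff_isFlush {t : ℕ} (ht : 0 < t) (hμ : μ.colLen 0 ≤ k) :
    IsTCore t μ ↔ IsFlush t (betaSet k μ) := by
  constructor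
  · intro h b hb
    by_contra hbs
    -- The hook number at (i, j) is the beta number of row i minus the gap k + j - μ.colLen j
    -- belonging to column j, so b + t and b give a hook number equal to t.
    obtain ⟨j, hj⟩ := exists_colLen_of_notMem_betaSet hμ hbs
    obtain ⟨i, hi, hib⟩ := mem_betaSet.1 hb
    have hmem : (i, j) ∈ μ := by
      by_contra hn
      have h1 := mt YoungDiagram.mem_iff_lt_rowLen.2 hn
      have h2 := mt YoungDiagram.mem_iff_lt_colLen.2 hn
      omega
    have h1 := YoungDiagram.mem_iff_lt_rowLen.1 hmem
    have h2 := YoungDiagram.mem_iff_lt_colLen.1 hmem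
    refine h i j hmem ⟨1, ?_⟩
    rw [hookNumber]
    omega
  · rintro h i j hmem ⟨m, hm⟩
    have h1 := YoungDiagram.mem_iff_lt_rowLen.1 hmem
    have h2 := YoungDiagram.mem_iff_lt_colLen.1 hmem
    have h3 := μ.colLen_anti 0 j (Nat.zero_le j)
    rw [hookNumber] at hm
    have h4 : k + j - μ.colLen j + t * m ∈ betaSet k μ :=
      mem_betaSet.2 ⟨i, by omega, by omega⟩
    -- Flushness would make the gap of column j a beta number. It is not: rows i' above the foot of
    -- column j have larger beta numbers, rows below it smaller ones.
    obtain ⟨i', hi', h5⟩ := mem_betaSet.1 (h.sub_mul_mem h4)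
    by_cases h6 : i' < μ.colLen j
    · have := YoungDiagram.mem_iff_lt_rowLen.1 (YoungDiagram.mem_iff_lt_colLen.2 h6)
      omega
    · have := mt YoungDiagram.mem_iff_lt_rowLen.2 (mt YoungDiagram.mem_iff_lt_colLen.1 h6)
      omega

theorem colLen_zero_le_card (μ : YoungDiagram) : μ.colLen 0 ≤ μ.card := by
  rw [YoungDiagram.colLen_eq_card]
  exact card_le_card (filter_subset _ _)

/-- As k ≥ n, every partition of n has at most k rows. Its size is the bead sum minus the bead sum 0
+ 1 + ⋯ + (k - 1) of the empty partition. -/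
theorem ncard_tCores {t n : ℕ} (ht : 0 < t) (hk : n ≤ k) :
    (tCores t n).ncard =
      {s : Finset ℕ | s.card = k ∧ IsFlush t s ∧ ∑ b ∈ s, b = n + ∑ i ∈ range k, i}.ncard := by
  have hcol : ∀ {μ : YoungDiagram}, μ ∈ tCores t n → μ.card = n ∧ μ.colLen 0 ≤ k := by
    rintro μ ⟨h1, -⟩
    have h1 : μ.card = n := by exact_mod_cast h1
    exact ⟨h1, (colLen_zero_le_card μ).trans (by omega)⟩
  refine Set.ncard_congr (fun μ _ => betaSet k μ) (fun μ hμ => ?_) (fun μ ν hμ hν h => ?_)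
    fun s hs => ?_
  · have h := hcol hμ
    exact ⟨card_betaSet, (isTCore_iff_isFlush ht h.2).1 hμ.2, by rw [sum_betaSet h.2, h.1]⟩
  · exact betaSet_injective (hcol hμ).2 (hcol hν).2 h
  · obtain ⟨hcard, hflush, hsum⟩ := hs
    obtain ⟨μ, hμ, rfl⟩ := exists_betaSet_eq hcard
    rw [sum_betaSet hμ] at hsum
    exact ⟨μ, ⟨by exact_mod_cast Nat.add_right_cancel hsum, (isTCore_iff_isFlush ht hμ).2 hflush⟩, rfl⟩

/-- The flush abacus with `c r` beads on runner `r`. -/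
def abacus (c : Fin 5 → ℕ) : Finset ℕ :=
  univ.biUnion fun r : Fin 5 => (range (c r)).image fun m => r.val + 5 * m

theorem add_five_mul_mem_abacus {c : Fin 5 → ℕ} {r : Fin 5} {m : ℕ} :
    r.val + 5 * m ∈ abacus c ↔ m < c r := by
  simp only [abacus, mem_biUnion, mem_univ, true_and, mem_image, mem_range]
  constructor
  · rintro ⟨r', m', h, h'⟩
    obtain rfl : m' = m := by omega
    obtain rfl : r' = r := Fin.ext (by omega)
    exact h
  · exact fun h => ⟨r, m, h, rfl⟩

theorem exists_eq_add_five_mul (b : ℕ) : ∃ (r : Fin 5) (m : ℕ), b = r.val + 5 * m :=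
  ⟨⟨b % 5, Nat.mod_lt _ (by norm_num)⟩, b / 5, (Nat.mod_add_div b 5).symm⟩

theorem isFlush_abacus (c : Fin 5 → ℕ) : IsFlush 5 (abacus c) := by
  intro b hb
  obtain ⟨r, m, rfl⟩ := exists_eq_add_five_mul b
  rw [show r.val + 5 * m + 5 = r.val + 5 * (m + 1) by ring, add_five_mul_mem_abacus] at hb
  rw [add_five_mul_mem_abacus]
  omega

theorem abacus_injective : Function.Injective abacus := by
  intro c c' h
  ext r
  have h1 : ∀ m, m < c r ↔ m < c' r := fun m => by
    rw [← add_five_mul_mem_abacus, h, add_five_mul_mem_abacus]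
  have := h1 (c r)
  have := h1 (c' r)
  omega

theorem exists_abacus_eq {s : Finset ℕ} (hs : IsFlush 5 s) : ∃ c, abacus c = s := by
  classical
  have hex : ∀ r : Fin 5, ∃ m, r.val + 5 * m ∉ s := by
    intro r
    obtain ⟨N, hN⟩ := s.exists_nat_subset_range
    refine ⟨N, fun h => ?_⟩
    have := mem_range.1 (hN h)
    omega
  refine ⟨fun r => Nat.find (hex r), ?_⟩
  ext b
  obtain ⟨r, m, rfl⟩ := exists_eq_add_five_mul b
  rw [add_five_mul_mem_abacus]
  constructor
  · intro h
    by_contra h'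
    exact Nat.find_min (hex r) h h'
  · intro h
    by_contra h'
    obtain ⟨d, hd⟩ := Nat.exists_eq_add_of_le (not_lt.1 h')
    refine Nat.find_spec (hex r) (hs.sub_mul_mem (m := d) ?_)
    rwa [add_assoc, ← mul_add, ← hd]

theorem sum_abacus {A : Type*} [AddCommMonoid A] (c : Fin 5 → ℕ) (f : ℕ → A) :
    ∑ b ∈ abacus c, f b = ∑ r : Fin 5, ∑ m ∈ range (c r), f (r.val + 5 * m) := by
  rw [abacus, sum_biUnion]
  · refine sum_congr rfl fun r _ => sum_image fun a _ b _ h => ?_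
    simpa using h
  · intro r _ r' _ hrr'
    rw [Function.onFun, disjoint_left]
    intro b hb hb'
    obtain ⟨m, -, rfl⟩ := mem_image.1 hb
    obtain ⟨m', -, h⟩ := mem_image.1 hb'
    exact hrr' (Fin.ext (by omega))

theorem card_abacus (c : Fin 5 → ℕ) : (abacus c).card = ∑ r, c r := by
  rw [card_eq_sum_ones, sum_abacus]
  simp

theorem two_mul_sum_abacus (c : Fin 5 → ℕ) :
    2 * ((∑ b ∈ abacus c, b : ℕ) : ℤ) = ∑ r : Fin 5, (2 * r.val * c r + 5 * (c r * (c r - 1)) : ℤ) := by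
  rw [sum_abacus, Nat.cast_sum, mul_sum]
  refine sum_congr rfl fun r _ => ?_
  induction c r with
  | zero => simp
  | succ m ih =>
    rw [sum_range_succ]
    push_cast at ih ⊢
    linear_combination ih

theorem two_mul_sum_range (k : ℕ) : 2 * ((∑ i ∈ range k, i : ℕ) : ℤ) = k * (k - 1) := by
  induction k with
  | zero => simp
  | succ k ih =>
    rw [sum_range_succ]
    push_cast at ih ⊢
    linear_combination ih

/-- Adding K beads to each runner changes the quadratic form by a multiple of ∑ v r = 0 and by a
constant, the bead sum of the empty core. -/
theorem sum_abacus_eq_iff {c : Fin 5 → ℕ} {v : Fin 5 → ℤ} {n K : ℕ} (hc : ∀ r, (c r : ℤ) = v r + K)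
    (hv : ∑ r, v r = 0) :
    ∑ b ∈ abacus c, b = n + ∑ i ∈ range (5 * K), i ↔ coreExp v = n := by
  have h1 := two_mul_sum_abacus c
  have h2 := two_mul_sum_range (5 * K)
  have h3 : 2 * (coreExp v : ℤ) = ∑ r : Fin 5, (5 * (v r * (v r - 1)) + 2 * r.val * v r : ℤ) := by
    rw [coreExp, Nat.cast_sum, mul_sum]
    exact sum_congr rfl fun r _ => two_mul_thetaExp (by omega) (v r)
  simp only [Fin.sum_univ_five, hc] at h1 h3 hv
  simp at h1 h3
  push_cast at h2
  have h4 : 2 * ((∑ b ∈ abacus c, b : ℕ) : ℤ) =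
      2 * (coreExp v : ℤ) + 2 * ((∑ i ∈ range (5 * K), i : ℕ) : ℤ) := by
    push_cast
    rw [h1, h2, h3]
    linear_combination (10 * K : ℤ) * hv
  omega

theorem ncard_tCores_five (n : ℕ) :
    (tCores 5 n).ncard = {v : Fin 5 → ℤ | ∑ r, v r = 0 ∧ coreExp v = n}.ncard := by
  -- With n + 1 beads per runner as origin, v r + n + 1 is never negative, because |v r| ≤ coreExp v
  -- + 1.
  rw [ncard_tCores (k := 5 * (n + 1)) (by norm_num) (by omega)]
  symm
  have hbound : ∀ v : Fin 5 → ℤ, coreExp v = n → ∀ r,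
      ((v r + (n + 1 : ℕ)).toNat : ℤ) = v r + (n + 1 : ℕ) := by
    intro v hv r
    have h1 := natAbs_le_of_exponent (by norm_num) (by omega)
      (two_mul_thetaExp (s := 5) (r := r) (by omega) (v r))
    have h2 : thetaExp 5 r (v r) ≤ coreExp v :=
      single_le_sum (f := fun r : Fin 5 => thetaExp 5 r (v r)) (fun _ _ => Nat.zero_le _)
        (mem_univ r)
    omega
  refine Set.ncard_congr (fun v _ => abacus fun r => (v r + (n + 1 : ℕ)).toNat)
    (fun v hv => ?_) (fun v w hv hw h => ?_) fun s hs => ?_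
  · refine ⟨?_, isFlush_abacus _, (sum_abacus_eq_iff (hbound v hv.2) hv.1).2 hv.2⟩
    rw [card_abacus]
    have h := sum_congr rfl fun (r : Fin 5) (_ : r ∈ univ) => hbound v hv.2 r
    rw [sum_add_distrib, hv.1, ← Nat.cast_sum] at h
    simp only [sum_const, card_univ, Fintype.card_fin, nsmul_eq_mul, zero_add] at h
    exact_mod_cast h
  · ext r
    have h1 := congrFun (abacus_injective h) r
    have h2 := hbound v hv.2 r
    have h3 := hbound w hw.2 r
    omega
  · obtain ⟨hcard, hflush, hsum⟩ := hs
    obtain ⟨c, rfl⟩ := exists_abacus_eq hflush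
    rw [card_abacus] at hcard
    have hv : ∑ r, ((c r : ℤ) - (n + 1 : ℕ)) = 0 := by
      rw [sum_sub_distrib, ← Nat.cast_sum, hcard]
      simp
    refine ⟨fun r => c r - (n + 1 : ℕ), ⟨hv, ?_⟩, ?_⟩
    · exact (sum_abacus_eq_iff (fun r => by ring) hv).1 hsum
    · simp

end BetaSets

/-- `c₅(n) = ∑ χ(d) (n + 1) / d` over the divisors `d` of `n + 1`. -/
theorem c5_natCast (n : ℕ) : c5 n = sigmaA (n + 1) := by
  have h : PowerSeries.mk sigmaA = PowerSeries.X *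
      latSum (fun v : Fin 5 → ℤ => if ∑ r, v r = 0 then 1 else 0) coreExp := by
    refine mul_left_cancel₀ (eulerProd_ne_zero (R := ℤ) one_pos) ?_
    rw [eulerProd_one_mul_lambert, mul_left_comm, eulerProd_one_mul_latSum_core]
  have h1 := congrArg (PowerSeries.coeff (n + 1)) h
  rw [PowerSeries.coeff_mk, PowerSeries.coeff_succ_X_mul, coeff_latSum_core] at h1
  rw [h1, c5, ncard_tCores_five]

/-! ### The thirteen identities by residue class -/

theorem theorem5 (n : ℤ) (hn : 0 ≤ n) :
    b5 (4 * n + 1) = c5 n - 2 * b5 (2 * n - 1) ∧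
    (b5 (10 * n) : ℚ) = 1 / 2 * (c5 (10 * n + 2) : ℚ) ∧
    b5 (10 * n + 1) = c5 (5 * n + 1) ∧
    (b5 (10 * n + 2) : ℚ) = 1 / 4 * (a5 (2 * n + 1) : ℚ) + 1 / 2 * (c5 (2 * n) : ℚ) ∧
    b5 (10 * n + 3) = c5 (5 * n + 2) ∧
    (b5 (10 * n + 4) : ℚ) = 1 / 2 * (c5 (10 * n + 6) : ℚ) ∧
    b5 (10 * n + 6) = 0 ∧
    b5 (10 * n + 8) = 0 ∧
    b5 (20 * n + 5) = -c5 (5 * n + 1) ∧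
    (b5 (20 * n + 7) : ℚ) = 1 / 2 * (a5 (2 * n + 1) : ℚ) + (c5 (2 * n) : ℚ) ∧
    b5 (20 * n + 9) = -c5 (5 * n + 2) ∧
    b5 (20 * n + 15) = 0 ∧
    b5 (20 * n + 19) = 0 := by
  lift n to ℕ using hn
  have hE : ∀ (m : ℤ) (k : ℕ), m = (2 * k : ℕ) → 4 * b5 m = sigmaDiff (2 * k + 3) := by
    rintro _ k rfl
    exact four_mul_b5_even k
  have hO : ∀ (m : ℤ) (k : ℕ), m = (2 * k + 1 : ℕ) →
      2 * b5 m = sigmaDiff (k + 2) - sigmaDiffHalf (k + 2) := by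
    rintro _ k rfl
    exact two_mul_b5_odd k
  have hc : ∀ (m : ℤ) (k : ℕ), m = k → c5 m = sigmaA (k + 1) := by
    rintro _ k rfl
    exact c5_natCast k
  have ha : a5 (2 * (n : ℤ) + 1) = 3 * sigmaA (2 * n + 1) - sigmaB (2 * n + 1) := by
    rw [← a5_odd]
    push_cast
    rfl
  have hc1 := hc (5 * n + 1) (5 * n + 1) (by push_cast; ring)
  have hc2 := hc (5 * n + 2) (5 * n + 2) (by push_cast; ring)
  have hc0 := hc (2 * n) (2 * n) (by push_cast; ring)
  refine ⟨?_, ?_, ?_, ?_, ?_, ?_, ?_, ?_, ?_, ?_, ?_, ?_, ?_⟩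
  · have h1 := hO (4 * n + 1) (2 * n) (by push_cast; ring)
    have h2 := sigmaDiff_two_mul (n := n + 1) (by omega)
    have h3 : sigmaDiffHalf (2 * (n + 1)) = sigmaDiff (n + 1) := by
      rw [sigmaDiffHalf, if_pos (Dvd.intro _ rfl), Nat.mul_div_cancel_left _ two_pos]
    have h4 : 2 * b5 (2 * n - 1) = sigmaDiff (n + 1) - sigmaDiffHalf (n + 1) := by
      -- For n = 0 the convention b̄₅(-1) = 0 agrees with D(1) = 0.
      rcases n with _ | k
      · rw [sigmaDiff_eq_zero (by norm_num), sigmaDiffHalf_eq_zero (by norm_num), b5,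
          if_neg (by norm_num)]
        norm_num
      · exact hO _ k (by push_cast; ring)
    rw [show 2 * n + 2 = 2 * (n + 1) by ring, h2, h3] at h1
    rw [hc n n rfl]
    linarith
  · have h1 := hE (10 * n) (5 * n) (by push_cast; ring)
    rw [sigmaDiff_eq_two_mul (by omega)] at h1
    rw [hc (10 * n + 2) (10 * n + 2) (by push_cast; ring)]
    rw [show 2 * (5 * n) + 3 = 10 * n + 2 + 1 by ring] at h1
    have : (4 : ℚ) * b5 (10 * n) = 2 * sigmaA (10 * n + 2 + 1) := by exact_mod_cast h1
    linarith
  · have h1 := hO (10 * n + 1) (5 * n) (by push_cast; ring)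
    rw [sigmaDiff_eq_two_mul (by omega), sigmaDiffHalf_eq_zero (by omega)] at h1
    rw [hc1]
    linarith
  · have h1 := hE (10 * n + 2) (5 * n + 1) (by push_cast; ring)
    -- 5σ_A - σ_B = (3σ_A - σ_B) + 2σ_A at 2n + 1, the first bracket being ā₅(2n+1).
    rw [show 2 * (5 * n + 1) + 3 = 5 * (2 * n + 1) by ring, sigmaDiff_five_mul (by omega)] at h1
    rw [ha, hc0]
    have : (4 : ℚ) * b5 (10 * n + 2) = 5 * sigmaA (2 * n + 1) - sigmaB (2 * n + 1) := by
      exact_mod_cast h1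
    push_cast
    linarith
  · have h1 := hO (10 * n + 3) (5 * n + 1) (by push_cast; ring)
    rw [sigmaDiff_eq_two_mul (by omega), sigmaDiffHalf_eq_zero (by omega)] at h1
    rw [hc2]
    linarith
  · have h1 := hE (10 * n + 4) (5 * n + 2) (by push_cast; ring)
    rw [sigmaDiff_eq_two_mul (by omega)] at h1
    rw [hc (10 * n + 6) (10 * n + 6) (by push_cast; ring)]
    rw [show 2 * (5 * n + 2) + 3 = 10 * n + 6 + 1 by ring] at h1
    have : (4 : ℚ) * b5 (10 * n + 4) = 2 * sigmaA (10 * n + 6 + 1) := by exact_mod_cast h1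
    linarith
  · have h1 := hE (10 * n + 6) (5 * n + 3) (by push_cast; ring)
    rw [sigmaDiff_eq_zero (by omega)] at h1
    linarith
  · have h1 := hE (10 * n + 8) (5 * n + 4) (by push_cast; ring)
    rw [sigmaDiff_eq_zero (by omega)] at h1
    linarith
  · have h1 := hO (20 * n + 5) (10 * n + 2) (by push_cast; ring)
    -- The main term vanishes since 10n + 4 ≡ 4 mod 5; only the half-argument 5n + 2 contributes,
    -- hence the minus sign.
    rw [sigmaDiff_eq_zero (by omega), sigmaDiffHalf, if_pos (by omega),
      show (10 * n + 2 + 2) / 2 = 5 * n + 1 + 1 by omega, sigmaDiff_eq_two_mul (by omega)] at h1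
    rw [hc1]
    linarith
  · have h1 := hO (20 * n + 7) (10 * n + 3) (by push_cast; ring)
    rw [show 10 * n + 3 + 2 = 5 * (2 * n + 1) by ring, sigmaDiff_five_mul (by omega),
      sigmaDiffHalf_eq_zero (by omega)] at h1
    rw [ha, hc0]
    have : (2 : ℚ) * b5 (20 * n + 7) = 5 * sigmaA (2 * n + 1) - sigmaB (2 * n + 1) - 0 := by
      exact_mod_cast h1
    push_cast
    linarith
  · have h1 := hO (20 * n + 9) (10 * n + 4) (by push_cast; ring)
    rw [sigmaDiff_eq_zero (by omega), sigmaDiffHalf, if_pos (by omega),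
      show (10 * n + 4 + 2) / 2 = 5 * n + 2 + 1 by omega, sigmaDiff_eq_two_mul (by omega)] at h1
    rw [hc2]
    linarith
  · have h1 := hO (20 * n + 15) (10 * n + 7) (by push_cast; ring)
    rw [sigmaDiff_eq_zero (by omega), sigmaDiffHalf_eq_zero (by omega)] at h1
    linarith
  · have h1 := hO (20 * n + 19) (10 * n + 9) (by push_cast; ring)
    rw [sigmaDiff_eq_zero (by omega), sigmaDiffHalf_eq_zero (by omega)] at h1
    linarith
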